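/- \textbf{Setting.} Let $\mathcal X$ be a finite set, $p_X$ a probability distribution on $\mathcal X$, $\mathcal H_B$ a complex Hilbert space (of arbitrary dimension), and for each $x\in\mathcal X$ let $\rho_B^x$ be a density operator (positive, trace one) on $\mathcal H_B$. Put $\rho_{XB}=\sum_x p_X(x)|x\rangle\langle x|\otimes\rho_B^x$, with marginals $\rho_X$ and $\rho_B=\sum_x p_X(x)\rho_B^x$. Let $\|T\|_\alpha=(\operatorname{Tr}|T|^\alpha)^{1/\alpha}$ and let $\log$ be the natural logarithm. For $\alpha>1$ and density operators $\rho,\sigma$ let $$D^*_\alpha(\rho\|\sigma)=\frac{\alpha}{\alpha-1}\log\Big\|\sigma^{\frac{1-\alpha}{2\alpha}}\rho\,\sigma^{\frac{1-\alpha}{2\alpha}}\Big\|_\alpha ,$$ where negative powers are taken on the support of $\sigma$. That is, the operator in the norm is the positive bounded operator $\tau$ that vanishes on $\ker\sigma$ and satisfies $\sigma^{\frac{\alpha-1}{2\alpha}}\tau\sigma^{\frac{\alpha-1}{2\alpha}}=\rho$; if no such $\tau$ exists, or if $\|\tau\|_\alpha=\infty$, then $D^*_\alpha(\rho\|\sigma)=+\infty$.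 The order-$\alpha$ sandwiched Augustin information is $$\breve I^*_\alpha(X{:}B)_\rho=\inf_{\sigma}\sum_{x}p_X(x)D^*_\alpha(\rho_B^x\|\sigma),$$ the infimum being over all density operators $\sigma$ on $\mathcal H_B$ (with $0\cdot\infty=0$), and the quantum mutual information is $I(X{:}B)_\rho=D(\rho_{XB}\|\rho_X\otimes\rho_B)$, where $D(\rho\|\sigma)=\operatorname{Tr}[\rho(\log\rho-\log\sigma)]$ is the relative entropy. Let $n\ge1$ be such that $n\,p_X(x)$ is a nonnegative integer for every $x$, let $T_p^n\subseteq\mathcal X^n$ be the set of sequences with empirical distribution $p_X$, and let $\breve p_{X^n}$ be the uniform distribution on $T_p^n$. For $x^n\in\mathcal X^n$ put $\rho_{B^n}^{x^n}=\rho_B^{x_1}\otimes\cdots\otimes\rho_B^{x_n}$, and let $\breve\rho_{B^n}=\sum_{x^n}\breve p_{X^n}(x^n)\rho_{B^n}^{x^n}$. Let $\breve{\mathcal C}^n=(x^n(1),\dots,x^n(M))$ consist of $M\ge1$ independent codewords with law $\breve p_{X^n}$, let $\rho_{B^n}^{\breve{\mathcal C}^n}=\frac1M\sum_{m=1}^M\rho_{B^n}^{x^n(m)}$,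 and let $R=\frac1n\log M$. \textbf{Theorem.} With $$E(R)=\sup_{\alpha\in(1,2)}\frac{1-\alpha}{\alpha}\big(\breve I^*_\alpha(X{:}B)_\rho-R\big)$$ one has $$\frac12\,\mathbb E_{\breve{\mathcal C}^n}\big\|\rho_{B^n}^{\breve{\mathcal C}^n}-\breve\rho_{B^n}\big\|_1\le e^{-nE(R)} .$$ Moreover, $E(R)>0$ if and only if $R>I(X{:}B)_\rho$. -/

import Mathlib

open scoped ENNReal lp

noncomputable section

namespace SoftCovering

/-! ### Operators on a Hilbert space: trace, Schatten norms, density operators -/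

section Operators

variable {H : Type*} [NormedAddCommGroup H] [InnerProductSpace ℂ H] [CompleteSpace H]

/-- The trace of a positive operator, as an element of `[0, ∞]`: the sum of the diagonal entries
in an orthonormal basis (the value does not depend on the basis). -/
def trace (T : H →L[ℂ] H) : ℝ≥0∞ :=
  ∑' i, ENNReal.ofReal
    (inner ℂ ((exists_hilbertBasis ℂ H).choose_spec.choose i)
      (T ((exists_hilbertBasis ℂ H).choose_spec.choose i))).re

/-- The Schatten norm `‖T‖_p = (Tr |T|^p)^{1/p}`, equal to `∞` off the Schatten class. -/
def schattenNorm (p : ℝ) (T : H →L[ℂ] H) : ℝ≥0∞ :=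
  trace (CFC.rpow (CFC.abs T) p) ^ (1 / p)

/-- Density operators: positive operators with unit trace. -/
def IsDensity (ρ : H →L[ℂ] H) : Prop := 0 ≤ ρ ∧ trace ρ = 1

/-! ### Divergences -/

/-- `τ = σ^{-γ} ρ σ^{-γ}` for `γ > 0`, the inverse being taken on the support of `σ`: the positive
operator `τ` vanishes on `ker σ` and `σ^γ τ σ^γ = ρ`. There is at most one such `τ`. -/
def IsSandwich (γ : ℝ) (ρ σ τ : H →L[ℂ] H) : Prop :=
  0 ≤ τ ∧ (∀ v, σ v = 0 → τ v = 0) ∧ CFC.rpow σ γ * τ * CFC.rpow σ γ = ρ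

/-- The sandwiched Rényi divergence of order `α > 1`,
`D*_α(ρ‖σ) = α/(α-1) · log ‖σ^{(1-α)/(2α)} ρ σ^{(1-α)/(2α)}‖_α`, with value `+∞` if
`σ^{(1-α)/(2α)} ρ σ^{(1-α)/(2α)}` does not exist or is not of Schatten class `α`. The infimum below
is over the at most one operator equal to that product. -/
def sandwichedDiv (α : ℝ) (ρ σ : H →L[ℂ] H) : EReal :=
  ⨅ (τ : H →L[ℂ] H) (_ : IsSandwich ((α - 1) / (2 * α)) ρ σ τ),
    ((α / (α - 1) : ℝ) : EReal) * ENNReal.log (schattenNorm α τ)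

/-- `e` is an orthonormal basis of eigenvectors of `T`, with eigenvalues `l`. -/
def IsEigenbasis {κ : Type*} (T : H →L[ℂ] H) (e : HilbertBasis κ ℂ H) (l : κ → ℝ) : Prop :=
  ∀ i, T (e i) = (l i : ℂ) • e i

/-- `l (log l - log m) + m - l ∈ [0, ∞]` for `l, m ≥ 0`, with `0 log 0 = 0` and value `∞` if
`m = 0 < l`. -/
def entropyTerm (l m : ℝ) : ℝ≥0∞ :=
  if m = 0 ∧ l ≠ 0 then ⊤ else ENNReal.ofReal (l * (Real.log l - Real.log m) + m - l)

/-- The relative entropy `D(ρ‖σ) = Tr[ρ (log ρ - log σ)] ∈ [0, ∞]` of two positive trace class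
operators of equal trace, in the form `Tr[ρ (log ρ - log σ) + σ - ρ]`, which makes all terms of the
trace nonnegative. The trace is expanded in an eigenbasis `e` of `ρ` (eigenvalues `l`) and an
eigenbasis `f` of `σ` (eigenvalues `m`):
`D(ρ‖σ) = ∑ i j, |⟨e i, f j⟩|² (l i (log (l i) - log (m j)) + m j - l i)`.
Eigenbases exist for compact self-adjoint operators, and the sum does not depend on their choice,
so the infimum is over one value only. -/
def relEntropy (ρ σ : H →L[ℂ] H) : ℝ≥0∞ :=
  ⨅ (S : Set H) (e : HilbertBasis S ℂ H) (l : S → ℝ) (_ : IsEigenbasis ρ e l)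
    (T : Set H) (f : HilbertBasis T ℂ H) (m : T → ℝ) (_ : IsEigenbasis σ f m),
    ∑' i, ∑' j, ENNReal.ofReal (‖inner ℂ (e i) (f j)‖ ^ 2) * entropyTerm (l i) (m j)

/-! ### Classical-quantum states and their information quantities -/

variable {X : Type*} [Fintype X]

/-- The block-diagonal operator `∑ x, |x⟩⟨x| ⊗ A x` on `ℂ^X ⊗ H`, the Hilbert sum of copies of `H`
indexed by `X`. -/
def cqOp (A : X → H →L[ℂ] H) : PiLp 2 (fun _ : X => H) →L[ℂ] PiLp 2 (fun _ : X => H) :=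
  (PiLp.continuousLinearEquiv 2 ℂ (fun _ : X => H)).symm.toContinuousLinearMap ∘L
    ContinuousLinearMap.pi (fun x => A x ∘L ContinuousLinearMap.proj x) ∘L
    (PiLp.continuousLinearEquiv 2 ℂ (fun _ : X => H)).toContinuousLinearMap

/-- The marginal state `ρ_B = ∑ x, p x • ρ x`. -/
def marginal (p : X → ℝ) (ρ : X → H →L[ℂ] H) : H →L[ℂ] H := ∑ x, (p x : ℂ) • ρ x

/-- The quantum mutual information `I(X:B)_ρ = D(ρ_XB ‖ ρ_X ⊗ ρ_B)` of the classical-quantum state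
`ρ_XB = ∑ x, p x |x⟩⟨x| ⊗ ρ x`. -/
def mutualInfo (p : X → ℝ) (ρ : X → H →L[ℂ] H) : ℝ≥0∞ :=
  relEntropy (cqOp fun x => (p x : ℂ) • ρ x) (cqOp fun x => (p x : ℂ) • marginal p ρ)

/-- The order-`α` sandwiched Augustin information
`inf_σ ∑ x, p x D*_α(ρ x ‖ σ)`, the infimum being over all density operators `σ`. -/
def augustinInfo (α : ℝ) (p : X → ℝ) (ρ : X → H →L[ℂ] H) : EReal :=
  ⨅ (σ : H →L[ℂ] H) (_ : IsDensity σ), ∑ x, (p x : EReal) * sandwichedDiv α (ρ x) σ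

/-- The exponent `sup_{α ∈ (1,2)} (1-α)/α · (Ĭ*_α(X:B)_ρ - R)`. -/
def augustinExponent (p : X → ℝ) (ρ : X → H →L[ℂ] H) (R : ℝ) : EReal :=
  ⨆ (α : ℝ) (_ : α ∈ Set.Ioo (1 : ℝ) 2),
    (((1 - α) / α : ℝ) : EReal) * (augustinInfo α p ρ - (R : EReal))

end Operators

/-! ### Tensor products of operators

For an orthonormal basis `b` of `H` indexed by `ι`, the `n`-fold Hilbert space tensor power of `H`
is `ℓ²(ι^n)`, the vector `b (i 1) ⊗ ⋯ ⊗ b (i n)` being the unit vector at `i : Fin n → ι`. -/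

section Tensor

variable {ι : Type*} {n : ℕ}

/-- The section of `f ∈ ℓ²(ι^n)` along the coordinate `k`, the other coordinates being `r`. -/
def fiber (k : Fin n) (f : ℓ²(Fin n → ι, ℂ)) (r : {j // j ≠ k} → ι) : ℓ²(ι, ℂ) :=
  ⟨fun a => f ((Equiv.funSplitAt k ι).symm (a, r)), by
    have h := (lp.memℓp f).summable (by norm_num)
    exact memℓp_gen (h.comp_injective ((Equiv.funSplitAt k ι).symm.injective.comp
      (Prod.mk_left_injective r)))⟩

theorem norm_sq_eq {κ : Type*} (f : ℓ²(κ, ℂ)) : HasSum (fun i => ‖f i‖ ^ 2) (‖f‖ ^ 2) := by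
  have h := lp.hasSum_norm (p := 2) (by norm_num) f
  simpa using h

theorem memℓp_two {κ : Type*} {g : κ → ℂ} (h : Summable fun i => ‖g i‖ ^ 2) :
    Memℓp g 2 := memℓp_gen (by simpa using h)

theorem hasSum_fiber (k : Fin n) (f : ℓ²(Fin n → ι, ℂ)) :
    HasSum (fun r => ‖fiber k f r‖ ^ 2) (‖f‖ ^ 2) := by
  have h := ((Equiv.funSplitAt k ι).symm.hasSum_iff).2 (norm_sq_eq f)
  have h2 := ((Equiv.prodComm _ _).hasSum_iff).2 h
  exact h2.prod_fiberwise (fun r => norm_sq_eq (fiber k f r))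

theorem hasSum_slot (k : Fin n) (A : ℓ²(ι, ℂ) →L[ℂ] ℓ²(ι, ℂ)) (f : ℓ²(Fin n → ι, ℂ)) :
    ∃ s ≤ (‖A‖ * ‖f‖) ^ 2, HasSum (fun i : Fin n → ι =>
      ‖A (fiber k f (Equiv.funSplitAt k ι i).2) (Equiv.funSplitAt k ι i).1‖ ^ 2) s := by
  have hle : ∀ r, ‖A (fiber k f r)‖ ^ 2 ≤ ‖A‖ ^ 2 * ‖fiber k f r‖ ^ 2 := fun r => by
    rw [← mul_pow]
    exact pow_le_pow_left₀ (norm_nonneg _) (A.le_opNorm _) 2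
  have hf := (hasSum_fiber k f).mul_left (‖A‖ ^ 2)
  have hs : Summable fun r => ‖A (fiber k f r)‖ ^ 2 :=
    Summable.of_nonneg_of_le (fun r => by positivity) hle hf.summable
  have hp : Summable fun x : ({j // j ≠ k} → ι) × ι => ‖A (fiber k f x.1) x.2‖ ^ 2 := by
    refine (summable_prod_of_nonneg (fun x => by positivity)).2
      ⟨fun r => (norm_sq_eq (A (fiber k f r))).summable, ?_⟩
    refine hs.congr fun r => ?_
    exact (norm_sq_eq (A (fiber k f r))).tsum_eq.symm
  have h1 := hp.hasSum.prod_fiberwise (fun r => norm_sq_eq (A (fiber k f r)))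
  refine ⟨_, ?_, ((((Equiv.funSplitAt k ι).trans (Equiv.prodComm _ _)).hasSum_iff).2 hp.hasSum)⟩
  rw [mul_pow]
  exact hasSum_le hle h1 hf

/-- `1 ⊗ ⋯ ⊗ A ⊗ ⋯ ⊗ 1` on `ℓ²(ι^n)`, with `A` acting on the coordinate `k`, as a function. -/
def slotFun (k : Fin n) (A : ℓ²(ι, ℂ) →L[ℂ] ℓ²(ι, ℂ)) (f : ℓ²(Fin n → ι, ℂ)) :
    ℓ²(Fin n → ι, ℂ) :=
  ⟨fun i => A (fiber k f (Equiv.funSplitAt k ι i).2) (Equiv.funSplitAt k ι i).1,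
    memℓp_two (hasSum_slot k A f).choose_spec.2.summable⟩

theorem slotFun_apply (k : Fin n) (A : ℓ²(ι, ℂ) →L[ℂ] ℓ²(ι, ℂ)) (f : ℓ²(Fin n → ι, ℂ))
    (i : Fin n → ι) : slotFun k A f i =
      A (fiber k f (Equiv.funSplitAt k ι i).2) (Equiv.funSplitAt k ι i).1 := rfl

theorem slotFun_add (k : Fin n) (A : ℓ²(ι, ℂ) →L[ℂ] ℓ²(ι, ℂ)) (f g : ℓ²(Fin n → ι, ℂ)) :
    slotFun k A (f + g) = slotFun k A f + slotFun k A g := by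
  ext i
  have h : ∀ r, fiber k (f + g) r = fiber k f r + fiber k g r := fun r => rfl
  rw [lp.coeFn_add, Pi.add_apply, slotFun_apply, slotFun_apply, slotFun_apply, h, map_add,
    lp.coeFn_add, Pi.add_apply]

theorem slotFun_smul (k : Fin n) (A : ℓ²(ι, ℂ) →L[ℂ] ℓ²(ι, ℂ)) (c : ℂ) (f : ℓ²(Fin n → ι, ℂ)) :
    slotFun k A (c • f) = c • slotFun k A f := by
  ext i
  have h : ∀ r, fiber k (c • f) r = c • fiber k f r := fun r => rfl
  rw [lp.coeFn_smul, Pi.smul_apply, slotFun_apply, slotFun_apply, h, map_smul,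
    lp.coeFn_smul, Pi.smul_apply]

theorem norm_slotFun_le (k : Fin n) (A : ℓ²(ι, ℂ) →L[ℂ] ℓ²(ι, ℂ)) (f : ℓ²(Fin n → ι, ℂ)) :
    ‖slotFun k A f‖ ≤ ‖A‖ * ‖f‖ := by
  obtain ⟨s, hs, h⟩ := hasSum_slot k A f
  refine le_of_sq_le_sq ?_ (by positivity)
  exact (HasSum.unique (norm_sq_eq (slotFun k A f)) h).trans_le hs

/-- `1 ⊗ ⋯ ⊗ A ⊗ ⋯ ⊗ 1` on `ℓ²(ι^n)`, with `A` acting on the coordinate `k`. -/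
def slot (k : Fin n) (A : ℓ²(ι, ℂ) →L[ℂ] ℓ²(ι, ℂ)) :
    ℓ²(Fin n → ι, ℂ) →L[ℂ] ℓ²(Fin n → ι, ℂ) :=
  LinearMap.mkContinuous
    { toFun := slotFun k A
      map_add' := slotFun_add k A
      map_smul' := slotFun_smul k A }
    ‖A‖ (norm_slotFun_le k A)

/-- The tensor product `A 1 ⊗ ⋯ ⊗ A n`, the product over `k` of the (commuting) operators
`1 ⊗ ⋯ ⊗ A k ⊗ ⋯ ⊗ 1`. Here `A k` acts on `H`, identified with `ℓ²(ι)` through the basis `b`. -/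
def tensorOp {H : Type*} [NormedAddCommGroup H] [InnerProductSpace ℂ H]
    (b : HilbertBasis ι ℂ H) (A : Fin n → H →L[ℂ] H) :
    ℓ²(Fin n → ι, ℂ) →L[ℂ] ℓ²(Fin n → ι, ℂ) :=
  (List.ofFn fun k => slot k
    ((b.repr.toContinuousLinearEquiv.toContinuousLinearMap ∘L A k) ∘L
      b.repr.symm.toContinuousLinearEquiv.toContinuousLinearMap)).prod

end Tensor

/-! ### Random constant composition codebooks -/

section Codebook

variable {X : Type*} [Fintype X] {n M : ℕ}

open Classical in
/-- The type class `T_p^n`: the sequences of length `n` whose empirical distribution is `p`. -/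
def typeClass (n : ℕ) (p : X → ℝ) : Finset (Fin n → X) :=
  {xs | ∀ x, (1 / n : ℝ) * (∑ i, if x = xs i then 1 else 0) = p x}

open Classical in
/-- The uniform distribution on the type class `T_p^n`. -/
def typeDist (n : ℕ) (p : X → ℝ) (xs : Fin n → X) : ℝ :=
  1 / (typeClass n p).card * (if xs ∈ typeClass n p then 1 else 0)

variable {H : Type*} [NormedAddCommGroup H] [InnerProductSpace ℂ H]
variable {ι : Type*}

/-- The channel output state averaged over the type class. -/
def typeState (b : HilbertBasis ι ℂ H) (n : ℕ) (p : X → ℝ) (ρ : X → H →L[ℂ] H) :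
    ℓ²(Fin n → ι, ℂ) →L[ℂ] ℓ²(Fin n → ι, ℂ) :=
  ∑ xs : Fin n → X, (typeDist n p xs : ℂ) • tensorOp b fun k => ρ (xs k)

/-- The state induced by the codebook `c = (c 1, …, c M)` of words of length `n`. -/
def codebookState (b : HilbertBasis ι ℂ H) (ρ : X → H →L[ℂ] H) (c : Fin M → Fin n → X) :
    ℓ²(Fin n → ι, ℂ) →L[ℂ] ℓ²(Fin n → ι, ℂ) :=
  (1 / M : ℂ) • ∑ m, tensorOp b fun k => ρ (c m k)

/-- The expected trace distance (with the factor `1/2`) between the codebook state and the type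
class state; the `M` codewords are independent, each uniform on the type class. -/
def expectedTraceDist (b : HilbertBasis ι ℂ H) (p : X → ℝ) (ρ : X → H →L[ℂ] H) (n M : ℕ) : ℝ≥0∞ :=
  (1 / 2) * ∑ c : Fin M → Fin n → X, ENNReal.ofReal (∏ m, typeDist n p (c m)) *
    schattenNorm 1 (codebookState b ρ c - typeState b n p ρ)

end Codebook

end SoftCovering

end

/-! Covering bound. Fix α in (1,2) and a density σ with finite divergences, and let σ^γ τ_x σ^γ =
ρ_x with γ = (α-1)/(2α). With S = (σ^γ)^{⊗n} and τ(x^n) the tensor product of the τ_x, the error of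
a codebook c is S (1/M ∑ (τ(c_m) - E τ)) S. The mean E τ is an average over an independent ghost
codebook. Swapping codewords with ghosts inserts random signs, and operator concavity of the square
root bounds the mean of |∑ ± Z_m| by (∑ Z_m²)^{1/2}, where Z_m are the differences
(`sum_abs_le_sum_sqrt`). Hölder's inequality applies with S² of norm one, because the conjugate
power of S² is σ^{⊗n}; subadditivity of Tr (·)^{α/2} then leaves (2 M k)^{1/α} / M
(`sum_schattenNorm_one_le`), with k = Tr τ(x^n)^α. On the type class k is the constant ∏ (Tr
τ_x^α)^{n p(x)}, whose logarithm is n (α-1) ∑ p(x) D*_α(ρ_x‖σ); this is how the Augustin information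
enters. It remains to optimise over σ and α.

Positivity. As (1-α)/α < 0, the exponent is positive iff the Augustin information of some order in
(1,2) lies below R. So two facts are needed. (i) The mutual information I is at most ∑ p D*_α(ρ_x‖σ)
for all α > 1 and σ (`mutualInfo_le`). Gibbs' inequality replaces the marginal by σ in the cross
entropy; at an eigenvector of ρ_x, Jensen and Cauchy-Schwarz bound the cross entropy through τ_x,
and Hölder sums the bounds. Since entropies may be infinite, this is done on finite sets of
eigenvectors. (ii) Orders near 1 come arbitrarily close to I when I is finite
(`exists_augustinInfo_lt`). Take σ to be the marginal: then p(x) ρ_x ≤ σ, the sandwiched quantity is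
dominated by the Petz quantity Tr ρ^{1+s} σ^{-s} with s = (α-1)/α (`exists_isSandwich_of_le`), and
the latter is expanded to second order in s with remainder controlled by Tr ρ² σ^{-1} ≤ 1/p(x)
(`tsum_petz_le`). -/

noncomputable section

namespace SoftCovering

open scoped NNReal InnerProductSpace
open Filter Topology

/-! ### Intertwining and the functional calculus -/

section Calculus

variable {A : Type*} [CStarAlgebra A] [PartialOrder A] [StarOrderedRing A]

omit [PartialOrder A] [StarOrderedRing A] in
-- On the union of the two spectra, the functions g with g(a) c = c g(b) form a closed subalgebra
-- containing the constants and the identity; Stone-Weierstrass gives all continuous functions.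
theorem cfc_mul_eq_mul_cfc {a b c : A} (ha : IsSelfAdjoint a) (hb : IsSelfAdjoint b)
    (h : a * c = c * b) (f : ℝ → ℝ) (hf : Continuous f) : cfc f a * c = c * cfc f b := by
  set s : Set ℝ := spectrum ℝ a ∪ spectrum ℝ b
  have hs : IsCompact s := (ContinuousFunctionalCalculus.isCompact_spectrum a).union
    (ContinuousFunctionalCalculus.isCompact_spectrum b)
  have : CompactSpace s := isCompact_iff_compactSpace.1 hs
  set ja : C(spectrum ℝ a, s) := ⟨Set.inclusion Set.subset_union_left, by fun_prop⟩
  set jb : C(spectrum ℝ b, s) := ⟨Set.inclusion Set.subset_union_right, by fun_prop⟩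
  have key : ∀ g : C(s, ℝ), cfcHom ha (g.comp ja) * c = c * cfcHom hb (g.comp jb) := by
    intro g
    induction g using ContinuousMap.induction_on_of_compact with
    | const r =>
      have h1 : cfcHom ha ((ContinuousMap.const s r).comp ja) = algebraMap ℝ A r :=
        AlgHomClass.commutes (cfcHom ha) r
      have h2 : cfcHom hb ((ContinuousMap.const s r).comp jb) = algebraMap ℝ A r :=
        AlgHomClass.commutes (cfcHom hb) r
      rw [h1, h2]
      exact Algebra.commutes r c
    | id =>
      have h1 := cfcHom_id (R := ℝ) ha
      have h2 := cfcHom_id (R := ℝ) hb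
      rw [← h1, ← h2] at h
      exact h
    | star_id =>
      have h1 := cfcHom_id (R := ℝ) ha
      have h2 := cfcHom_id (R := ℝ) hb
      rw [← h1, ← h2] at h
      exact h
    | add f g hf hg =>
      rw [ContinuousMap.add_comp, ContinuousMap.add_comp, map_add, map_add, add_mul, mul_add, hf,
        hg]
    | mul f g hf hg =>
      rw [ContinuousMap.mul_comp, ContinuousMap.mul_comp, map_mul, map_mul, mul_assoc, hg,
        ← mul_assoc, hf, mul_assoc]
    | frequently f hf =>
      have hcl : IsClosed {g : C(s, ℝ) | cfcHom ha (g.comp ja) * c = c * cfcHom hb (g.comp jb)} :=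
        isClosed_eq
          (((cfcHom_continuous ha).comp (ContinuousMap.continuous_precomp ja)).mul_const c)
          (((cfcHom_continuous hb).comp (ContinuousMap.continuous_precomp jb)).const_mul c)
      exact hcl.closure_subset (mem_closure_iff_frequently.2 hf)
  have h1 := key ⟨_, hf.continuousOn.domRestrict⟩
  rw [cfc_apply f a ha hf.continuousOn, cfc_apply f b hb hf.continuousOn]
  exact h1

theorem rpow_mul_eq_mul_rpow {a b c : A} (ha : 0 ≤ a) (hb : 0 ≤ b)
    (h : a * c = c * b) {r : ℝ} (hr : 0 ≤ r) : CFC.rpow a r * c = c * CFC.rpow b r := by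
  -- Replacing t by max t 0 makes the power continuous on all of ℝ without changing it on a
  -- nonnegative spectrum.
  have e : ∀ x : A, 0 ≤ x → CFC.rpow x r = cfc (fun t : ℝ => (max t 0) ^ r) x := fun x hx => by
    rw [CFC.rpow, cfc_nnreal_eq_real _ x]
    rfl
  rw [e a ha, e b hb]
  exact cfc_mul_eq_mul_cfc ha.isSelfAdjoint hb.isSelfAdjoint h _
    ((continuous_id.max continuous_const).rpow_const fun _ => Or.inr hr)

end Calculus

/-! ### Parseval's identity, positivity and the trace -/

section Basics

variable {H : Type*} [NormedAddCommGroup H] [InnerProductSpace ℂ H]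
variable {K : Type*} [NormedAddCommGroup K] [InnerProductSpace ℂ K]
variable {ι κ : Type*}

theorem hasSum_norm_inner_sq (e : HilbertBasis ι ℂ H) (v : H) :
    HasSum (fun i => ‖⟪e i, v⟫_ℂ‖ ^ 2) (‖v‖ ^ 2) := by
  have h := norm_sq_eq (e.repr v)
  simpa only [e.repr_apply_apply, LinearIsometryEquiv.norm_map] using h

theorem tsum_ofReal_norm_inner_sq (e : HilbertBasis ι ℂ H) (v : H) :
    ∑' i, ENNReal.ofReal (‖⟪e i, v⟫_ℂ‖ ^ 2) = ENNReal.ofReal (‖v‖ ^ 2) := by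
  have h := hasSum_norm_inner_sq e v
  rw [← h.tsum_eq, ENNReal.ofReal_tsum_of_nonneg (fun _ => by positivity) h.summable]

theorem norm_hilbertBasis (e : HilbertBasis ι ℂ H) (i : ι) : ‖e i‖ = 1 := e.orthonormal.1 i

theorem tsum_ofReal_norm_inner_basis_sq (e : HilbertBasis ι ℂ H) (f : HilbertBasis κ ℂ H) (j : κ) :
    ∑' i, ENNReal.ofReal (‖⟪e i, f j⟫_ℂ‖ ^ 2) = 1 := by
  rw [tsum_ofReal_norm_inner_sq, norm_hilbertBasis]; simp

theorem tsum_ofReal_norm_sq_adjoint [CompleteSpace H] [CompleteSpace K] (e : HilbertBasis ι ℂ H)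
    (f : HilbertBasis κ ℂ K) (A : H →L[ℂ] K) :
    ∑' i, ENNReal.ofReal (‖A (e i)‖ ^ 2) =
      ∑' j, ENNReal.ofReal (‖ContinuousLinearMap.adjoint A (f j)‖ ^ 2) := by
  simp_rw [← tsum_ofReal_norm_inner_sq f, ← tsum_ofReal_norm_inner_sq e]
  rw [ENNReal.tsum_comm]
  refine tsum_congr fun j => tsum_congr fun i => ?_
  rw [ContinuousLinearMap.adjoint_inner_right, norm_inner_symm]

theorem isSelfAdjoint_iff_inner [CompleteSpace H] {T : H →L[ℂ] H} (hT : IsSelfAdjoint T) (v w : H) :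
    ⟪T v, w⟫_ℂ = ⟪v, T w⟫_ℂ := by
  rw [← ContinuousLinearMap.adjoint_inner_right, ← ContinuousLinearMap.star_eq_adjoint, hT.star_eq]

theorem re_inner_nonneg [CompleteSpace H] {T : H →L[ℂ] H} (hT : 0 ≤ T) (v : H) :
    0 ≤ (⟪v, T v⟫_ℂ).re := by
  rw [ContinuousLinearMap.nonneg_iff_isPositive] at hT
  exact hT.re_inner_nonneg_right v

theorem nonneg_of_re_inner_nonneg [CompleteSpace H] {T : H →L[ℂ] H} (hT : IsSelfAdjoint T)
    (h : ∀ v, 0 ≤ (⟪v, T v⟫_ℂ).re) : 0 ≤ T := by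
  rw [ContinuousLinearMap.nonneg_iff_isPositive]
  refine (ContinuousLinearMap.isPositive_def' ).2 ⟨hT, fun v => ?_⟩
  rw [ContinuousLinearMap.reApplyInnerSelf_apply, isSelfAdjoint_iff_inner hT]
  exact h v

theorem re_inner_mono [CompleteSpace H] {S T : H →L[ℂ] H} (h : S ≤ T) (v : H) :
    (⟪v, S v⟫_ℂ).re ≤ (⟪v, T v⟫_ℂ).re := by
  have := re_inner_nonneg (sub_nonneg.2 h) v
  simpa [inner_sub_right] using this

theorem re_inner_eq_norm_sqrt_sq [CompleteSpace H] {T : H →L[ℂ] H} (hT : 0 ≤ T) (v : H) :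
    (⟪v, T v⟫_ℂ).re = ‖CFC.sqrt T v‖ ^ 2 := by
  have h := CFC.sqrt_mul_sqrt_self T
  conv_lhs => rw [← h]
  rw [mul_apply_eq_comp, ← isSelfAdjoint_iff_inner (CFC.sqrt_nonneg T).isSelfAdjoint]
  exact inner_self_eq_norm_sq (𝕜 := ℂ) _

/-- Since ⟪e, T e⟫ = ‖√T e‖², Parseval and an exchange of sums show that the basis fixed in `trace`
is immaterial. -/
theorem trace_eq_tsum [CompleteSpace H] {T : H →L[ℂ] H} (hT : 0 ≤ T) (e : HilbertBasis ι ℂ H) :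
    trace T = ∑' i, ENNReal.ofReal (⟪e i, T (e i)⟫_ℂ).re := by
  unfold trace
  simp_rw [re_inner_eq_norm_sqrt_sq hT]
  rw [tsum_ofReal_norm_sq_adjoint _ e]
  rw [← ContinuousLinearMap.star_eq_adjoint, (CFC.sqrt_nonneg T).isSelfAdjoint.star_eq]

theorem rpow_apply_eigenvector [CompleteSpace H] {T : H →L[ℂ] H} (hT : 0 ≤ T) {l : ℝ} (hl : 0 ≤ l)
    {v : H} (hv : T v = (l : ℂ) • v) {r : ℝ} (hr : 0 ≤ r) :
    CFC.rpow T r v = ((l ^ r : ℝ) : ℂ) • v := by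
  by_cases h0 : v = 0
  · simp [h0]
  -- T P = P (l · 1) for the rank-one operator P along v, so intertwining gives T^r P = l^r P, which
  -- is evaluated at v.
  set P : H →L[ℂ] H := (innerSL ℂ v).smulRight v
  have hP : ∀ w, P w = ⟪v, w⟫_ℂ • v := fun w => rfl
  have hl' : (0 : H →L[ℂ] H) ≤ algebraMap ℝ≥0 (H →L[ℂ] H) ⟨l, hl⟩ := by
    exact algebraMap_nonneg _ (zero_le : (0 : ℝ≥0) ≤ _)
  have h1 : T * P = P * algebraMap ℝ≥0 (H →L[ℂ] H) ⟨l, hl⟩ := by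
    ext w
    rw [mul_apply_eq_comp, mul_apply_eq_comp, hP, map_smul, hv]
    have : (algebraMap ℝ≥0 (H →L[ℂ] H) ⟨l, hl⟩) w = (l : ℂ) • w := rfl
    rw [this, map_smul, hP, smul_comm]
  have h2 := congrArg (fun Q : H →L[ℂ] H => Q v) (rpow_mul_eq_mul_rpow hT hl' h1 hr)
  have h3 : CFC.rpow (algebraMap ℝ≥0 (H →L[ℂ] H) ⟨l, hl⟩) r
      = algebraMap ℝ≥0 (H →L[ℂ] H) (⟨l, hl⟩ ^ r) := CFC.rpow_algebraMap
  have h4 : (algebraMap ℝ≥0 (H →L[ℂ] H) (⟨l, hl⟩ ^ r)) v = ((l ^ r : ℝ) : ℂ) • v := rfl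
  simp only [mul_apply_eq_comp, h3, h4, hP, map_smul] at h2
  have hne : ⟪v, v⟫_ℂ ≠ 0 := inner_self_ne_zero.2 h0
  rw [inner_smul_right, mul_smul, smul_comm] at h2
  rw [smul_comm] at h2
  exact smul_right_injective H hne (h2.trans (smul_comm _ _ _))

end Basics

/-! ### Hilbert bases and diagonalisation of compact operators -/

section Bases

variable {H : Type*} [NormedAddCommGroup H] [InnerProductSpace ℂ H] [CompleteSpace H]
variable {K : Type*} [NormedAddCommGroup K] [InnerProductSpace ℂ K]
variable {ι κ : Type*}

theorem exists_hilbertBasis_of_orthonormal {v : ι → H} (hv : Orthonormal ℂ v)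
    (h : ∀ w, (∀ i, ⟪v i, w⟫_ℂ = 0) → w = 0) : ∃ e : HilbertBasis ι ℂ H, ⇑e = v := by
  have hsp : (Submodule.span ℂ (Set.range v))ᗮ = ⊥ := by
    rw [eq_bot_iff]
    intro w hw
    rw [Submodule.mem_orthogonal] at hw
    exact h w fun i => hw _ (Submodule.subset_span ⟨i, rfl⟩)
  exact ⟨HilbertBasis.mkOfOrthogonalEqBot hv hsp, HilbertBasis.coe_mkOfOrthogonalEqBot hv hsp⟩

omit [CompleteSpace H] in
theorem eq_zero_of_forall_inner_eq_zero (e : HilbertBasis ι ℂ H) {w : H}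
    (h : ∀ i, ⟪e i, w⟫_ℂ = 0) : w = 0 := by
  have h0 : HasSum (fun i => ‖⟪e i, w⟫_ℂ‖ ^ 2) 0 := by simp [h, hasSum_zero]
  simpa using (hasSum_norm_inner_sq e w).unique h0

theorem exists_reindex (e : HilbertBasis ι ℂ H) (φ : κ ≃ ι) :
    ∃ f : HilbertBasis κ ℂ H, ∀ j, f j = e (φ j) := by
  obtain ⟨f, hf⟩ := exists_hilbertBasis_of_orthonormal
    (v := fun j => e (φ j)) (e.orthonormal.comp φ φ.injective)
    fun w hw => eq_zero_of_forall_inner_eq_zero e fun i => by simpa using hw (φ.symm i)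
  exact ⟨f, fun j => congrFun hf j⟩

/-- Needed because `relEntropy` ranges over bases indexed by subsets of `H`. -/
theorem exists_set_reindex (e : HilbertBasis ι ℂ H) :
    ∃ (S : Set H) (φ : S ≃ ι) (f : HilbertBasis S ℂ H), ∀ j, f j = e (φ j) := by
  have hinj : Function.Injective e := e.orthonormal.linearIndependent.injective
  exact ⟨Set.range e, (Equiv.ofInjective e hinj).symm, exists_reindex e _⟩

omit [CompleteSpace H] in
theorem finite_index_of_hilbertBasis (e : HilbertBasis ι ℂ H) (f : HilbertBasis κ ℂ H) [Finite ι] :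
    Finite κ ∧ Nat.card ι = Nat.card κ := by
  cases nonempty_fintype ι
  have hfd : FiniteDimensional ℂ H := Module.Basis.finiteDimensional_of_finite
    e.toOrthonormalBasis.toBasis
  have : Finite κ := f.orthonormal.linearIndependent.finite
  cases nonempty_fintype κ
  refine ⟨this, ?_⟩
  rw [Nat.card_eq_fintype_card, Nat.card_eq_fintype_card,
    ← Module.finrank_eq_card_basis e.toOrthonormalBasis.toBasis,
    ← Module.finrank_eq_card_basis f.toOrthonormalBasis.toBasis]

omit [CompleteSpace H] in
-- Each f j has a nonzero coefficient on some e i, and each e i meets only countably many f j. The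
-- resulting equipotence of bases lets every eigenbasis be indexed by the index type of the fixed
-- basis of H, over which the tensor power is built.
theorem exists_injective_index (e : HilbertBasis ι ℂ H) (f : HilbertBasis κ ℂ H) :
    ∃ φ : κ → ι × ℕ, Function.Injective φ := by
  have h1 : ∀ j, ∃ i, ⟪e i, f j⟫_ℂ ≠ 0 := by
    intro j
    by_contra! h
    exact f.orthonormal.ne_zero j (eq_zero_of_forall_inner_eq_zero e h)
  choose g hg using h1
  have h2 : ∀ i, ∃ n : {j | ⟪f j, e i⟫_ℂ ≠ 0} → ℕ, Function.Injective n := by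
    intro i
    have hc := (hasSum_norm_inner_sq f (e i)).summable.countable_support
    have : {j | ⟪f j, e i⟫_ℂ ≠ 0}.Countable := hc.mono fun j hj => by simpa using hj
    exact this.exists_injective_nat
  choose n hn using h2
  have hg' : ∀ j, ⟪f j, e (g j)⟫_ℂ ≠ 0 := fun j h => hg j (by
    rw [← inner_conj_symm, h, map_zero])
  have key : ∀ j i (h : ⟪f j, e i⟫_ℂ ≠ 0) j' i' (h' : ⟪f j', e i'⟫_ℂ ≠ 0), i = i' →
      n i ⟨j, h⟩ = n i' ⟨j', h'⟩ → j = j' := by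
    rintro j i h j' i' h' rfl hnn
    simpa using hn i hnn
  refine ⟨fun j => (g j, n (g j) ⟨j, hg' j⟩), fun j j' h => ?_⟩
  exact key _ _ (hg' j) _ _ (hg' j') (Prod.ext_iff.1 h).1 (Prod.ext_iff.1 h).2

omit [CompleteSpace H] in
/-- Any two Hilbert bases are equipotent. -/
theorem nonempty_equiv_of_hilbertBasis (e : HilbertBasis ι ℂ H) (f : HilbertBasis κ ℂ H) :
    Nonempty (ι ≃ κ) := by
  rcases finite_or_infinite ι with hι | hι
  · obtain ⟨hκ, h⟩ := finite_index_of_hilbertBasis e f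
    exact ⟨(Finite.equivFinOfCardEq h).trans (Finite.equivFin κ).symm⟩
  rcases finite_or_infinite κ with hκ | hκ
  · exact absurd (finite_index_of_hilbertBasis f e).1 (not_finite_iff_infinite.2 hι)
  obtain ⟨φ, hφ⟩ := exists_injective_index e f
  obtain ⟨ψ, hψ⟩ := exists_injective_index f e
  obtain ⟨a⟩ : Nonempty (ι × ℕ ≃ ι) := Cardinal.eq.1 (by simp)
  obtain ⟨b⟩ : Nonempty (κ × ℕ ≃ κ) := Cardinal.eq.1 (by simp)
  exact Function.Embedding.antisymm ⟨_, b.injective.comp hψ⟩ ⟨_, a.injective.comp hφ⟩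

omit [CompleteSpace H] in
-- A Hilbert-Schmidt operator is the norm limit of its finite-rank truncations: by Cauchy-Schwarz
-- the error is at most the square root of the tail of ∑ ‖A e i‖².
theorem isCompactOperator_of_tsum_lt_top (e : HilbertBasis ι ℂ H) [CompleteSpace K] (A : H →L[ℂ] K)
    (h : ∑' i, ENNReal.ofReal (‖A (e i)‖ ^ 2) ≠ ∞) : IsCompactOperator A := by
  classical
  have hs : Summable fun i => ‖A (e i)‖ ^ 2 := by
    have := ENNReal.summable_toReal h
    refine this.congr fun i => ?_
    rw [ENNReal.toReal_ofReal (by positivity)]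
  set F : Finset ι → H →L[ℂ] K := fun s => ∑ i ∈ s, (innerSL ℂ (e i)).smulRight (A (e i))
  have hF : ∀ s, IsCompactOperator (F s) := by
    intro s
    have : F s ∈ compactOperator (RingHom.id ℂ) H K := by
      refine Submodule.sum_mem _ fun i _ => ?_
      have h1 : IsCompactOperator ((innerSL ℂ (e i)).smulRight (A (e i))) := by
        have h2 : IsCompactOperator (ContinuousLinearMap.toSpanSingleton ℂ (A (e i))) :=
          isCompactOperator_of_locallyCompactSpace_rng _
        exact h2.comp_clm (innerSL ℂ (e i))
      exact h1
    exact this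
  have hbound : ∀ s, ‖A - F s‖ ≤ Real.sqrt (∑' i : {i // i ∉ s}, ‖A (e i)‖ ^ 2) := by
    intro s
    refine ContinuousLinearMap.opNorm_le_bound _ (Real.sqrt_nonneg _) fun v => ?_
    have h1 : HasSum (fun i => ⟪e i, v⟫_ℂ • A (e i)) (A v) := by
      have := (e.hasSum_repr v).mapL A
      simpa only [map_smul, e.repr_apply_apply] using this
    have h2 : HasSum (fun i : {i // i ∉ s} => ⟪e i, v⟫_ℂ • A (e i)) ((A - F s) v) := by
      have := (s.hasSum_compl_iff (a := (A - F s) v) (f := fun i => ⟪e i, v⟫_ℂ • A (e i))).2 (by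
        convert h1 using 1
        simp [F])
      exact this
    have hv := (hasSum_norm_inner_sq e v).summable.subtype (fun i => i ∉ s)
    have hv' : ∑' i : {i // i ∉ s}, ‖⟪e i, v⟫_ℂ‖ ^ 2 ≤ ‖v‖ ^ 2 := by
      rw [← (hasSum_norm_inner_sq e v).tsum_eq]
      exact (hasSum_norm_inner_sq e v).summable.tsum_subtype_le _ _ (fun i => by positivity)
    have hs' := hs.subtype (fun i => i ∉ s)
    have hCS := Real.summable_and_inner_le_Lp_mul_Lq_tsum_of_nonneg (p := 2) (q := 2)
      (f := fun i : {i // i ∉ s} => ‖⟪e i, v⟫_ℂ‖) (g := fun i : {i // i ∉ s} => ‖A (e i)‖)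
      (by constructor <;> norm_num) (fun _ => norm_nonneg _) (fun _ => norm_nonneg _)
      (by simpa [Function.comp_def] using hv) (by simpa [Function.comp_def] using hs')
    rw [← h2.tsum_eq]
    have hn : Summable fun i : {i // i ∉ s} => ‖⟪e i, v⟫_ℂ • A (e i)‖ := by
      simpa only [norm_smul] using hCS.1
    refine (norm_tsum_le_tsum_norm hn).trans ?_
    simp only [norm_smul]
    refine hCS.2.trans ?_
    simp only [Real.rpow_ofNat]
    rw [mul_comm, ← Real.sqrt_eq_rpow, ← Real.sqrt_eq_rpow]
    refine mul_le_mul_of_nonneg_left ?_ (Real.sqrt_nonneg _)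
    exact Real.sqrt_le_iff.2 ⟨norm_nonneg _, hv'⟩
  refine isCompactOperator_of_tendsto (l := atTop) (F := F) ?_ (Eventually.of_forall hF)
  rw [tendsto_iff_norm_sub_tendsto_zero]
  have hz : Tendsto (fun s : Finset ι => Real.sqrt (∑' i : {i // i ∉ s}, ‖A (e i)‖ ^ 2)) atTop
      (𝓝 0) := by
    have := (tendsto_tsum_compl_atTop_zero fun i => ‖A (e i)‖ ^ 2)
    simpa using this.sqrt
  refine squeeze_zero (fun _ => norm_nonneg _) (fun s => ?_) hz
  rw [norm_sub_rev]
  exact hbound s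

/-- A compact self-adjoint operator has an orthonormal basis of eigenvectors. -/
theorem exists_eigenbasis {T : H →L[ℂ] H} (hT : IsSelfAdjoint T) (hc : IsCompactOperator T) :
    ∃ (S : Set H) (e : HilbertBasis S ℂ H) (l : S → ℝ), IsEigenbasis T e l := by
  have hsym : T.IsSymmetric := hT.isSymmetric
  -- The eigenspaces are pairwise orthogonal with dense span, so their orthonormal bases join into
  -- one of H.
  have hbot := ContinuousLinearMap.orthogonalComplement_iSup_eigenspaces_eq_bot hc hsym
  set V : ℂ → Submodule ℂ H := fun μ => Module.End.eigenspace (T : Module.End ℂ H) μ with hV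
  have hcl : ∀ μ, IsClosed (V μ : Set H) := by
    intro μ
    have : (V μ : Set H) = {v | T v = μ • v} := by
      ext v; simp [hV]
    rw [this]
    exact isClosed_eq T.continuous (by fun_prop)
  have hcomp : ∀ μ, CompleteSpace (V μ) := fun μ => (hcl μ).completeSpace_coe
  choose w b hb using fun μ => exists_hilbertBasis ℂ (V μ)
  have hof := hsym.orthogonalFamily_eigenspaces
  set v : (Σ μ, w μ) → H := fun x => ((b x.1 x.2 : V x.1) : H) with hv
  have hvo : Orthonormal ℂ v := by
    have := hof.orthonormal_sigma_orthonormal (v_family := fun μ => b μ)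
      (fun μ => (b μ).orthonormal)
    exact this
  obtain ⟨e, he⟩ := exists_hilbertBasis_of_orthonormal hvo (by
    intro u hu
    have hu' : u ∈ (⨆ μ, V μ)ᗮ := by
      rw [Submodule.mem_orthogonal]
      intro x hx
      rw [← inner_conj_symm, map_eq_zero]
      refine Submodule.iSup_induction V (motive := fun x => ⟪u, x⟫_ℂ = 0) hx ?_ (by simp) ?_
      · intro μ x hx
        have h0 : (V μ).orthogonalProjectionOnto u = 0 := by
          refine eq_zero_of_forall_inner_eq_zero (b μ) fun i => ?_
          rw [Submodule.inner_orthogonalProjectionOnto_eq_of_mem_left]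
          exact hu ⟨μ, i⟩
        have := Submodule.inner_orthogonalProjectionOnto_eq_of_mem_left (K := V μ) ⟨x, hx⟩ u
        rw [h0, inner_zero_right] at this
        rw [← inner_conj_symm, ← this, map_zero]
      · intro x y hx hy
        rw [inner_add_right, hx, hy, add_zero]
    rw [hbot] at hu'
    simpa using hu')
  have heig : ∀ x, T (e x) = (x.1 : ℂ) • e x := by
    intro x
    rw [he]
    exact Module.End.mem_eigenspace_iff.1 (b x.1 x.2).2
  obtain ⟨S, φ, f, hf⟩ := exists_set_reindex e
  refine ⟨S, f, fun j => (φ j).1.re, fun j => ?_⟩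
  have hreal : ((φ j).1.re : ℂ) = (φ j).1 := by
    have h1 := isSelfAdjoint_iff_inner hT (e (φ j)) (e (φ j))
    rw [heig, inner_smul_left, inner_smul_right] at h1
    have hne : ⟪e (φ j), e (φ j)⟫_ℂ ≠ 0 :=
      inner_self_ne_zero.2 (e.orthonormal.ne_zero _)
    exact Complex.conj_eq_iff_re.1 (mul_right_cancel₀ hne h1)
  rw [hf, heig, hreal]

end Bases

/-! ### Hölder and Jensen inequalities with substochastic weights -/

section Weights

variable {ι κ : Type*}

theorem tsum_mul_le_Lp_mul_Lq {p q : ℝ} (hpq : p.HolderConjugate q) (f g : ι → ℝ≥0∞) :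
    ∑' i, f i * g i ≤ (∑' i, f i ^ p) ^ (1 / p) * (∑' i, g i ^ q) ^ (1 / q) := by
  let _ : MeasurableSpace ι := ⊤
  have h := ENNReal.lintegral_mul_le_Lp_mul_Lq (MeasureTheory.Measure.count (α := ι)) hpq
    (f := f) (g := g) (Measurable.of_discrete.aemeasurable) (Measurable.of_discrete.aemeasurable)
  simpa [MeasureTheory.lintegral_count] using h

/-- Hölder's inequality with doubly substochastic weights. -/
theorem tsum_tsum_mul_le_Lp_mul_Lq {p q : ℝ} (hpq : p.HolderConjugate q) (w : ι → κ → ℝ≥0∞)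
    (h1 : ∀ j, ∑' i, w i j ≤ 1) (h2 : ∀ i, ∑' j, w i j ≤ 1) (a : ι → ℝ≥0∞) (b : κ → ℝ≥0∞) :
    ∑' i, ∑' j, w i j * (a i * b j) ≤ (∑' i, a i ^ p) ^ (1 / p) * (∑' j, b j ^ q) ^ (1 / q) := by
  have hp := hpq.pos
  have hq := hpq.symm.pos
  -- The weight is split between the two Hölder factors, each of which then collapses through the
  -- row or column sums.
  have hw : ∀ i j, w i j * (a i * b j) = (w i j ^ (1 / p) * a i) * (w i j ^ (1 / q) * b j) := by
    intro i j
    have : w i j = w i j ^ (1 / p) * w i j ^ (1 / q) := by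
      rw [← ENNReal.rpow_add_of_nonneg _ _ (by positivity) (by positivity)]
      simp [hpq.inv_add_inv_eq_one]
    conv_lhs => rw [this]
    ring
  have e1 : ∀ (r : ℝ), 0 < r → ∀ x y : ℝ≥0∞, (x ^ (1 / r) * y) ^ r = x * y ^ r := by
    intro r hr x y
    rw [ENNReal.mul_rpow_of_nonneg _ _ hr.le, ← ENNReal.rpow_mul, one_div_mul_cancel hr.ne',
      ENNReal.rpow_one]
  simp_rw [hw]
  rw [← ENNReal.tsum_prod (f := fun i j => (w i j ^ (1 / p) * a i) * (w i j ^ (1 / q) * b j))]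
  refine (tsum_mul_le_Lp_mul_Lq hpq (fun x : ι × κ => w x.1 x.2 ^ (1 / p) * a x.1)
    (fun x : ι × κ => w x.1 x.2 ^ (1 / q) * b x.2)).trans ?_
  simp_rw [e1 p hp, e1 q hq]
  rw [ENNReal.tsum_prod (f := fun i j => w i j * a i ^ p),
    ENNReal.tsum_prod (f := fun i j => w i j * b j ^ q), ENNReal.tsum_comm (f := fun i j => w i j * b j ^ q)]
  simp_rw [ENNReal.tsum_mul_right]
  gcongr with i j
  · exact mul_le_of_le_one_left' (h2 i)
  · exact mul_le_of_le_one_left' (h1 j)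

/-- Jensen's inequality with substochastic weights. -/
theorem tsum_mul_rpow_le {α : ℝ} (hα : 1 ≤ α) (w x : ι → ℝ≥0∞) (hw : ∑' i, w i ≤ 1) :
    (∑' i, w i * x i) ^ α ≤ ∑' i, w i * x i ^ α := by
  rcases hα.eq_or_lt with rfl | hα
  · simp
  have hpq := Real.HolderConjugate.conjExponent hα
  have hp := hpq.pos
  set q := α.conjExponent
  have hq := hpq.symm.pos
  have h := tsum_mul_le_Lp_mul_Lq hpq (fun i => w i ^ (1 / α) * x i) (fun i => w i ^ (1 / q))
  have e1 : ∀ i, w i ^ (1 / α) * x i * w i ^ (1 / q) = w i * x i := by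
    intro i
    have : w i = w i ^ (1 / α) * w i ^ (1 / q) := by
      rw [← ENNReal.rpow_add_of_nonneg _ _ (by positivity) (by positivity)]
      simp [hpq.inv_add_inv_eq_one]
    conv_rhs => rw [this]
    ring
  have e2 : ∀ i, (w i ^ (1 / α) * x i) ^ α = w i * x i ^ α := by
    intro i
    rw [ENNReal.mul_rpow_of_nonneg _ _ hp.le, ← ENNReal.rpow_mul, one_div_mul_cancel hp.ne',
      ENNReal.rpow_one]
  have e3 : ∀ i, (w i ^ (1 / q)) ^ q = w i := by
    intro i
    rw [← ENNReal.rpow_mul, one_div_mul_cancel hq.ne', ENNReal.rpow_one]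
  simp_rw [e1, e2, e3] at h
  have h' : ∑' i, w i * x i ≤ (∑' i, w i * x i ^ α) ^ (1 / α) := by
    refine h.trans (mul_le_of_le_one_right' ?_)
    exact ENNReal.rpow_le_one hw (by positivity)
  calc (∑' i, w i * x i) ^ α ≤ ((∑' i, w i * x i ^ α) ^ (1 / α)) ^ α :=
        ENNReal.rpow_le_rpow h' hp.le
    _ = _ := by rw [← ENNReal.rpow_mul, one_div_mul_cancel hp.ne', ENNReal.rpow_one]

theorem tsum_mul_rpow_ge {t : ℝ} (ht : 0 < t) (ht1 : t ≤ 1) (w x : ι → ℝ≥0∞)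
    (hw : ∑' i, w i ≤ 1) : ∑' i, w i * x i ^ t ≤ (∑' i, w i * x i) ^ t := by
  have h := tsum_mul_rpow_le (one_le_one_div ht ht1) w (fun i => x i ^ t) hw
  simp_rw [← ENNReal.rpow_mul, mul_one_div_cancel ht.ne', ENNReal.rpow_one] at h
  calc ∑' i, w i * x i ^ t = ((∑' i, w i * x i ^ t) ^ (1 / t)) ^ t := by
        rw [← ENNReal.rpow_mul, one_div_mul_cancel ht.ne', ENNReal.rpow_one]
    _ ≤ _ := ENNReal.rpow_le_rpow h ht.le

end Weights

/-! ### Eigenbases, trace class operators and the trace norm -/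

section Spectral

variable {H : Type*} [NormedAddCommGroup H] [InnerProductSpace ℂ H] [CompleteSpace H]
variable {ι κ : Type*} {e : HilbertBasis ι ℂ H} {f : HilbertBasis κ ℂ H} {T : H →L[ℂ] H}
  {l : ι → ℝ} {m : κ → ℝ}

omit [CompleteSpace H] in
theorem IsEigenbasis.re_inner (h : IsEigenbasis T e l) (i : ι) : (⟪e i, T (e i)⟫_ℂ).re = l i := by
  rw [h i, inner_smul_right, inner_self_eq_norm_sq_to_K, norm_hilbertBasis]
  simp

theorem IsEigenbasis.nonneg (h : IsEigenbasis T e l) (hT : 0 ≤ T) (i : ι) : 0 ≤ l i :=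
  h.re_inner i ▸ re_inner_nonneg hT _

theorem IsEigenbasis.inner_apply (h : IsEigenbasis T e l) (hT : IsSelfAdjoint T) (i : ι) (v : H) :
    ⟪e i, T v⟫_ℂ = l i * ⟪e i, v⟫_ℂ := by
  rw [← isSelfAdjoint_iff_inner hT, h i, inner_smul_left, Complex.conj_ofReal]

theorem IsEigenbasis.hasSum_re_inner (h : IsEigenbasis T e l) (hT : IsSelfAdjoint T) (v : H) :
    HasSum (fun i => ‖⟪e i, v⟫_ℂ‖ ^ 2 * l i) (⟪v, T v⟫_ℂ).re := by
  have := Complex.hasSum_re (e.hasSum_inner_mul_inner v (T v))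
  convert this using 2 with i
  rw [h.inner_apply hT, ← inner_conj_symm v, ← Complex.normSq_eq_norm_sq,
    mul_left_comm, ← Complex.normSq_eq_conj_mul_self]
  norm_cast
  ring

theorem IsEigenbasis.ofReal_re_inner (h : IsEigenbasis T e l) (hT : IsSelfAdjoint T)
    (hl : ∀ i, 0 ≤ l i) (v : H) :
    ENNReal.ofReal (⟪v, T v⟫_ℂ).re
      = ∑' i, ENNReal.ofReal (‖⟪e i, v⟫_ℂ‖ ^ 2) * ENNReal.ofReal (l i) := by
  have hs := h.hasSum_re_inner hT v
  rw [← hs.tsum_eq, ENNReal.ofReal_tsum_of_nonneg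
    (fun i => mul_nonneg (by positivity) (hl i)) hs.summable]
  exact tsum_congr fun i => ENNReal.ofReal_mul (by positivity)

theorem IsEigenbasis.rpow (h : IsEigenbasis T e l) (hT : 0 ≤ T) {r : ℝ} (hr : 0 ≤ r) :
    IsEigenbasis (CFC.rpow T r) e (fun i => l i ^ r) := fun i =>
  rpow_apply_eigenvector hT (h.nonneg hT i) (h i) hr

theorem IsEigenbasis.trace_rpow (h : IsEigenbasis T e l) (hT : 0 ≤ T) {r : ℝ} (hr : 0 ≤ r) :
    trace (CFC.rpow T r) = ∑' i, ENNReal.ofReal (l i ^ r) := by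
  rw [trace_eq_tsum (T := CFC.rpow T r) CFC.rpow_nonneg e]
  exact tsum_congr fun i => by rw [(h.rpow hT hr).re_inner]

theorem IsEigenbasis.trace_eq (h : IsEigenbasis T e l) (hT : 0 ≤ T) :
    trace T = ∑' i, ENNReal.ofReal (l i) := by
  rw [trace_eq_tsum hT e]
  exact tsum_congr fun i => by rw [h.re_inner]

/-- T^(r/2) is Hilbert-Schmidt, hence compact and diagonalisable, and T is its power 2/r. -/
theorem exists_eigenbasis_of_trace_rpow (hT : 0 ≤ T) {r : ℝ} (hr : 0 < r)
    (h : trace (CFC.rpow T r) ≠ ∞) :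
    ∃ (S : Set H) (e : HilbertBasis S ℂ H) (l : S → ℝ), IsEigenbasis T e l := by
  obtain ⟨w, b, -⟩ := exists_hilbertBasis ℂ H
  have hA : 0 ≤ CFC.rpow T (r / 2) := CFC.rpow_nonneg
  have hr2 : CFC.rpow T (r / 2) * CFC.rpow T (r / 2) = CFC.rpow T r := by
    have h1 : CFC.rpow (CFC.rpow T (r / 2)) 2 = CFC.rpow T (r / 2 * 2) :=
      CFC.rpow_rpow_of_exponent_nonneg T (r / 2) 2 (by positivity) (by positivity)
    have h2 : CFC.rpow (CFC.rpow T (r / 2)) ((2 : ℕ) : ℝ) = (CFC.rpow T (r / 2)) ^ 2 :=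
      CFC.rpow_natCast (CFC.rpow T (r / 2)) 2
    rw [← sq, ← h2, Nat.cast_ofNat, h1, div_mul_cancel₀ r two_ne_zero]
  have hc : IsCompactOperator (⇑(CFC.rpow T (r / 2) : H →L[ℂ] H)) := by
    refine isCompactOperator_of_tsum_lt_top b _ ?_
    rw [trace_eq_tsum (T := CFC.rpow T r) (CFC.rpow_nonneg (a := T)) b, ← hr2] at h
    convert h using 4 with i
    rw [mul_apply_eq_comp, ← isSelfAdjoint_iff_inner hA.isSelfAdjoint]
    exact (inner_self_eq_norm_sq (𝕜 := ℂ) _).symm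
  obtain ⟨S, e, l, hl⟩ := exists_eigenbasis hA.isSelfAdjoint hc
  refine ⟨S, e, fun i => l i ^ (2 / r), ?_⟩
  have h3 := hl.rpow hA (r := 2 / r) (by positivity)
  have h4 : CFC.rpow (CFC.rpow T (r / 2)) (2 / r) = CFC.rpow T (r / 2 * (2 / r)) :=
    CFC.rpow_rpow_of_exponent_nonneg T (r / 2) (2 / r) (by positivity) (by positivity)
  have h5 : CFC.rpow T 1 = T := CFC.rpow_one T
  rwa [h4, show r / 2 * (2 / r) = 1 by field_simp, h5] at h3

theorem exists_eigenbasis_of_trace (hT : 0 ≤ T) (h : trace T ≠ ∞) :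
    ∃ (S : Set H) (e : HilbertBasis S ℂ H) (l : S → ℝ), IsEigenbasis T e l := by
  have h5 : CFC.rpow T 1 = T := CFC.rpow_one T
  exact exists_eigenbasis_of_trace_rpow hT one_pos (by rwa [h5])

theorem schattenNorm_of_nonneg (hT : 0 ≤ T) (p : ℝ) :
    schattenNorm p T = trace (CFC.rpow T p) ^ (1 / p) := by
  rw [schattenNorm, CFC.abs_of_nonneg T hT]

theorem IsEigenbasis.abs (h : IsEigenbasis T e l) (hT : IsSelfAdjoint T) :
    IsEigenbasis (CFC.abs T) e (fun i => |l i|) := by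
  have h1 : IsEigenbasis (star T * T) e (fun i => l i ^ 2) := fun i => by
    rw [hT.star_eq, mul_apply_eq_comp, h i, map_smul, h i, smul_smul]
    push_cast
    rw [sq]
  have h2 := h1.rpow (star_mul_self_nonneg T) (r := 1 / 2) (by positivity)
  have h3 : CFC.rpow (star T * T) (1 / 2) = CFC.abs T := by
    rw [CFC.abs, CFC.sqrt_eq_rpow]; rfl
  rw [h3] at h2
  convert h2 using 2 with i
  rw [← Real.sqrt_eq_rpow, Real.sqrt_sq_eq_abs]

theorem IsEigenbasis.schattenNorm_one (h : IsEigenbasis T e l) (hT : IsSelfAdjoint T) :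
    schattenNorm 1 T = ∑' i, ENNReal.ofReal |l i| := by
  rw [schattenNorm, (h.abs hT).trace_rpow (CFC.abs_nonneg T) zero_le_one]
  simp

theorem tsum_norm_sq_ne_top (hT : 0 ≤ T) (h : trace T ≠ ∞) (e : HilbertBasis ι ℂ H) :
    ∑' i, ENNReal.ofReal (‖T (e i)‖ ^ 2) ≠ ∞ := by
  rw [trace_eq_tsum hT e] at h
  have h1 : ∀ v, ‖T v‖ ^ 2 ≤ ‖CFC.sqrt T‖ ^ 2 * (⟪v, T v⟫_ℂ).re := by
    intro v
    rw [re_inner_eq_norm_sqrt_sq hT, ← mul_pow]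
    refine pow_le_pow_left₀ (norm_nonneg _) ?_ 2
    have := (CFC.sqrt T).le_opNorm (CFC.sqrt T v)
    rwa [← mul_apply_eq_comp, CFC.sqrt_mul_sqrt_self T] at this
  have h2 : ∑' i, ENNReal.ofReal (‖T (e i)‖ ^ 2) ≤
      ∑' i, ENNReal.ofReal (‖CFC.sqrt T‖ ^ 2) * ENNReal.ofReal (⟪e i, T (e i)⟫_ℂ).re := by
    refine ENNReal.tsum_le_tsum fun i => ?_
    rw [← ENNReal.ofReal_mul (by positivity)]
    exact ENNReal.ofReal_le_ofReal (h1 _)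
  rw [ENNReal.tsum_mul_left] at h2
  exact ne_top_of_le_ne_top (ENNReal.mul_ne_top ENNReal.ofReal_ne_top h) h2

theorem isCompactOperator_of_trace (hT : 0 ≤ T) (h : trace T ≠ ∞) :
    IsCompactOperator T := by
  obtain ⟨w, b, -⟩ := exists_hilbertBasis ℂ H
  exact isCompactOperator_of_tsum_lt_top b T (tsum_norm_sq_ne_top hT h b)

theorem trace_add {S T : H →L[ℂ] H} (hS : 0 ≤ S) (hT : 0 ≤ T) :
    trace (S + T) = trace S + trace T := by
  obtain ⟨w, b, -⟩ := exists_hilbertBasis ℂ H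
  rw [trace_eq_tsum hS b, trace_eq_tsum hT b, trace_eq_tsum (add_nonneg hS hT) b,
    ← ENNReal.tsum_add]
  refine tsum_congr fun i => ?_
  rw [← ENNReal.ofReal_add (re_inner_nonneg hS _) (re_inner_nonneg hT _)]
  simp

theorem trace_mono {S T : H →L[ℂ] H} (hS : 0 ≤ S) (hST : S ≤ T) :
    trace S ≤ trace T := by
  obtain ⟨w, b, -⟩ := exists_hilbertBasis ℂ H
  rw [trace_eq_tsum hS b, trace_eq_tsum (hS.trans hST) b]
  exact ENNReal.tsum_le_tsum fun i => ENNReal.ofReal_le_ofReal (re_inner_mono hST _)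

theorem trace_smul {T : H →L[ℂ] H} (hT : 0 ≤ T) {c : ℝ} (hc : 0 ≤ c) :
    trace (c • T) = ENNReal.ofReal c * trace T := by
  obtain ⟨w, b, -⟩ := exists_hilbertBasis ℂ H
  rw [trace_eq_tsum hT b, trace_eq_tsum (smul_nonneg hc hT) b, ← ENNReal.tsum_mul_left]
  refine tsum_congr fun i => ?_
  rw [← ENNReal.ofReal_mul hc]
  simp [inner_smul_right_eq_smul]

theorem trace_zero : trace (0 : H →L[ℂ] H) = 0 := by
  simp [trace]

theorem trace_sum {σ : Type*} (s : Finset σ) (F : σ → H →L[ℂ] H) (hF : ∀ x ∈ s, 0 ≤ F x) :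
    trace (∑ x ∈ s, F x) = ∑ x ∈ s, trace (F x) := by
  classical
  induction s using Finset.induction_on with
  | empty => simp [trace_zero]
  | insert a s ha ih =>
    rw [Finset.sum_insert ha, Finset.sum_insert ha, trace_add (hF a (Finset.mem_insert_self a s))
      (Finset.sum_nonneg fun x hx => hF x (Finset.mem_insert_of_mem hx)),
      ih fun x hx => hF x (Finset.mem_insert_of_mem hx)]

/-- In an eigenbasis of T, |l i| = |⟪e i, T e i⟫| ≤ ⟪e i, B e i⟫. The eigenbasis exists because T =
(T + B) - B is a difference of positive trace class operators. -/
theorem schattenNorm_one_le_trace {T B : H →L[ℂ] H} (h1 : -B ≤ T) (h2 : T ≤ B) :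
    schattenNorm 1 T ≤ trace B := by
  have hB : 0 ≤ B := by
    have := add_le_add (neg_le_of_neg_le h1) h2
    have h3 : 0 ≤ (2 : ℝ) • B := by
      rw [two_smul]; simpa using this
    have := smul_nonneg (show (0 : ℝ) ≤ 1 / 2 by norm_num) h3
    rwa [smul_smul, show (1 / 2 * 2 : ℝ) = 1 by norm_num, one_smul] at this
  by_cases htop : trace B = ∞
  · simp [htop]
  have hTB : 0 ≤ T + B := by simpa using add_le_add_left h1 B
  have hsa : IsSelfAdjoint T := by
    have := hTB.isSelfAdjoint.sub hB.isSelfAdjoint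
    simpa using this
  have hc : IsCompactOperator T := by
    have h3 : IsCompactOperator (T + B) := by
      refine isCompactOperator_of_trace hTB (ne_top_of_le_ne_top ?_
        (trace_mono hTB (add_le_add_left h2 B)))
      rw [trace_add hB hB]
      exact ENNReal.add_ne_top.2 ⟨htop, htop⟩
    have := h3.sub (isCompactOperator_of_trace hB htop)
    have h6 : (T : H → H) = (⇑(T + B) - ⇑B) := by funext v; simp
    rwa [h6]
  obtain ⟨S, e, l, hl⟩ := exists_eigenbasis hsa hc
  rw [hl.schattenNorm_one hsa, trace_eq_tsum hB e]
  refine ENNReal.tsum_le_tsum fun i => ENNReal.ofReal_le_ofReal ?_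
  rw [← hl.re_inner i, abs_le]
  refine ⟨?_, re_inner_mono h2 _⟩
  simpa using re_inner_mono h1 (e i)

/-- If `B² ≤ A` then `B A⁻¹ B ≤ 1`. -/
theorem tsum_inv_mul_le {A B : H →L[ℂ] H} {a : κ → ℝ} (hA : IsEigenbasis A f a)
    (ha : ∀ j, 0 ≤ a j) (hB : IsSelfAdjoint B) (h : ∀ z, ‖B z‖ ^ 2 ≤ (⟪z, A z⟫_ℂ).re) (y : H) :
    ∑' j, ENNReal.ofReal (a j)⁻¹ * ENNReal.ofReal (‖⟪f j, B y⟫_ℂ‖ ^ 2)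
      ≤ ENNReal.ofReal (‖y‖ ^ 2) := by
  rw [ENNReal.tsum_eq_iSup_sum]
  refine iSup_le fun s => ?_
  have hcs : ∑ j ∈ s, ENNReal.ofReal (a j)⁻¹ * ENNReal.ofReal (‖⟪f j, B y⟫_ℂ‖ ^ 2)
      = ENNReal.ofReal (∑ j ∈ s, (a j)⁻¹ * ‖⟪f j, B y⟫_ℂ‖ ^ 2) := by
    rw [ENNReal.ofReal_sum_of_nonneg fun j _ => mul_nonneg (inv_nonneg.2 (ha j)) (by positivity)]
    exact Finset.sum_congr rfl fun j _ => (ENNReal.ofReal_mul (inv_nonneg.2 (ha j))).symm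
  rw [hcs]
  refine ENNReal.ofReal_le_ofReal ?_
  set c := ∑ j ∈ s, (a j)⁻¹ * ‖⟪f j, B y⟫_ℂ‖ ^ 2
  have hc0 : 0 ≤ c := Finset.sum_nonneg fun j _ => mul_nonneg (inv_nonneg.2 (ha j)) (by positivity)
  -- z is a finite truncation of A⁻¹ B y, so ⟪z, B y⟫ = c and ⟪z, A z⟫ ≤ c, whence c² ≤ ‖B z‖² ‖y‖²
  -- ≤ c ‖y‖². Eigenvalues a j = 0 drop out because 0⁻¹ = 0.
  set x : κ → ℂ := fun j => ((a j)⁻¹ : ℂ) * ⟪f j, B y⟫_ℂ with hx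
  set z : H := ∑ j ∈ s, x j • f j with hz
  have h1 : ⟪z, B y⟫_ℂ = c := by
    rw [hz, sum_inner, Complex.ofReal_sum]
    refine Finset.sum_congr rfl fun j _ => ?_
    rw [inner_smul_left, hx, map_mul, mul_assoc, ← Complex.normSq_eq_conj_mul_self,
      Complex.normSq_eq_norm_sq, map_inv₀, Complex.conj_ofReal]
    push_cast
    rfl
  have h2 : (⟪z, A z⟫_ℂ).re ≤ c := by
    have hAz : ⟪z, A z⟫_ℂ = ((∑ j ∈ s, (a j)⁻¹ * (a j * (a j)⁻¹) * ‖⟪f j, B y⟫_ℂ‖ ^ 2 : ℝ) : ℂ) := by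
      have hA' : A z = ∑ j ∈ s, (a j * x j) • f j := by
        rw [hz, map_sum]
        refine Finset.sum_congr rfl fun j _ => ?_
        rw [map_smul, hA j, smul_smul, mul_comm]
      conv_lhs => rw [hz]
      rw [sum_inner, Complex.ofReal_sum]
      refine Finset.sum_congr rfl fun j hj => ?_
      rw [inner_smul_left, hA', f.orthonormal.inner_right_sum _ hj, hx]
      simp only [map_mul, map_inv₀, Complex.conj_ofReal]
      push_cast
      rw [← Complex.ofReal_pow, ← Complex.normSq_eq_norm_sq, Complex.normSq_eq_conj_mul_self]
      ring
    rw [hAz, Complex.ofReal_re]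
    refine Finset.sum_le_sum fun j _ => ?_
    have := ha j
    refine mul_le_mul_of_nonneg_right ?_ (by positivity)
    exact mul_le_of_le_one_right (inv_nonneg.2 this) mul_inv_le_one
  have h3 : c ≤ ‖B z‖ * ‖y‖ := by
    rw [← isSelfAdjoint_iff_inner hB] at h1
    have := norm_inner_le_norm (𝕜 := ℂ) (B z) y
    rwa [h1, Complex.norm_real, Real.norm_of_nonneg hc0] at this
  have h4 := (h z).trans h2
  by_contra! hlt
  have h5 : c ^ 2 ≤ c * ‖y‖ ^ 2 := calc
    c ^ 2 ≤ (‖B z‖ * ‖y‖) ^ 2 := pow_le_pow_left₀ hc0 h3 2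
    _ = ‖B z‖ ^ 2 * ‖y‖ ^ 2 := mul_pow ..
    _ ≤ _ := mul_le_mul_of_nonneg_right h4 (by positivity)
  nlinarith [sq_nonneg ‖y‖]

end Spectral

/-! ### Trace inequalities for powers -/

section Schatten

variable {H : Type*} [NormedAddCommGroup H] [InnerProductSpace ℂ H] [CompleteSpace H]
variable {ι κ : Type*} {e : HilbertBasis ι ℂ H} {f : HilbertBasis κ ℂ H} {S T : H →L[ℂ] H}
  {l : ι → ℝ} {m : κ → ℝ}

omit [CompleteSpace H] in
theorem tsum_ofReal_norm_inner_basis_sq' (e : HilbertBasis ι ℂ H) (f : HilbertBasis κ ℂ H) (i : ι) :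
    ∑' j, ENNReal.ofReal (‖⟪e i, f j⟫_ℂ‖ ^ 2) = 1 := by
  simp_rw [norm_inner_symm (e i)]
  exact tsum_ofReal_norm_inner_basis_sq f e i

/-- For r ≤ 2, l² ≤ ‖T‖^(2-r) l^r, so T is Hilbert-Schmidt. -/
theorem isCompactOperator_of_trace_rpow (hT : 0 ≤ T) {r : ℝ} (hr : 0 < r) (hr2 : r ≤ 2)
    (h : trace (CFC.rpow T r) ≠ ∞) : IsCompactOperator T := by
  obtain ⟨w, e, l, hl⟩ := exists_eigenbasis_of_trace_rpow hT hr h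
  refine isCompactOperator_of_tsum_lt_top e T ?_
  rw [hl.trace_rpow hT hr.le] at h
  have hb : ∀ i, l i ≤ ‖T‖ := by
    intro i
    have h1 := T.le_opNorm (e i)
    rw [hl i, norm_smul, norm_hilbertBasis, mul_one, mul_one, Complex.norm_real] at h1
    exact (Real.le_norm_self _).trans h1
  have h2 : ∑' i, ENNReal.ofReal (‖T (e i)‖ ^ 2) ≤
      ∑' i, ENNReal.ofReal (‖T‖ ^ (2 - r)) * ENNReal.ofReal (l i ^ r) := by
    refine ENNReal.tsum_le_tsum fun i => ?_
    have hi := hl.nonneg hT i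
    rw [← ENNReal.ofReal_mul (by positivity)]
    refine ENNReal.ofReal_le_ofReal ?_
    rw [hl i, norm_smul, norm_hilbertBasis, mul_one, Complex.norm_real, Real.norm_of_nonneg hi]
    have : l i ^ 2 = l i ^ (2 - r) * l i ^ r := by
      rw [← Real.rpow_add_of_nonneg hi (by linarith) hr.le, sub_add_cancel, Real.rpow_two]
    rw [this]
    exact mul_le_mul_of_nonneg_right (Real.rpow_le_rpow hi (hb i) (by linarith)) (by positivity)
  rw [ENNReal.tsum_mul_left] at h2
  exact ne_top_of_le_ne_top (ENNReal.mul_ne_top ENNReal.ofReal_ne_top h) h2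

/-- Hölder's inequality `Tr (S G S) ≤ ‖G‖_p ‖S²‖_q`. -/
theorem trace_conj_le {G : H →L[ℂ] H} (hS : IsSelfAdjoint S) (hSe : IsEigenbasis S f m)
    (hG : 0 ≤ G) (hGe : IsEigenbasis G e l) {p q : ℝ} (hpq : p.HolderConjugate q) :
    trace (S * G * S) ≤ trace (CFC.rpow G p) ^ (1 / p) *
      (∑' j, ENNReal.ofReal (m j ^ 2) ^ q) ^ (1 / q) := by
  have hl := hGe.nonneg hG
  have h0 : 0 ≤ S * G * S := by
    simpa [hS.star_eq] using star_left_conjugate_nonneg hG S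
  have h1 : ∀ j, ENNReal.ofReal (⟪f j, (S * G * S) (f j)⟫_ℂ).re =
      ∑' i, ENNReal.ofReal (‖⟪e i, f j⟫_ℂ‖ ^ 2) *
        (ENNReal.ofReal (l i) * ENNReal.ofReal (m j ^ 2)) := by
    intro j
    have : (⟪f j, (S * G * S) (f j)⟫_ℂ).re = (⟪f j, G (f j)⟫_ℂ).re * m j ^ 2 := by
      rw [mul_apply_eq_comp, mul_apply_eq_comp, hSe.inner_apply hS, hSe j, map_smul,
        inner_smul_right, ← mul_assoc, ← Complex.ofReal_mul, Complex.re_ofReal_mul]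
      ring
    rw [this, ENNReal.ofReal_mul (re_inner_nonneg hG _),
      hGe.ofReal_re_inner hG.isSelfAdjoint hl, ← ENNReal.tsum_mul_right]
    exact tsum_congr fun i => mul_assoc _ _ _
  rw [trace_eq_tsum h0 f]
  simp_rw [h1]
  rw [ENNReal.tsum_comm]
  refine (tsum_tsum_mul_le_Lp_mul_Lq hpq (fun i j => ENNReal.ofReal (‖⟪e i, f j⟫_ℂ‖ ^ 2))
    (fun j => (tsum_ofReal_norm_inner_basis_sq e f j).le)
    (fun i => (tsum_ofReal_norm_inner_basis_sq' e f i).le) _ _).trans_eq ?_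
  rw [hGe.trace_rpow hG hpq.nonneg]
  simp_rw [ENNReal.ofReal_rpow_of_nonneg (hl _) hpq.nonneg]

/-- Diagonal entries: `∑ ⟨f j, T f j⟩ ^ p ≤ Tr T ^ p`. -/
theorem tsum_diag_rpow_le (hT : 0 ≤ T) (hTe : IsEigenbasis T e l) (f : HilbertBasis κ ℂ H)
    {p : ℝ} (hp : 1 ≤ p) :
    ∑' j, ENNReal.ofReal (⟪f j, T (f j)⟫_ℂ).re ^ p ≤ trace (CFC.rpow T p) := by
  have hl := hTe.nonneg hT
  rw [hTe.trace_rpow hT (by linarith)]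
  calc ∑' j, ENNReal.ofReal (⟪f j, T (f j)⟫_ℂ).re ^ p
      ≤ ∑' j, ∑' i, ENNReal.ofReal (‖⟪e i, f j⟫_ℂ‖ ^ 2) * ENNReal.ofReal (l i) ^ p := by
        refine ENNReal.tsum_le_tsum fun j => ?_
        rw [hTe.ofReal_re_inner hT.isSelfAdjoint hl]
        exact tsum_mul_rpow_le hp _ _ (tsum_ofReal_norm_inner_basis_sq e f j).le
    _ = ∑' i, ENNReal.ofReal (l i ^ p) := by
        rw [ENNReal.tsum_comm]
        refine tsum_congr fun i => ?_
        rw [ENNReal.tsum_mul_right, tsum_ofReal_norm_inner_basis_sq', one_mul,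
          ENNReal.ofReal_rpow_of_nonneg (hl i) (by linarith)]

/-- `Tr |S - T| ^ p ≤ Tr S ^ p + Tr T ^ p` for positive operators. -/
theorem tsum_abs_rpow_sub_le {ι' κ' : Type*} {e' : HilbertBasis ι' ℂ H} {f' : HilbertBasis κ' ℂ H}
    {s : ι' → ℝ} {t : κ' → ℝ} (hS : 0 ≤ S) (hSe : IsEigenbasis S e' s)
    (hT : 0 ≤ T) (hTe : IsEigenbasis T f' t)
    (h : IsEigenbasis (S - T) e l) {p : ℝ} (hp : 1 ≤ p) :
    ∑' i, ENNReal.ofReal |l i| ^ p ≤ trace (CFC.rpow S p) + trace (CFC.rpow T p) := by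
  refine le_trans ?_ (add_le_add (tsum_diag_rpow_le hS hSe e hp) (tsum_diag_rpow_le hT hTe e hp))
  rw [← ENNReal.tsum_add]
  refine ENNReal.tsum_le_tsum fun i => ?_
  -- l i is a difference of two nonnegative diagonal entries, so |l i| is at most one of them.
  have h1 := h.re_inner i
  rw [sub_apply, inner_sub_right, Complex.sub_re] at h1
  have ha := re_inner_nonneg hS (e i)
  have hb := re_inner_nonneg hT (e i)
  rcases le_total 0 (l i) with h0 | h0
  · refine le_trans ?_ le_self_add
    refine ENNReal.rpow_le_rpow (ENNReal.ofReal_le_ofReal ?_) (by linarith)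
    rw [abs_of_nonneg h0]; linarith
  · refine le_trans ?_ le_add_self
    refine ENNReal.rpow_le_rpow (ENNReal.ofReal_le_ofReal ?_) (by linarith)
    rw [abs_of_nonpos h0]; linarith

/-- `Tr (∑ Z_m²) ^ r ≤ ∑ Tr |Z_m| ^ (2 r)` for `r < 1`. -/
theorem tsum_rpow_sum_sq_le {σ : Type*} [Fintype σ] {Z : σ → H →L[ℂ] H}
    (hZ : ∀ x, IsSelfAdjoint (Z x)) {ιZ : σ → Type*} {h : ∀ x, HilbertBasis (ιZ x) ℂ H}
    {z : ∀ x, ιZ x → ℝ} (hZe : ∀ x, IsEigenbasis (Z x) (h x) (z x))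
    (hG : IsEigenbasis (∑ x, Z x * Z x) e l) {r : ℝ} (hr0 : 0 < r) (hr : r < 1) :
    ∑' i, ENNReal.ofReal (l i ^ r) ≤ ∑ x, ∑' j, ENNReal.ofReal |z x j| ^ (2 * r) := by
  have hnorm : ∀ x v, (⟪v, (Z x * Z x) v⟫_ℂ).re = ‖Z x v‖ ^ 2 := by
    intro x v
    rw [mul_apply_eq_comp, ← isSelfAdjoint_iff_inner (hZ x)]
    exact inner_self_eq_norm_sq (𝕜 := ℂ) _
  have hsum : ∀ v, (⟪v, (∑ x, Z x * Z x) v⟫_ℂ).re = ∑ x, ‖Z x v‖ ^ 2 := by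
    intro v
    rw [sum_apply, inner_sum, Complex.re_sum]
    exact Finset.sum_congr rfl fun x _ => hnorm x v
  have hl : ∀ i, l i = ∑ x, ‖Z x (e i)‖ ^ 2 := fun i => by rw [← hG.re_inner, hsum]
  have hl0 : ∀ i, 0 ≤ l i := fun i => by rw [hl]; positivity
  -- Writing l^r = l^(-(1-r)) l, with G = ∑ Z_x², turns Tr G^r into ∑ Tr Z_x G^(-(1-r)) Z_x, so each
  -- x can be treated alone.
  have hterm : ∀ i, ENNReal.ofReal (l i ^ r) =
      ∑ x, ENNReal.ofReal ((l i)⁻¹) ^ (1 - r) * ENNReal.ofReal (‖Z x (e i)‖ ^ 2) := by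
    intro i
    rw [← Finset.mul_sum, ← ENNReal.ofReal_sum_of_nonneg (fun x _ => by positivity), ← hl,
      ENNReal.ofReal_rpow_of_nonneg (inv_nonneg.2 (hl0 i)) (by linarith),
      ← ENNReal.ofReal_mul (by have := hl0 i; positivity)]
    congr 1
    rcases (hl0 i).eq_or_lt with h0 | h0
    · rw [← h0]; simp [Real.zero_rpow hr0.ne']
    · rw [Real.inv_rpow h0.le, ← Real.rpow_neg h0.le]
      conv_rhs => rw [← Real.rpow_one (l i), ← Real.rpow_mul h0.le, ← Real.rpow_add h0]
      congr 1; ring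
  simp_rw [hterm]
  rw [Summable.tsum_finsetSum (fun _ _ => ENNReal.summable)]
  refine Finset.sum_le_sum fun x _ => ?_
  have hZsq : ∀ i, ENNReal.ofReal (‖Z x (e i)‖ ^ 2) =
      ∑' j, ENNReal.ofReal (‖⟪h x j, e i⟫_ℂ‖ ^ 2) * ENNReal.ofReal (z x j ^ 2) := by
    intro i
    rw [← tsum_ofReal_norm_inner_sq (h x)]
    refine tsum_congr fun j => ?_
    rw [(hZe x).inner_apply (hZ x), norm_mul, mul_pow, Complex.norm_real, Real.norm_eq_abs,
      sq_abs, mul_comm, ENNReal.ofReal_mul (by positivity)]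
  simp_rw [hZsq, ← ENNReal.tsum_mul_left]
  rw [ENNReal.tsum_comm]
  refine ENNReal.tsum_le_tsum fun j => ?_
  by_cases hz : z x j = 0
  · simp [hz]
  have hz2 : ENNReal.ofReal (z x j ^ 2) ≠ 0 := (ENNReal.ofReal_pos.2 (by positivity)).ne'
  -- Z_x² ≤ G gives z² ⟪h, G⁻¹ h⟫ ≤ 1 at an eigenvector h of Z_x with eigenvalue z. Concavity of
  -- t^(1-r) then gives z² ⟪h, G^(-(1-r)) h⟫ ≤ z² z^(-2(1-r)) = |z|^(2r).
  have key := tsum_inv_mul_le hG hl0 (hZ x) (fun v => by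
    rw [hsum]
    exact Finset.single_le_sum (f := fun x => ‖Z x v‖ ^ 2) (fun _ _ => by positivity)
      (Finset.mem_univ x)) (h x j)
  have hkey : (∑' i, ENNReal.ofReal (‖⟪h x j, e i⟫_ℂ‖ ^ 2) * ENNReal.ofReal (l i)⁻¹)
      * ENNReal.ofReal (z x j ^ 2) ≤ 1 := by
    rw [norm_hilbertBasis, one_pow, ENNReal.ofReal_one] at key
    rw [← ENNReal.tsum_mul_right]
    refine le_trans (le_of_eq (tsum_congr fun i => ?_)) key
    rw [hZe x j, inner_smul_right, norm_mul, mul_pow, Complex.norm_real, Real.norm_eq_abs, sq_abs,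
      ENNReal.ofReal_mul (by positivity), norm_inner_symm (h x j)]
    ring
  have hJ := tsum_mul_rpow_ge (t := 1 - r) (by linarith) (by linarith)
    (fun i => ENNReal.ofReal (‖⟪h x j, e i⟫_ℂ‖ ^ 2)) (fun i => ENNReal.ofReal (l i)⁻¹)
    (tsum_ofReal_norm_inner_basis_sq' _ _ j).le
  calc ∑' i, ENNReal.ofReal (l i)⁻¹ ^ (1 - r) *
        (ENNReal.ofReal (‖⟪h x j, e i⟫_ℂ‖ ^ 2) * ENNReal.ofReal (z x j ^ 2))
      = (∑' i, ENNReal.ofReal (‖⟪h x j, e i⟫_ℂ‖ ^ 2) * ENNReal.ofReal (l i)⁻¹ ^ (1 - r)) *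
          ENNReal.ofReal (z x j ^ 2) := by
        rw [← ENNReal.tsum_mul_right]
        exact tsum_congr fun i => by ring
    _ ≤ ((ENNReal.ofReal (z x j ^ 2))⁻¹) ^ (1 - r) * ENNReal.ofReal (z x j ^ 2) := by
        gcongr
        refine hJ.trans (ENNReal.rpow_le_rpow ?_ (by linarith))
        exact ENNReal.le_inv_iff_mul_le.2 hkey
    _ = ENNReal.ofReal |z x j| ^ (2 * r) := by
        rw [ENNReal.inv_rpow, ← ENNReal.rpow_neg]
        conv_lhs => rw [← ENNReal.rpow_one (ENNReal.ofReal (z x j ^ 2)), ← ENNReal.rpow_mul,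
          ← ENNReal.rpow_add _ _ hz2 ENNReal.ofReal_ne_top]
        rw [← sq_abs, ENNReal.ofReal_pow (abs_nonneg _), ← ENNReal.rpow_natCast, ← ENNReal.rpow_mul]
        congr 1
        push_cast; ring

end Schatten

/-! ### Random signs and operator concavity of the square root -/

section Signs

variable {H : Type*} [NormedAddCommGroup H] [InnerProductSpace ℂ H] [CompleteSpace H]
variable {σ : Type*} [Fintype σ] [DecidableEq σ]

/-- The real number `±1`. -/
def unitSign (u : ℤˣ) : ℝ := ((u : ℤ) : ℝ)

theorem unitSign_mul (u v : ℤˣ) : unitSign (u * v) = unitSign u * unitSign v := by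
  simp [unitSign]

theorem unitSign_mul_self (u : ℤˣ) : unitSign u * unitSign u = 1 := by
  rw [← unitSign_mul, Int.units_mul_self]; simp [unitSign]

/-- Flipping the sign at x permutes the sign patterns and negates the summand. -/
theorem sum_unitSign_mul_eq_zero {x y : σ} (hxy : x ≠ y) :
    ∑ ε : σ → ℤˣ, unitSign (ε x) * unitSign (ε y) = 0 := by
  have h : ∑ ε : σ → ℤˣ, unitSign (ε x) * unitSign (ε y) =
      ∑ ε : σ → ℤˣ, -(unitSign (ε x) * unitSign (ε y)) := by
    refine Fintype.sum_equiv (Equiv.mulLeft (Pi.mulSingle x (-1 : ℤˣ))) _ _ fun ε => ?_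
    have h1 : (Pi.mulSingle x (-1 : ℤˣ) : σ → ℤˣ) y = 1 := Pi.mulSingle_eq_of_ne' hxy _
    simp only [Equiv.coe_mulLeft, Pi.mul_apply, Pi.mulSingle_eq_same, h1, one_mul, unitSign_mul]
    simp [unitSign]
  rw [Finset.sum_neg_distrib] at h
  linarith

omit [CompleteSpace H] in
/-- The mean of the square of a random signed sum is the sum of the squares. -/
theorem sum_sq_sum_unitSign (Z : σ → H →L[ℂ] H) :
    ∑ ε : σ → ℤˣ, (∑ x, unitSign (ε x) • Z x) * (∑ x, unitSign (ε x) • Z x) =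
      (Fintype.card (σ → ℤˣ) : ℝ) • ∑ x, Z x * Z x := by
  have h1 : ∀ ε : σ → ℤˣ, (∑ x, unitSign (ε x) • Z x) * (∑ x, unitSign (ε x) • Z x) =
      ∑ x, ∑ y, (unitSign (ε x) * unitSign (ε y)) • (Z x * Z y) := by
    intro ε
    rw [Finset.sum_mul_sum]
    simp_rw [smul_mul_smul_comm]
  simp_rw [h1]
  rw [Finset.sum_comm, Finset.smul_sum]
  refine Finset.sum_congr rfl fun x _ => ?_
  rw [Finset.sum_comm, Finset.sum_eq_single x]
  · simp [unitSign_mul_self, ← Nat.cast_smul_eq_nsmul ℝ]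
  · intro y _ hy
    rw [← Finset.sum_smul, sum_unitSign_mul_eq_zero hy.symm, zero_smul]
  · simp

/-- Jensen's inequality for the operator concave square root: |Y_ε| = √(Y_ε²), and the mean of Y_ε²
over the signs is ∑ Z_x². -/
theorem smul_sum_abs_le (Z : σ → H →L[ℂ] H) (hZ : ∀ x, IsSelfAdjoint (Z x)) :
    (Fintype.card (σ → ℤˣ) : ℝ)⁻¹ • ∑ ε : σ → ℤˣ, CFC.abs (∑ x, unitSign (ε x) • Z x) ≤
      CFC.sqrt (∑ x, Z x * Z x) := by
  set N : ℝ := (Fintype.card (σ → ℤˣ) : ℝ) with hNdef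
  have hN : 0 < N := by
    exact Nat.cast_pos.2 Fintype.card_pos
  set Y : (σ → ℤˣ) → H →L[ℂ] H := fun ε => ∑ x, unitSign (ε x) • Z x with hY
  have hYs : ∀ ε, IsSelfAdjoint (Y ε) := fun ε =>
    isSelfAdjoint_sum _ fun x _ => (IsSelfAdjoint.all _).smul (hZ x)
  have hab : ∀ ε, CFC.abs (Y ε) = CFC.sqrt (Y ε * Y ε) := fun ε => by
    rw [CFC.abs, (hYs ε).star_eq]
  have hpos : ∀ ε, 0 ≤ Y ε * Y ε := fun ε => by
    simpa [(hYs ε).star_eq] using star_mul_self_nonneg (Y ε)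
  have h := CFC.concaveOn_sqrt (A := H →L[ℂ] H) |>.le_map_sum (t := Finset.univ)
    (w := fun _ : σ → ℤˣ => N⁻¹) (p := fun ε => Y ε * Y ε) (fun _ _ => by positivity)
    (by simp [N]) (fun ε _ => hpos ε)
  rw [← Finset.smul_sum, ← Finset.smul_sum, hY, sum_sq_sum_unitSign Z, smul_smul,
    inv_mul_cancel₀ hN.ne', one_smul] at h
  refine le_of_eq_of_le ?_ h
  congr 1
  exact Finset.sum_congr rfl fun ε _ => hab ε

end Signs

/-! ### One-shot covering by symmetrisation -/

section Covering

variable {H : Type*} [NormedAddCommGroup H] [InnerProductSpace ℂ H] [CompleteSpace H]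
variable {Ω σ : Type*} [Fintype Ω] [Fintype σ] [DecidableEq σ]

/-- The two entries of a pair are independent with the same law, so exchanging them preserves the
product law; ε selects the pairs. -/
theorem sum_prod_pair_swap {E : Type*} [AddCommMonoid E] [Module ℝ E] (q : Ω → ℝ)
    (F : (σ → Ω × Ω) → E) (ε : σ → ℤˣ) :
    ∑ d : σ → Ω × Ω, (∏ x, q (d x).1 * q (d x).2) •
        F (fun x => if ε x = 1 then d x else (d x).swap) =
      ∑ d : σ → Ω × Ω, (∏ x, q (d x).1 * q (d x).2) • F d := by
  refine Fintype.sum_equiv (Equiv.piCongrRight fun x =>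
    if ε x = 1 then Equiv.refl _ else Equiv.prodComm Ω Ω) _ _ fun d => ?_
  have h : (Equiv.piCongrRight fun x => if ε x = 1 then Equiv.refl _ else Equiv.prodComm Ω Ω) d =
      fun x => if ε x = 1 then d x else (d x).swap := by
    funext x
    simp only [Equiv.piCongrRight_apply, Pi.map_apply]
    split_ifs <;> rfl
  rw [h]
  congr 1
  refine Finset.prod_congr rfl fun x _ => ?_
  dsimp only
  split_ifs
  · rfl
  · exact mul_comm _ _

/-- Swapping the x-th pair negates the x-th difference, so the left side equals its average over all
signs; operator Jensen then applies for each d. -/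
theorem sum_abs_le_sum_sqrt {q : Ω → ℝ} (hq : ∀ ω, 0 ≤ q ω) (τ : Ω → H →L[ℂ] H)
    (hτ : ∀ ω, IsSelfAdjoint (τ ω)) :
    ∑ d : σ → Ω × Ω, (∏ x, q (d x).1 * q (d x).2) •
        CFC.abs (∑ x, (τ (d x).1 - τ (d x).2)) ≤
      ∑ d : σ → Ω × Ω, (∏ x, q (d x).1 * q (d x).2) •
        CFC.sqrt (∑ x, (τ (d x).1 - τ (d x).2) * (τ (d x).1 - τ (d x).2)) := by
  set N : ℝ := (Fintype.card (σ → ℤˣ) : ℝ) with hNdef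
  have hN : 0 < N := by
    exact Nat.cast_pos.2 Fintype.card_pos
  have h1 : ∀ ε : σ → ℤˣ, ∑ d : σ → Ω × Ω, (∏ x, q (d x).1 * q (d x).2) •
        CFC.abs (∑ x, (τ (d x).1 - τ (d x).2)) =
      ∑ d : σ → Ω × Ω, (∏ x, q (d x).1 * q (d x).2) •
        CFC.abs (∑ x, unitSign (ε x) • (τ (d x).1 - τ (d x).2)) := by
    intro ε
    rw [← sum_prod_pair_swap q (fun d => CFC.abs (∑ x, (τ (d x).1 - τ (d x).2))) ε]
    refine Finset.sum_congr rfl fun d _ => ?_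
    congr 2
    refine Finset.sum_congr rfl fun x _ => ?_
    rcases Int.units_eq_one_or (ε x) with h | h
    · simp [h, unitSign]
    · simp [h, unitSign]
  have h2 : ∑ d : σ → Ω × Ω, (∏ x, q (d x).1 * q (d x).2) •
        CFC.abs (∑ x, (τ (d x).1 - τ (d x).2)) =
      ∑ d : σ → Ω × Ω, (∏ x, q (d x).1 * q (d x).2) •
        (N⁻¹ • ∑ ε : σ → ℤˣ, CFC.abs (∑ x, unitSign (ε x) • (τ (d x).1 - τ (d x).2))) := by
    have h3 := Finset.sum_congr (rfl : (Finset.univ : Finset (σ → ℤˣ)) = Finset.univ)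
      fun ε _ => h1 ε
    rw [Finset.sum_const, Finset.card_univ, ← Nat.cast_smul_eq_nsmul ℝ] at h3
    rw [← inv_smul_smul₀ hN.ne' (∑ d : σ → Ω × Ω, _), h3, Finset.sum_comm, Finset.smul_sum]
    refine Finset.sum_congr rfl fun d _ => ?_
    simp only [Finset.smul_sum]
    exact Finset.sum_congr rfl fun ε _ => smul_comm _ _ _
  rw [h2]
  refine Finset.sum_le_sum fun d _ => smul_le_smul_of_nonneg_left ?_
    (Finset.prod_nonneg fun x _ => mul_nonneg (hq _) (hq _))
  exact smul_sum_abs_le _ fun x => (hτ _).sub (hτ _)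

theorem sum_prod_smul_apply {E : Type*} [AddCommGroup E] [Module ℝ E] {q : Ω → ℝ}
    (hq : ∑ ω, q ω = 1) (F : Ω → E) (x : σ) :
    ∑ c : σ → Ω, (∏ y, q (c y)) • F (c x) = ∑ ω, q ω • F ω := by
  classical
  have h1 : ∀ ω, ∑ c : σ → Ω, (∏ y, q (c y)) * (if c x = ω then 1 else 0) = q ω := by
    intro ω
    have h2 := Finset.prod_univ_sum (fun _ : σ => (Finset.univ : Finset Ω))
      (fun y ω' => q ω' * (if y = x then (if ω' = ω then 1 else 0) else 1))
    rw [Fintype.piFinset_univ] at h2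
    have h3 : ∀ c : σ → Ω, ∏ y, q (c y) * (if y = x then (if c y = ω then 1 else 0) else 1) =
        (∏ y, q (c y)) * (if c x = ω then (1 : ℝ) else 0) := by
      intro c
      rw [Finset.prod_mul_distrib, Finset.prod_ite_eq' Finset.univ x]
      simp
    simp_rw [h3] at h2
    rw [← h2, Finset.prod_eq_single x]
    · simp
    · intro y _ hy; simp [hy, hq]
    · simp
  calc ∑ c : σ → Ω, (∏ y, q (c y)) • F (c x)
      = ∑ c : σ → Ω, ∑ ω, ((∏ y, q (c y)) * (if c x = ω then 1 else 0)) • F ω := by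
        refine Finset.sum_congr rfl fun c _ => ?_
        rw [Finset.sum_eq_single (c x)]
        · simp
        · intro ω _ h; simp [h.symm]
        · simp
    _ = _ := by
        rw [Finset.sum_comm]
        refine Finset.sum_congr rfl fun ω _ => ?_
        rw [← Finset.sum_smul, h1]

theorem sum_prod_eq_one {q : Ω → ℝ} (hq : ∑ ω, q ω = 1) : ∑ c : σ → Ω, ∏ y, q (c y) = 1 := by
  have h2 := Finset.prod_univ_sum (fun _ : σ => (Finset.univ : Finset Ω)) (fun _ ω => q ω)
  rw [Fintype.piFinset_univ] at h2
  rw [← h2]; simp [hq]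

omit [DecidableEq σ] in
-- `hs` bounds the norm of S² for the exponent conjugate to α. Hölder leaves (Tr (∑
-- Z_x²)^(α/2))^(1/α); as α/2 < 1 this trace is at most ∑ Tr |Z_x|^α, and each term is at most 2k.
theorem trace_conj_sqrt_le {κ : Type*} {f : HilbertBasis κ ℂ H} {S : H →L[ℂ] H} {s : κ → ℝ}
    (hS : IsSelfAdjoint S) (hSe : IsEigenbasis S f s) {α : ℝ} (hα : 1 < α) (hα2 : α < 2)
    (hs : ∑' j, ENNReal.ofReal (s j ^ 2) ^ (α.conjExponent) ≤ 1)
    (τ τ' : σ → H →L[ℂ] H) (hτ : ∀ x, 0 ≤ τ x) (hτ' : ∀ x, 0 ≤ τ' x) {k : ℝ≥0∞}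
    (hk : k ≠ ∞)
    (h : ∀ x, trace (CFC.rpow (τ x) α) ≤ k) (h' : ∀ x, trace (CFC.rpow (τ' x) α) ≤ k) :
    trace (S * CFC.sqrt (∑ x, (τ x - τ' x) * (τ x - τ' x)) * S) ≤
      (Fintype.card σ * (2 * k)) ^ (1 / α) := by
  have hα0 : 0 < α := by linarith
  have hne : ∀ x, trace (CFC.rpow (τ x) α) ≠ ∞ := fun x => ne_top_of_le_ne_top hk (h x)
  have hne' : ∀ x, trace (CFC.rpow (τ' x) α) ≠ ∞ := fun x => ne_top_of_le_ne_top hk (h' x)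
  set Z : σ → H →L[ℂ] H := fun x => τ x - τ' x with hZdef
  have hZs : ∀ x, IsSelfAdjoint (Z x) := fun x => (hτ x).isSelfAdjoint.sub (hτ' x).isSelfAdjoint
  have hZc : ∀ x, IsCompactOperator (Z x) := fun x =>
    (isCompactOperator_of_trace_rpow (hτ x) hα0 hα2.le (hne x)).sub
      (isCompactOperator_of_trace_rpow (hτ' x) hα0 hα2.le (hne' x))
  choose w hb z hz using fun x => exists_eigenbasis (hZs x) (hZc x)
  have hG2 : 0 ≤ ∑ x, Z x * Z x := Finset.sum_nonneg fun x _ => by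
    simpa [(hZs x).star_eq] using star_mul_self_nonneg (Z x)
  have hG2c : IsCompactOperator (⇑(∑ x, Z x * Z x : H →L[ℂ] H)) := by
    have : (∑ x, Z x * Z x : H →L[ℂ] H) ∈ compactOperator (RingHom.id ℂ) H H :=
      Submodule.sum_mem _ fun x _ => (hZc x).comp_clm (Z x)
    exact this
  obtain ⟨V, g, y, hy⟩ := exists_eigenbasis hG2.isSelfAdjoint hG2c
  have hGe := hy.rpow hG2 (r := 1 / 2) (by norm_num)
  have hGs : CFC.rpow (∑ x, Z x * Z x) (1 / 2) = CFC.sqrt (∑ x, Z x * Z x) :=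
    CFC.sqrt_eq_rpow.symm
  rw [hGs] at hGe
  have hpq := Real.HolderConjugate.conjExponent hα
  refine (trace_conj_le hS hSe (CFC.sqrt_nonneg _) hGe hpq).trans ?_
  refine (mul_le_of_le_one_right' (ENNReal.rpow_le_one hs (by
    have := hpq.symm.pos; positivity))).trans ?_
  refine ENNReal.rpow_le_rpow ?_ (by positivity)
  rw [hGe.trace_rpow (CFC.sqrt_nonneg _) hα0.le]
  have hy0 := hy.nonneg hG2
  simp_rw [← Real.rpow_mul (hy0 _)]
  refine (tsum_rpow_sum_sq_le hZs hz hy (r := 1 / 2 * α) (by positivity) (by linarith)).trans ?_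
  rw [show 2 * (1 / 2 * α) = α by ring]
  calc ∑ x, ∑' j, ENNReal.ofReal |z x j| ^ α ≤ ∑ x : σ, (k + k) := by
        refine Finset.sum_le_sum fun x _ => ?_
        obtain ⟨_, _, _, h1⟩ := exists_eigenbasis_of_trace_rpow (hτ x) hα0 (hne x)
        obtain ⟨_, _, _, h2⟩ := exists_eigenbasis_of_trace_rpow (hτ' x) hα0 (hne' x)
        exact (tsum_abs_rpow_sub_le (hτ x) h1 (hτ' x) h2 (hz x) hα.le).trans
          (add_le_add (h x) (h' x))
    _ = _ := by rw [Finset.sum_const, Finset.card_univ, nsmul_eq_mul, two_mul]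

set_option maxHeartbeats 1000000 in
/-- One-shot soft covering. -/
theorem sum_schattenNorm_one_le {κ : Type*} {f : HilbertBasis κ ℂ H} {S : H →L[ℂ] H} {s : κ → ℝ}
    (hS : IsSelfAdjoint S) (hSe : IsEigenbasis S f s) {α : ℝ} (hα : 1 < α) (hα2 : α < 2)
    (hs : ∑' j, ENNReal.ofReal (s j ^ 2) ^ (α.conjExponent) ≤ 1)
    {q : Ω → ℝ} (hq : ∀ ω, 0 ≤ q ω) (hq1 : ∑ ω, q ω = 1) (ρ τ : Ω → H →L[ℂ] H)
    (hτ : ∀ ω, 0 ≤ τ ω) (hρ : ∀ ω, q ω ≠ 0 → ρ ω = S * τ ω * S) {k : ℝ≥0∞} (hk : k ≠ ∞)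
    (h : ∀ ω, trace (CFC.rpow (τ ω) α) ≤ k) [Nonempty σ] :
    ∑ c : σ → Ω, ENNReal.ofReal (∏ x, q (c x)) *
        schattenNorm 1 ((1 / (Fintype.card σ : ℝ)) • ∑ x, ρ (c x) - ∑ ω, q ω • ρ ω) ≤
      (Fintype.card σ : ℝ≥0∞)⁻¹ * (Fintype.card σ * (2 * k)) ^ (1 / α) := by
  set M : ℝ := (Fintype.card σ : ℝ) with hMdef
  have hM : 0 < M := by
    exact Nat.cast_pos.2 Fintype.card_pos
  set Q : (σ → Ω) → ℝ := fun c => ∏ x, q (c x) with hQ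
  have hQ0 : ∀ c, 0 ≤ Q c := fun c => Finset.prod_nonneg fun x _ => hq _
  set Y : (σ → Ω) → (σ → Ω) → H →L[ℂ] H := fun c c' => ∑ x, (τ (c x) - τ (c' x)) with hY
  have hYs : ∀ c c', IsSelfAdjoint (Y c c') := fun c c' =>
    isSelfAdjoint_sum _ fun x _ => (hτ _).isSelfAdjoint.sub (hτ _).isSelfAdjoint
  -- B c dominates ± the error of c, with c' in the role of a ghost codebook. Absolute values are
  -- taken inside the conjugation by S, where the sign argument applies.
  set B : (σ → Ω) → H →L[ℂ] H := fun c => S * ((1 / M) • ∑ c', Q c' • CFC.abs (Y c c')) * S with hB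
  set Φ : (H →L[ℂ] H) →ₗ[ℝ] (H →L[ℂ] H) := LinearMap.mulRight ℝ S ∘ₗ LinearMap.mulLeft ℝ S
  have hΦ : ∀ a, Φ a = S * a * S := fun a => rfl
  have hconj : ∀ {a b : H →L[ℂ] H}, a ≤ b → S * a * S ≤ S * b * S := fun hab => by
    simpa [hS.star_eq] using star_left_conjugate_le_conjugate hab S
  have hin0 : ∀ c, 0 ≤ (1 / M) • ∑ c', Q c' • CFC.abs (Y c c') := fun c =>
    smul_nonneg (by positivity) (Finset.sum_nonneg fun c' _ =>
      smul_nonneg (hQ0 c') (CFC.abs_nonneg _))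
  have hB0 : ∀ c, 0 ≤ B c := fun c => by
    have := hconj (hin0 c)
    rwa [mul_zero, zero_mul] at this
  have hρ' : ∀ ω, q ω • ρ ω = S * (q ω • τ ω) * S := by
    intro ω
    by_cases h0 : q ω = 0
    · simp [h0]
    · rw [hρ ω h0]; simp
  -- Averaging over c' replaces ∑ τ (c' x) by M times the mean. The factorisation ρ = S τ S is
  -- available only where q is nonzero, hence the restriction on c.
  have hT : ∀ c, Q c ≠ 0 → (1 / M) • ∑ x, ρ (c x) - ∑ ω, q ω • ρ ω =
      S * ((1 / M) • ∑ c', Q c' • Y c c') * S := by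
    intro c hc
    have h1 : ∑ c', Q c' • Y c c' = ∑ x, τ (c x) - M • ∑ ω, q ω • τ ω := by
      simp_rw [hY, Finset.smul_sum (s := Finset.univ (α := σ)), smul_sub]
      rw [Finset.sum_comm]
      simp_rw [Finset.sum_sub_distrib]
      congr 1
      · refine Finset.sum_congr rfl fun x _ => ?_
        rw [← Finset.sum_smul, sum_prod_eq_one hq1, one_smul]
      · simp_rw [hQ, sum_prod_smul_apply hq1 τ]
        rw [Finset.sum_const, Finset.card_univ, ← Nat.cast_smul_eq_nsmul ℝ]
    have h2 : ∀ x, ρ (c x) = S * τ (c x) * S := fun x =>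
      hρ _ fun h0 => hc (Finset.prod_eq_zero (Finset.mem_univ x) h0)
    rw [h1, smul_sub, smul_smul, one_div_mul_cancel hM.ne', one_smul, ← hΦ, map_sub, map_smul,
      map_sum, map_sum]
    simp_rw [hΦ, hρ', h2]
  have hbound : ∀ c, ENNReal.ofReal (Q c) *
      schattenNorm 1 ((1 / M) • ∑ x, ρ (c x) - ∑ ω, q ω • ρ ω) ≤ trace (Q c • B c) := by
    intro c
    rw [trace_smul (hB0 c) (hQ0 c)]
    by_cases hc : Q c = 0
    · simp [hc]
    gcongr
    rw [hT c hc]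
    have habs : ∀ c', Y c c' ≤ CFC.abs (Y c c') ∧ -CFC.abs (Y c c') ≤ Y c c' := by
      intro c'
      have h1 := CFC.abs_sub_self (Y c c') (hYs c c')
      have h2 := CFC.abs_add_self (Y c c') (hYs c c')
      constructor
      · rw [← sub_nonneg, h1]; exact nsmul_nonneg (CFC.negPart_nonneg _) 2
      · rw [← sub_nonneg, sub_neg_eq_add, add_comm, h2]; exact nsmul_nonneg (CFC.posPart_nonneg _) 2
    refine schattenNorm_one_le_trace ?_ ?_
    · have : -B c = S * ((1 / M) • ∑ c', Q c' • -CFC.abs (Y c c')) * S := by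
        simp only [hB, ← hΦ, smul_neg, Finset.sum_neg_distrib, map_neg]
      rw [this]
      refine hconj (smul_le_smul_of_nonneg_left (Finset.sum_le_sum fun c' _ =>
        smul_le_smul_of_nonneg_left (habs c').2 (hQ0 c')) (by positivity))
    · refine hconj (smul_le_smul_of_nonneg_left (Finset.sum_le_sum fun c' _ =>
        smul_le_smul_of_nonneg_left (habs c').1 (hQ0 c')) (by positivity))
  set q2 : (σ → Ω × Ω) → ℝ := fun d => ∏ x, q (d x).1 * q (d x).2 with hq2
  have hq20 : ∀ d, 0 ≤ q2 d := fun d => Finset.prod_nonneg fun x _ => mul_nonneg (hq _) (hq _)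
  set G : (σ → Ω × Ω) → H →L[ℂ] H := fun d =>
    CFC.sqrt (∑ x, (τ (d x).1 - τ (d x).2) * (τ (d x).1 - τ (d x).2)) with hG
  -- Pairs of codebooks are regrouped as families of pairs, the form in which codewords and ghosts
  -- can be swapped.
  have hsumB : ∑ c, Q c • B c ≤ ∑ d, (q2 d * (1 / M)) • (S * G d * S) := by
    have h1 : ∑ c, Q c • B c = S * ((1 / M) • ∑ d : σ → Ω × Ω, q2 d •
        CFC.abs (∑ x, (τ (d x).1 - τ (d x).2))) * S := by
      have h2 : ∑ d : σ → Ω × Ω, q2 d • CFC.abs (∑ x, (τ (d x).1 - τ (d x).2)) =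
          ∑ c, ∑ c', (Q c * Q c') • CFC.abs (Y c c') := by
        rw [← Fintype.sum_prod_type' (f := fun c c' => (Q c * Q c') • CFC.abs (Y c c'))]
        refine Fintype.sum_equiv (Equiv.arrowProdEquivProdArrow σ (fun _ => Ω) (fun _ => Ω)) _ _
          fun d => ?_
        simp only [hq2, Finset.prod_mul_distrib]
        rfl
      rw [h2]
      simp only [hB, ← hΦ, map_smul, map_sum, Finset.smul_sum, smul_smul]
      refine Finset.sum_congr rfl fun c _ => Finset.sum_congr rfl fun c' _ => ?_
      congr 1; ring
    rw [h1]
    refine (hconj (smul_le_smul_of_nonneg_left (sum_abs_le_sum_sqrt hq τ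
      fun ω => (hτ ω).isSelfAdjoint) (by positivity))).trans_eq ?_
    simp only [← hΦ, map_smul, map_sum, Finset.smul_sum, smul_smul]
    refine Finset.sum_congr rfl fun d _ => ?_
    rw [mul_comm]
  have hSG0 : ∀ d, 0 ≤ S * G d * S := fun d => by
    have := hconj (CFC.sqrt_nonneg (∑ x, (τ (d x).1 - τ (d x).2) * (τ (d x).1 - τ (d x).2)))
    rwa [mul_zero, zero_mul] at this
  have hq2sum : ∑ d, ENNReal.ofReal (q2 d) = 1 := by
    rw [← ENNReal.ofReal_sum_of_nonneg fun d _ => hq20 d]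
    have := sum_prod_eq_one (σ := σ) (Ω := Ω × Ω) (q := fun ω => q ω.1 * q ω.2) (by
      rw [Fintype.sum_prod_type]
      simp only [← Finset.mul_sum, hq1, mul_one])
    rw [hq2, this, ENNReal.ofReal_one]
  calc ∑ c, ENNReal.ofReal (Q c) * schattenNorm 1 ((1 / M) • ∑ x, ρ (c x) - ∑ ω, q ω • ρ ω)
      ≤ ∑ c, trace (Q c • B c) := Finset.sum_le_sum fun c _ => hbound c
    _ = trace (∑ c, Q c • B c) := (trace_sum _ _ fun c _ => smul_nonneg (hQ0 c) (hB0 c)).symm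
    _ ≤ trace (∑ d, (q2 d * (1 / M)) • (S * G d * S)) :=
        trace_mono (Finset.sum_nonneg fun c _ => smul_nonneg (hQ0 c) (hB0 c)) hsumB
    _ = ∑ d, ENNReal.ofReal (q2 d * (1 / M)) * trace (S * G d * S) := by
        rw [trace_sum _ _ fun d _ => smul_nonneg (mul_nonneg (hq20 d) (by positivity)) (hSG0 d)]
        exact Finset.sum_congr rfl fun d _ =>
          trace_smul (hSG0 d) (mul_nonneg (hq20 d) (by positivity))
    _ ≤ ∑ d, ENNReal.ofReal (q2 d) * ((Fintype.card σ : ℝ≥0∞)⁻¹ *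
          (Fintype.card σ * (2 * k)) ^ (1 / α)) := by
        refine Finset.sum_le_sum fun d _ => ?_
        rw [ENNReal.ofReal_mul (hq20 d), mul_assoc, one_div, ENNReal.ofReal_inv_of_pos hM,
          ENNReal.ofReal_natCast]
        gcongr
        exact trace_conj_sqrt_le hS hSe hα hα2 hs _ _ (fun x => hτ _) (fun x => hτ _) hk
          (fun x => h _) (fun x => h _)
    _ = _ := by rw [← Finset.sum_mul, hq2sum, one_mul]

end Covering

/-! ### Product vectors and tensor products of operators -/

section Pure

variable {ι : Type*} {n : ℕ}

/-- The standard Hilbert basis of `ℓ²(κ)`. -/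
def stdBasis (κ : Type*) : HilbertBasis κ ℂ ℓ²(κ, ℂ) := ⟨LinearIsometryEquiv.refl ℂ _⟩

theorem inner_stdBasis {κ : Type*} (i : κ) (f : ℓ²(κ, ℂ)) : ⟪stdBasis κ i, f⟫_ℂ = f i :=
  ((stdBasis κ).repr_apply_apply f i).symm

open Classical in
theorem stdBasis_apply {κ : Type*} (i j : κ) : stdBasis κ i j = if i = j then 1 else 0 := by
  rw [← inner_stdBasis, orthonormal_iff_ite.1 (stdBasis κ).orthonormal]
  simp [eq_comm]

theorem clm_ext_basis {H K : Type*} [NormedAddCommGroup H] [InnerProductSpace ℂ H]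
    [NormedAddCommGroup K] [InnerProductSpace ℂ K] {κ : Type*} (e : HilbertBasis κ ℂ H)
    {S T : H →L[ℂ] K} (h : ∀ i, S (e i) = T (e i)) : S = T := by
  ext v
  have h1 := (e.hasSum_repr v).mapL S
  have h2 := (e.hasSum_repr v).mapL T
  simp only [map_smul, h] at h1 h2
  exact h1.unique h2

/-- `F` is the product vector `v 1 ⊗ ⋯ ⊗ v n`. -/
def IsPure (F : ℓ²(Fin n → ι, ℂ)) (v : Fin n → ℓ²(ι, ℂ)) : Prop := ∀ i, F i = ∏ k, v k (i k)

theorem IsPure.unique {F G : ℓ²(Fin n → ι, ℂ)} {v : Fin n → ℓ²(ι, ℂ)} (hF : IsPure F v)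
    (hG : IsPure G v) : F = G := by
  ext i; rw [hF, hG]

theorem IsPure.smul {F : ℓ²(Fin n → ι, ℂ)} {v : Fin n → ℓ²(ι, ℂ)} (hF : IsPure F v)
    (c : Fin n → ℂ) : IsPure ((∏ k, c k) • F) (fun k => c k • v k) := fun i => by
  rw [lp.coeFn_smul, Pi.smul_apply, hF, smul_eq_mul, ← Finset.prod_mul_distrib]
  rfl

theorem isPure_stdBasis (i : Fin n → ι) : IsPure (stdBasis _ i) (fun k => stdBasis ι (i k)) := by
  classical
  intro j
  simp_rw [stdBasis_apply]
  rw [Finset.prod_ite_zero]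
  simp [funext_iff]

theorem IsPure.slot {F : ℓ²(Fin n → ι, ℂ)} {v : Fin n → ℓ²(ι, ℂ)} (hF : IsPure F v) (k : Fin n)
    (A : ℓ²(ι, ℂ) →L[ℂ] ℓ²(ι, ℂ)) :
    IsPure (slot k A F) (Function.update v k (A (v k))) := by
  intro i
  have h1 : SoftCovering.slot k A F i =
      A (fiber k F (Equiv.funSplitAt k ι i).2) (Equiv.funSplitAt k ι i).1 := rfl
  -- Along the coordinate k a product vector is a scalar multiple of its factor v k.
  have h2 : fiber k F (Equiv.funSplitAt k ι i).2 =
      (∏ j ∈ Finset.univ.erase k, v j (i j)) • v k := by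
    ext a
    have : fiber k F (Equiv.funSplitAt k ι i).2 a =
      F ((Equiv.funSplitAt k ι).symm (a, (Equiv.funSplitAt k ι i).2)) := rfl
    rw [this, hF, ← Finset.mul_prod_erase _ _ (Finset.mem_univ k), lp.coeFn_smul, Pi.smul_apply,
      smul_eq_mul, mul_comm]
    congr 1
    · refine Finset.prod_congr rfl fun j hj => ?_
      have : j ≠ k := Finset.ne_of_mem_erase hj
      simp [Equiv.funSplitAt, Equiv.piSplitAt, this]
    · simp [Equiv.funSplitAt, Equiv.piSplitAt]
  rw [h1, h2, map_smul, lp.coeFn_smul, Pi.smul_apply, smul_eq_mul,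
    ← Finset.mul_prod_erase _ _ (Finset.mem_univ k), Function.update_self, mul_comm]
  congr 1
  refine Finset.prod_congr rfl fun j hj => ?_
  rw [Function.update_of_ne (Finset.ne_of_mem_erase hj)]

/-- `A 1 ⊗ ⋯ ⊗ A n` on `ℓ²(ι^n)`. -/
def slotProd (A : Fin n → ℓ²(ι, ℂ) →L[ℂ] ℓ²(ι, ℂ)) : ℓ²(Fin n → ι, ℂ) →L[ℂ] ℓ²(Fin n → ι, ℂ) :=
  (List.ofFn fun k => slot k (A k)).prod

theorem IsPure.slotProd {F : ℓ²(Fin n → ι, ℂ)} {v : Fin n → ℓ²(ι, ℂ)} (hF : IsPure F v)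
    (A : Fin n → ℓ²(ι, ℂ) →L[ℂ] ℓ²(ι, ℂ)) :
    IsPure (slotProd A F) (fun k => A k (v k)) := by
  -- Without repetitions each factor is acted on at most once, so the induction can track which ones
  -- are already done.
  have key : ∀ L : List (Fin n), L.Nodup →
      IsPure ((L.map fun k => SoftCovering.slot k (A k)).prod F)
        (fun k => if k ∈ L then A k (v k) else v k) := by
    intro L
    induction L with
    | nil => intro _; simpa using hF
    | cons k L ih =>
      intro hL
      rw [List.nodup_cons] at hL
      have h := (ih hL.2).slot k (A k)
      rw [List.map_cons, List.prod_cons, mul_apply_eq_comp]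
      convert h using 1
      funext j
      by_cases hj : j = k
      · subst hj; simp [hL.1]
      · simp [hj]
  have h := key (List.finRange n) (List.nodup_finRange n)
  rw [← List.ofFn_eq_map] at h
  simp only [List.mem_finRange, if_true] at h
  exact h

theorem slotProd_mul (A B : Fin n → ℓ²(ι, ℂ) →L[ℂ] ℓ²(ι, ℂ)) :
    slotProd (fun k => A k * B k) = slotProd A * slotProd B :=
  clm_ext_basis (stdBasis _) fun i => ((isPure_stdBasis i).slotProd _).unique
    (((isPure_stdBasis i).slotProd B).slotProd A)

theorem slotProd_one : slotProd (fun _ : Fin n => (1 : ℓ²(ι, ℂ) →L[ℂ] ℓ²(ι, ℂ))) = 1 :=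
  clm_ext_basis (stdBasis _) fun i => ((isPure_stdBasis i).slotProd _).unique (isPure_stdBasis i)

theorem adjoint_slotProd (A : Fin n → ℓ²(ι, ℂ) →L[ℂ] ℓ²(ι, ℂ)) :
    ContinuousLinearMap.adjoint (slotProd A) =
      slotProd (fun k => ContinuousLinearMap.adjoint (A k)) := by
  refine clm_ext_basis (stdBasis _) fun i => ?_
  ext j
  rw [← inner_stdBasis, ContinuousLinearMap.adjoint_inner_right, ← inner_conj_symm, inner_stdBasis,
    (isPure_stdBasis j).slotProd A i, (isPure_stdBasis i).slotProd _ j, map_prod]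
  refine Finset.prod_congr rfl fun k _ => ?_
  rw [← inner_stdBasis, ← inner_stdBasis, ContinuousLinearMap.adjoint_inner_right, inner_conj_symm]

end Pure

/-! ### Eigenbases of tensor products -/

section TensorOp

variable {H : Type*} [NormedAddCommGroup H] [InnerProductSpace ℂ H] [CompleteSpace H]
variable {ι : Type*} {n : ℕ}

omit [CompleteSpace H] in
theorem tensorOp_mul (b : HilbertBasis ι ℂ H) (A B : Fin n → H →L[ℂ] H) :
    tensorOp b (fun k => A k * B k) = tensorOp b A * tensorOp b B := by
  unfold tensorOp
  rw [← slotProd, ← slotProd, ← slotProd, ← slotProd_mul]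
  congr 1
  funext k
  ext v : 1
  simp

theorem isSelfAdjoint_of_isEigenbasis {κ : Type*} {T : H →L[ℂ] H} {e : HilbertBasis κ ℂ H}
    {l : κ → ℝ} (h : IsEigenbasis T e l) : IsSelfAdjoint T := by
  rw [IsSelfAdjoint, ContinuousLinearMap.star_eq_adjoint]
  refine clm_ext_basis e fun i => ?_
  refine sub_eq_zero.1 (eq_zero_of_forall_inner_eq_zero e fun j => ?_)
  rw [inner_sub_right, ContinuousLinearMap.adjoint_inner_right, h j, h i, inner_smul_left,
    inner_smul_right, Complex.conj_ofReal]
  by_cases hij : j = i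
  · subst hij; ring
  · rw [e.orthonormal.2 hij]; ring

theorem nonneg_of_isEigenbasis {κ : Type*} {T : H →L[ℂ] H} {e : HilbertBasis κ ℂ H}
    {l : κ → ℝ} (h : IsEigenbasis T e l) (hl : ∀ i, 0 ≤ l i) : 0 ≤ T := by
  have hT := isSelfAdjoint_of_isEigenbasis h
  refine nonneg_of_re_inner_nonneg hT fun v => ?_
  exact (h.hasSum_re_inner hT v).nonneg fun i => mul_nonneg (by positivity) (hl i)

omit [CompleteSpace H] in
/-- Product vectors of eigenvectors form an eigenbasis of a tensor product. -/
theorem exists_hilbertBasis_tensor (b : HilbertBasis ι ℂ H) (g : Fin n → HilbertBasis ι ℂ H) :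
    ∃ f : HilbertBasis (Fin n → ι) ℂ ℓ²(Fin n → ι, ℂ),
      ∀ (A : Fin n → H →L[ℂ] H) (d : Fin n → ι → ℝ), (∀ k, IsEigenbasis (A k) (g k) (d k)) →
        IsEigenbasis (tensorOp b A) f (fun i => ∏ k, d k (i k)) := by
  -- U k is the unitary sending the standard basis to the b-coordinates of g k. The tensor product
  -- of the U k is again unitary and carries the standard basis to the required product vectors.
  set U : Fin n → ℓ²(ι, ℂ) →L[ℂ] ℓ²(ι, ℂ) := fun k =>
    b.repr.toContinuousLinearEquiv.toContinuousLinearMap ∘L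
      (g k).repr.symm.toContinuousLinearEquiv.toContinuousLinearMap
  have hU : ∀ k i, U k (stdBasis ι i) = b.repr (g k i) := fun k i => rfl
  have hUnorm : ∀ k v w, ⟪U k v, U k w⟫_ℂ = ⟪v, w⟫_ℂ := fun k v w => by
    change ⟪b.repr ((g k).repr.symm v), b.repr ((g k).repr.symm w)⟫_ℂ = _
    rw [LinearIsometryEquiv.inner_map_map, LinearIsometryEquiv.inner_map_map]
  have h1 : ∀ k, ContinuousLinearMap.adjoint (U k) * U k = 1 := fun k => by
    ext v : 1
    refine ext_inner_left ℂ fun w => ?_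
    rw [mul_apply_eq_comp, ContinuousLinearMap.adjoint_inner_right, hUnorm, one_apply_eq_self]
  have h2 : ∀ k, U k * ContinuousLinearMap.adjoint (U k) = 1 := fun k => by
    have hsurj : Function.Surjective (U k) := b.repr.surjective.comp (g k).repr.symm.surjective
    ext v : 1
    obtain ⟨w, rfl⟩ := hsurj v
    rw [mul_apply_eq_comp, ← mul_apply_eq_comp _ (U k), h1]
    simp
  have h1' : ContinuousLinearMap.adjoint (slotProd U) * slotProd U = 1 := by
    rw [adjoint_slotProd, ← slotProd_mul, ← slotProd_one]
    congr 1; funext k; exact h1 k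
  have h2' : slotProd U * ContinuousLinearMap.adjoint (slotProd U) = 1 := by
    rw [adjoint_slotProd, ← slotProd_mul, ← slotProd_one]
    congr 1; funext k; exact h2 k
  have horth : Orthonormal ℂ (fun i => slotProd U (stdBasis (Fin n → ι) i)) := by
    classical
    rw [orthonormal_iff_ite]
    intro i j
    rw [← ContinuousLinearMap.adjoint_inner_right, ← mul_apply_eq_comp, h1', one_apply_eq_self]
    exact orthonormal_iff_ite.1 (stdBasis _).orthonormal i j
  obtain ⟨f, hf⟩ := exists_hilbertBasis_of_orthonormal horth (by
    intro w hw
    have hz : ContinuousLinearMap.adjoint (slotProd U) w = 0 :=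
      eq_zero_of_forall_inner_eq_zero (stdBasis _) fun i => by
        rw [ContinuousLinearMap.adjoint_inner_right]; exact hw i
    have := congrArg (fun T : ℓ²(Fin n → ι, ℂ) →L[ℂ] ℓ²(Fin n → ι, ℂ) => T w) h2'
    simpa [hz] using this.symm)
  refine ⟨f, fun A d hA i => ?_⟩
  have hp : IsPure (f i) (fun k => b.repr (g k (i k))) := by
    rw [hf]; exact (isPure_stdBasis i).slotProd U
  have h3 := hp.slotProd (fun k => (b.repr.toContinuousLinearEquiv.toContinuousLinearMap ∘L A k) ∘L
      b.repr.symm.toContinuousLinearEquiv.toContinuousLinearMap)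
  have h4 := hp.smul (fun k => (d k (i k) : ℂ))
  rw [Complex.ofReal_prod]
  refine IsPure.unique h3 ?_
  convert h4 using 2 with k
  change b.repr (A k (b.repr.symm (b.repr (g k (i k))))) = _
  rw [LinearIsometryEquiv.symm_apply_apply, hA, map_smul]

end TensorOp

/-! ### The sandwiched operator and its divergence -/

section Sandwich

variable {H : Type*} [NormedAddCommGroup H] [InnerProductSpace ℂ H] [CompleteSpace H]
variable {ρ σ τ τ' : H →L[ℂ] H} {γ : ℝ}

theorem IsDensity.exists_eigenbasis (h : IsDensity σ) :
    ∃ (S : Set H) (f : HilbertBasis S ℂ H) (m : S → ℝ), IsEigenbasis σ f m :=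
  exists_eigenbasis_of_trace h.1 (by rw [h.2]; exact ENNReal.one_ne_top)

theorem IsDensity.ne_zero (h : IsDensity ρ) : ρ ≠ 0 := by
  rintro rfl
  have := h.2
  rw [trace_zero] at this
  exact zero_ne_one this

/-- The equation σ^γ τ σ^γ = ρ fixes the matrix entries between nonzero eigenvalues of σ, and
vanishing on the kernel kills the others. Uniqueness of τ follows. -/
theorem IsSandwich.inner_eq {κ : Type*} {f : HilbertBasis κ ℂ H} {m : κ → ℝ}
    (hσ : 0 ≤ σ) (hf : IsEigenbasis σ f m) (hγ : 0 ≤ γ) (h : IsSandwich γ ρ σ τ) (i j : κ) :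
    ⟪f i, τ (f j)⟫_ℂ =
      if m i = 0 ∨ m j = 0 then 0 else ((m i ^ γ * m j ^ γ : ℝ) : ℂ)⁻¹ * ⟪f i, ρ (f j)⟫_ℂ := by
  have hm := hf.nonneg hσ
  have h0 : ∀ i, m i = 0 → τ (f i) = 0 := fun i hi => h.2.1 _ (by rw [hf i, hi]; simp)
  split_ifs with hz
  · rcases hz with hz | hz
    · rw [← isSelfAdjoint_iff_inner h.1.isSelfAdjoint, h0 i hz, inner_zero_left]
    · rw [h0 j hz, inner_zero_right]
  · rw [not_or] at hz
    have h1 : 0 < m i ^ γ := Real.rpow_pos_of_pos ((hm i).lt_of_ne' hz.1) _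
    have h2 : 0 < m j ^ γ := Real.rpow_pos_of_pos ((hm j).lt_of_ne' hz.2) _
    have hfγ := hf.rpow hσ hγ
    have hsa : IsSelfAdjoint (CFC.rpow σ γ) := isSelfAdjoint_of_isEigenbasis hfγ
    rw [← h.2.2, mul_apply_eq_comp, mul_apply_eq_comp, hfγ.inner_apply hsa, hfγ j, map_smul,
      inner_smul_right]
    push_cast
    have h1' : ((m i ^ γ : ℝ) : ℂ) ≠ 0 := by exact_mod_cast h1.ne'
    have h2' : ((m j ^ γ : ℝ) : ℂ) ≠ 0 := by exact_mod_cast h2.ne'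
    field_simp

theorem IsSandwich.unique (hσ : IsDensity σ) (hγ : 0 ≤ γ) (h : IsSandwich γ ρ σ τ)
    (h' : IsSandwich γ ρ σ τ') : τ = τ' := by
  obtain ⟨S, f, m, hf⟩ := hσ.exists_eigenbasis
  refine clm_ext_basis f fun j => sub_eq_zero.1 (eq_zero_of_forall_inner_eq_zero f fun i => ?_)
  rw [inner_sub_right, h.inner_eq hσ.1 hf hγ, h'.inner_eq hσ.1 hf hγ, sub_self]

theorem trace_rpow_ne_zero (hT : 0 ≤ τ) (h0 : τ ≠ 0) {r : ℝ} (hr : 0 < r) :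
    trace (CFC.rpow τ r) ≠ 0 := by
  intro h
  obtain ⟨S, f, m, hf⟩ := exists_eigenbasis_of_trace_rpow hT hr (by rw [h]; exact ENNReal.zero_ne_top)
  refine h0 (clm_ext_basis f fun i => ?_)
  rw [hf.trace_rpow hT hr.le, ENNReal.tsum_eq_zero] at h
  have h1 := ENNReal.ofReal_eq_zero.1 (h i)
  have h2 : m i = 0 := by
    by_contra hne
    exact absurd h1 (not_le.2 (Real.rpow_pos_of_pos ((hf.nonneg hT i).lt_of_ne' hne) r))
  rw [hf i, h2]; simp

theorem IsSandwich.ne_zero (h : IsSandwich γ ρ σ τ) (hρ : IsDensity ρ) : τ ≠ 0 := by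
  rintro rfl
  exact hρ.ne_zero (by rw [← h.2.2]; simp)

/-- By uniqueness the infimum has a single value. The trace is nonzero because ρ, hence τ, is
nonzero, so its logarithm is real. -/
theorem sandwichedDiv_eq {α : ℝ} (hα : 1 < α) (hρ : IsDensity ρ) (hσ : IsDensity σ)
    (h : IsSandwich ((α - 1) / (2 * α)) ρ σ τ) (hfin : trace (CFC.rpow τ α) ≠ ∞) :
    sandwichedDiv α ρ σ = ((1 / (α - 1) * Real.log (trace (CFC.rpow τ α)).toReal : ℝ) : EReal) := by
  have hγ : 0 ≤ (α - 1) / (2 * α) := div_nonneg (by linarith) (by linarith)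
  have h1 : sandwichedDiv α ρ σ =
      ((α / (α - 1) : ℝ) : EReal) * ENNReal.log (schattenNorm α τ) := by
    unfold sandwichedDiv
    refine le_antisymm (iInf₂_le τ h) (le_iInf₂ fun τ' h' => ?_)
    rw [h.unique hσ hγ h']
  have h0 := trace_rpow_ne_zero h.1 (h.ne_zero hρ) (show 0 < α by linarith)
  rw [h1, schattenNorm_of_nonneg h.1, ENNReal.log_rpow, ENNReal.log_pos_real h0 hfin,
    ← EReal.coe_mul, ← EReal.coe_mul]
  congr 1
  have : α - 1 ≠ 0 := by linarith
  have : α ≠ 0 := by linarith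
  field_simp

theorem exists_of_sandwichedDiv_ne_top {α : ℝ} (hα : 1 < α) (h : sandwichedDiv α ρ σ ≠ ⊤) :
    ∃ τ, IsSandwich ((α - 1) / (2 * α)) ρ σ τ ∧ trace (CFC.rpow τ α) ≠ ∞ := by
  by_contra! hne
  refine h ?_
  unfold sandwichedDiv
  refine iInf₂_eq_top.2 fun τ hτ => ?_
  rw [schattenNorm_of_nonneg hτ.1, hne τ hτ, ENNReal.top_rpow_of_pos (by positivity),
    ENNReal.log_top, EReal.coe_mul_top_of_pos (div_pos (by linarith) (by linarith))]

theorem sandwichedDiv_ne_bot {α : ℝ} (hα : 1 < α) (hρ : IsDensity ρ) (hσ : IsDensity σ) :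
    sandwichedDiv α ρ σ ≠ ⊥ := by
  by_cases h : sandwichedDiv α ρ σ = ⊤
  · rw [h]; exact top_ne_bot
  · obtain ⟨τ, hτ, hfin⟩ := exists_of_sandwichedDiv_ne_top hα h
    rw [sandwichedDiv_eq hα hρ hσ hτ hfin]
    exact EReal.coe_ne_bot _

theorem sum_coe_real {X : Type*} (s : Finset X) (F : X → ℝ) :
    ∑ x ∈ s, (F x : EReal) = ((∑ x ∈ s, F x : ℝ) : EReal) := by
  classical
  induction s using Finset.induction_on with
  | empty => simp
  | insert a s ha ih => rw [Finset.sum_insert ha, Finset.sum_insert ha, ih, EReal.coe_add]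

/-- A finite sum confines infinite values to indices of weight zero, where the default value of
`toReal` is multiplied by 0. -/
theorem sum_mul_eq_coe {X : Type*} [Fintype X] {p : X → ℝ} (hp : ∀ x, 0 ≤ p x) {D : X → EReal}
    (hbot : ∀ x, D x ≠ ⊥) (h : ∑ x, (p x : EReal) * D x ≠ ⊤) :
    (∀ x, p x ≠ 0 → D x ≠ ⊤) ∧
      ∑ x, (p x : EReal) * D x = ((∑ x, p x * (D x).toReal : ℝ) : EReal) := by
  classical
  have hb : ∀ x, (p x : EReal) * D x ≠ ⊥ := by
    intro x
    rcases (hp x).eq_or_lt with h0 | h0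
    · rw [← h0]; simp
    · rcases eq_or_ne (D x) ⊤ with ht | ht
      · rw [ht, EReal.coe_mul_top_of_pos h0]; exact top_ne_bot
      · rw [← EReal.coe_toReal ht (hbot x), ← EReal.coe_mul]; exact EReal.coe_ne_bot _
  have h1 : ∀ x, p x ≠ 0 → D x ≠ ⊤ := by
    intro x hx ht
    refine h ?_
    rw [← Finset.add_sum_erase _ _ (Finset.mem_univ x), ht,
      EReal.coe_mul_top_of_pos ((hp x).lt_of_ne' hx), EReal.top_add_of_ne_bot]
    have : ∀ s : Finset X, ∑ x ∈ s, (p x : EReal) * D x ≠ ⊥ := by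
      intro s
      induction s using Finset.induction_on with
      | empty => simp
      | insert a s ha ih =>
        rw [Finset.sum_insert ha, ne_eq, EReal.add_eq_bot_iff, not_or]
        exact ⟨hb a, ih⟩
    exact this _
  refine ⟨h1, ?_⟩
  have h2 : ∀ x, (p x : EReal) * D x = ((p x * (D x).toReal : ℝ) : EReal) := by
    intro x
    by_cases h0 : p x = 0
    · rw [h0]; simp
    · rw [EReal.coe_mul, EReal.coe_toReal (h1 x h0) (hbot x)]
  simp_rw [h2]
  exact sum_coe_real _ _

end Sandwich

/-! ### Combinatorics of the type class -/

section TypeClass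

theorem tsum_prod_pi {ι : Type*} : ∀ {n : ℕ} (g : Fin n → ι → ℝ≥0∞),
    ∑' i : Fin n → ι, ∏ k, g k (i k) = ∏ k, ∑' a, g k a
  | 0, g => by simp
  | n + 1, g => by
    rw [← (Fin.consEquiv fun _ => ι).tsum_eq, Fin.prod_univ_succ, ← tsum_prod_pi fun k => g k.succ,
      ← ENNReal.tsum_mul_right, ENNReal.tsum_prod']
    refine tsum_congr fun a => ?_
    rw [← ENNReal.tsum_mul_left]
    refine tsum_congr fun i => ?_
    rw [Fin.prod_univ_succ]
    simp [Fin.consEquiv]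

variable {X : Type*} [Fintype X] {p : X → ℝ} {n : ℕ}

theorem typeDist_nonneg (xs : Fin n → X) : 0 ≤ typeDist n p xs := by
  unfold typeDist
  split_ifs <;> positivity

theorem mem_typeClass_of_ne_zero {xs : Fin n → X} (h : typeDist n p xs ≠ 0) :
    xs ∈ typeClass n p := by
  by_contra hc
  exact h (by simp [typeDist, hc])

open Classical in
theorem card_of_mem_typeClass (hn : 1 ≤ n) {xs : Fin n → X} (h : xs ∈ typeClass n p) (x : X) :
    ((Finset.univ.filter fun k => xs k = x).card : ℝ) = n * p x := by
  have h1 := (Finset.mem_filter.1 h).2 x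
  have hn' : (n : ℝ) ≠ 0 := by positivity
  rw [← h1, Finset.sum_boole]
  field_simp
  simp_rw [eq_comm]

/-- Each letter x occurs exactly n p(x) times, so products along codewords are constant on the type
class. Hence p-averages of logarithms appear in the exponent. -/
theorem prod_of_mem_typeClass (hn : 1 ≤ n) {xs : Fin n → X} (h : xs ∈ typeClass n p)
    (g : X → ℝ≥0∞) : ∏ k, g (xs k) = ∏ x, g x ^ (n * p x) := by
  classical
  rw [← Finset.prod_fiberwise_of_maps_to (s := Finset.univ) (t := Finset.univ) (g := xs)
    (fun _ _ => Finset.mem_univ _)]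
  refine Finset.prod_congr rfl fun x _ => ?_
  rw [← card_of_mem_typeClass hn h x, ENNReal.rpow_natCast, ← Finset.prod_const]
  refine Finset.prod_congr rfl fun k hk => ?_
  rw [(Finset.mem_filter.1 hk).2]

theorem ne_zero_of_mem_typeClass (hn : 1 ≤ n) {xs : Fin n → X} (h : xs ∈ typeClass n p)
    (k : Fin n) : p (xs k) ≠ 0 := by
  classical
  intro h0
  have := card_of_mem_typeClass hn h (xs k)
  rw [h0, mul_zero, Nat.cast_eq_zero, Finset.card_eq_zero] at this
  have hk : k ∈ Finset.univ.filter fun j => xs j = xs k := by simp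
  rw [this] at hk
  exact Finset.notMem_empty _ hk

theorem exists_typeClass_mem (hp1 : ∑ x, p x = 1) (hn : 1 ≤ n)
    (hnp : ∀ x, ∃ k : ℕ, (n : ℝ) * p x = k) : (typeClass n p).Nonempty := by
  classical
  choose N hN using hnp
  have hsum : ∑ x, N x = n := by
    have : ((∑ x, N x : ℕ) : ℝ) = n := by
      push_cast
      simp_rw [← hN, ← Finset.mul_sum, hp1, mul_one]
    exact_mod_cast this
  have hcard : Fintype.card (Σ x, Fin (N x)) = n := by simp [hsum]
  -- A word of the right type is read off a bijection of the n positions with N x tagged copies of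
  -- each letter x.
  obtain ⟨φ⟩ : Nonempty (Fin n ≃ Σ x, Fin (N x)) := ⟨(Fintype.equivFinOfCardEq hcard).symm⟩
  refine ⟨fun k => (φ k).1, Finset.mem_filter.2 ⟨Finset.mem_univ _, fun x => ?_⟩⟩
  have hn' : (n : ℝ) ≠ 0 := by positivity
  have h1 : (∑ i, if x = (φ i).1 then (1 : ℝ) else 0) = N x := by
    rw [Equiv.sum_comp φ fun y => if x = y.1 then (1 : ℝ) else 0, Fintype.sum_sigma,
      Finset.sum_eq_single x]
    · simp
    · intro y _ hy; simp [hy.symm]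
    · simp
  rw [h1, ← hN]
  field_simp

theorem sum_typeDist (hp1 : ∑ x, p x = 1) (hn : 1 ≤ n)
    (hnp : ∀ x, ∃ k : ℕ, (n : ℝ) * p x = k) : ∑ xs : Fin n → X, typeDist n p xs = 1 := by
  classical
  have h := exists_typeClass_mem hp1 hn hnp
  have hc : ((typeClass n p).card : ℝ) ≠ 0 := by
    rw [Nat.cast_ne_zero]; exact h.card_pos.ne'
  unfold typeDist
  rw [← Finset.mul_sum, Finset.sum_boole]
  simp [hc]

end TypeClass

/-! ### The covering bound on the type class -/

section Bound

variable {X : Type*} [Fintype X] {p : X → ℝ} {n M : ℕ}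
variable {H : Type*} [NormedAddCommGroup H] [InnerProductSpace ℂ H] [CompleteSpace H]
variable {ι : Type*}

theorem exists_reindex_eigenbasis {κ : Type*} (b : HilbertBasis ι ℂ H) {T : H →L[ℂ] H}
    {e : HilbertBasis κ ℂ H} {l : κ → ℝ} (h : IsEigenbasis T e l) :
    ∃ (g : HilbertBasis ι ℂ H) (d : ι → ℝ), IsEigenbasis T g d := by
  obtain ⟨φ⟩ := nonempty_equiv_of_hilbertBasis b e
  obtain ⟨g, hg⟩ := exists_reindex e φ
  exact ⟨g, fun i => l (φ i), fun i => by rw [hg]; exact h _⟩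

theorem trace_rpow_le_of_eigenbasis {κ : Type*} {T : H →L[ℂ] H} {r : ℝ} (hr : 0 < r) {B : ℝ≥0∞}
    (h : T = 0 ∨ ∃ (f : HilbertBasis κ ℂ H) (l : κ → ℝ), IsEigenbasis T f l ∧ (∀ i, 0 ≤ l i) ∧
      ∑' i, ENNReal.ofReal (l i ^ r) ≤ B) : trace (CFC.rpow T r) ≤ B := by
  rcases h with rfl | ⟨f, l, hf, hl, hB⟩
  · rw [CFC.zero_rpow hr.ne', trace_zero]
    exact zero_le
  · rwa [hf.trace_rpow (nonneg_of_isEigenbasis hf hl) hr.le]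

theorem expectedTraceDist_le (b : HilbertBasis ι ℂ H) (hp1 : ∑ x, p x = 1)
    (ρ : X → H →L[ℂ] H) (hn : 1 ≤ n) (hM : 1 ≤ M) (hnp : ∀ x, ∃ k : ℕ, (n : ℝ) * p x = k)
    {α : ℝ} (hα : 1 < α) (hα2 : α < 2) {σ : H →L[ℂ] H} (hσ : IsDensity σ) (τ : X → H →L[ℂ] H)
    (hτ : ∀ x, p x ≠ 0 → IsSandwich ((α - 1) / (2 * α)) (ρ x) σ (τ x))
    (hfin : ∀ x, p x ≠ 0 → trace (CFC.rpow (τ x) α) ≠ ∞) :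
    expectedTraceDist b p ρ n M ≤ (1 / 2) * ((M : ℝ≥0∞)⁻¹ *
      (M * (2 * ∏ x, trace (CFC.rpow (τ x) α) ^ (n * p x))) ^ (1 / α)) := by
  classical
  have hα0 : 0 < α := by linarith
  obtain ⟨_, f0, m0, hf0⟩ := hσ.exists_eigenbasis
  obtain ⟨f1, m, hf1⟩ := exists_reindex_eigenbasis b hf0
  have hm := hf1.nonneg hσ.1
  set γ := (α - 1) / (2 * α) with hγdef
  have hγ : 0 ≤ γ := div_nonneg (by linarith) (by linarith)
  have hg : ∀ x, ∃ (g : HilbertBasis ι ℂ H) (d : ι → ℝ), p x ≠ 0 → IsEigenbasis (τ x) g d := by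
    intro x
    by_cases hx : p x = 0
    · exact ⟨b, 0, fun h => absurd hx h⟩
    · obtain ⟨_, e, l, h⟩ := exists_eigenbasis_of_trace_rpow (hτ x hx).1 hα0 (hfin x hx)
      obtain ⟨g, d, h⟩ := exists_reindex_eigenbasis b h
      exact ⟨g, d, fun _ => h⟩
  choose g d hgd using hg
  obtain ⟨f, hf⟩ := exists_hilbertBasis_tensor b (fun _ : Fin n => f1)
  set S := tensorOp b (fun _ : Fin n => CFC.rpow σ γ)
  have hSe := hf (fun _ => CFC.rpow σ γ) (fun _ i => m i ^ γ) (fun _ => hf1.rpow hσ.1 hγ)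
  have hS : IsSelfAdjoint S := isSelfAdjoint_of_isEigenbasis hSe
  have hs : ∑' i : Fin n → ι, ENNReal.ofReal ((∏ k, m (i k) ^ γ) ^ 2) ^ α.conjExponent ≤ 1 := by
    have hq : 0 ≤ α.conjExponent := (Real.HolderConjugate.conjExponent hα).symm.nonneg
    have h1 : ∀ i : Fin n → ι, ENNReal.ofReal ((∏ k, m (i k) ^ γ) ^ 2) ^ α.conjExponent =
        ∏ k, ENNReal.ofReal (m (i k)) := by
      intro i
      rw [ENNReal.ofReal_rpow_of_nonneg (by positivity) hq, ← Finset.prod_pow,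
        ← Real.finsetProd_rpow _ _ (fun k _ => by have := hm (i k); positivity),
        ENNReal.ofReal_prod_of_nonneg (fun k _ => by have := hm (i k); positivity)]
      refine Finset.prod_congr rfl fun k _ => ?_
      rw [← Real.rpow_natCast, ← Real.rpow_mul (hm _), ← Real.rpow_mul (hm _)]
      -- The choice of γ makes the conjugate power of (σ^γ)² equal to σ, so the sum over ι^n is (Tr
      -- σ)^n = 1.
      have : γ * (2 : ℕ) * α.conjExponent = 1 := by
        rw [hγdef, Real.conjExponent]
        have : α - 1 ≠ 0 := by linarith
        push_cast; field_simp
      rw [this, Real.rpow_one]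
    simp_rw [h1]
    rw [tsum_prod_pi (fun _ => fun a => ENNReal.ofReal (m a)), ← hf1.trace_eq hσ.1, hσ.2]
    simp
  set q : (Fin n → X) → ℝ := typeDist n p
  -- τ x is controlled only when p x ≠ 0. At words of probability zero the tensor product is
  -- replaced by 0, which is positive and meets the trace bound.
  set τn : (Fin n → X) → ℓ²(Fin n → ι, ℂ) →L[ℂ] ℓ²(Fin n → ι, ℂ) := fun xs =>
    if q xs = 0 then 0 else tensorOp b fun k => τ (xs k)
  have hpx : ∀ xs, q xs ≠ 0 → ∀ k, p (xs k) ≠ 0 := fun xs hxs k =>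
    ne_zero_of_mem_typeClass hn (mem_typeClass_of_ne_zero hxs) k
  have hτe : ∀ xs, q xs ≠ 0 → ∃ fx : HilbertBasis (Fin n → ι) ℂ ℓ²(Fin n → ι, ℂ),
      IsEigenbasis (tensorOp b fun k => τ (xs k)) fx (fun i => ∏ k, d (xs k) (i k)) := by
    intro xs hxs
    obtain ⟨fx, hfx⟩ := exists_hilbertBasis_tensor b (fun k => g (xs k))
    exact ⟨fx, hfx _ _ fun k => hgd _ (hpx xs hxs k)⟩
  have hd : ∀ x, p x ≠ 0 → ∀ i, 0 ≤ d x i := fun x hx => (hgd x hx).nonneg (hτ x hx).1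
  have hτ0 : ∀ xs, 0 ≤ τn xs := by
    intro xs
    by_cases hxs : q xs = 0
    · simp [τn, hxs]
    · obtain ⟨fx, hfx⟩ := hτe xs hxs
      simp only [τn, hxs, if_false]
      exact nonneg_of_isEigenbasis hfx fun i => Finset.prod_nonneg fun k _ => hd _ (hpx xs hxs k) _
  have hτρ : ∀ xs, q xs ≠ 0 → tensorOp b (fun k => ρ (xs k)) = S * τn xs * S := by
    intro xs hxs
    simp only [τn, hxs, if_false, S]
    rw [← tensorOp_mul, ← tensorOp_mul]
    congr 1
    funext k
    exact (hτ _ (hpx xs hxs k)).2.2.symm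
  have hk := fun xs => trace_rpow_le_of_eigenbasis (κ := Fin n → ι) (T := τn xs) hα0
    (B := ∏ x, trace (CFC.rpow (τ x) α) ^ (n * p x)) (by
    by_cases hxs : q xs = 0
    · exact Or.inl (by simp only [τn, hxs, if_true])
    · refine Or.inr ?_
      rw [← prod_of_mem_typeClass hn (mem_typeClass_of_ne_zero hxs)
        (fun x => trace (CFC.rpow (τ x) α))]
      obtain ⟨fx, hfx⟩ := hτe xs hxs
      simp only [τn, hxs, if_false]
      refine ⟨fx, _, hfx, fun i => Finset.prod_nonneg fun k _ => hd _ (hpx xs hxs k) _,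
        le_of_eq ?_⟩
      have h1 : ∀ k, trace (CFC.rpow (τ (xs k)) α) = ∑' a, ENNReal.ofReal (d (xs k) a ^ α) :=
        fun k => (hgd _ (hpx xs hxs k)).trace_rpow (hτ _ (hpx xs hxs k)).1 hα0.le
      simp_rw [h1]
      rw [← tsum_prod_pi fun k a => ENNReal.ofReal (d (xs k) a ^ α)]
      refine tsum_congr fun i => ?_
      rw [← Real.finsetProd_rpow _ _ (fun k _ => hd _ (hpx xs hxs k) _),
        ENNReal.ofReal_prod_of_nonneg
          (fun k _ => Real.rpow_nonneg (hd _ (hpx xs hxs k) _) _)])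
  have hktop : ∏ x, trace (CFC.rpow (τ x) α) ^ (n * p x) ≠ ∞ := by
    refine ENNReal.prod_ne_top fun x _ => ?_
    obtain ⟨N, hN⟩ := hnp x
    by_cases hx : p x = 0
    · rw [hx]; simp
    · rw [hN, ENNReal.rpow_natCast]
      exact ENNReal.pow_ne_top (hfin x hx)
  have : Nonempty (Fin M) := ⟨⟨0, hM⟩⟩
  have key := sum_schattenNorm_one_le (σ := Fin M) hS hSe hα hα2 hs typeDist_nonneg
    (sum_typeDist hp1 hn hnp) (fun xs => tensorOp b fun k => ρ (xs k)) τn hτ0 hτρ hktop hk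
  rw [Fintype.card_fin] at key
  unfold expectedTraceDist
  gcongr
  refine le_trans (le_of_eq (Finset.sum_congr rfl fun c _ => ?_)) key
  have hcb : codebookState b ρ c = (1 / (M : ℝ)) • ∑ x, tensorOp b fun k => ρ (c x k) := by
    rw [codebookState, show (1 / (M : ℂ)) = ((1 / (M : ℝ) : ℝ) : ℂ) by push_cast; rfl]
    exact Complex.coe_smul _ _
  have hts : typeState b n p ρ = ∑ ω, q ω • tensorOp b fun k => ρ (ω k) := by
    rw [typeState]
    exact Finset.sum_congr rfl fun xs _ => Complex.coe_smul _ _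
  rw [hcb, hts]
  rfl

end Bound

/-! ### From the covering bound to the exponent -/

section Exponent

variable {X : Type*} [Fintype X] {p : X → ℝ} {n M : ℕ}
variable {H : Type*} [NormedAddCommGroup H] [InnerProductSpace ℂ H] [CompleteSpace H]
variable {ι : Type*} {ρ : X → H →L[ℂ] H} {R α : ℝ}

/-- The finite case of the covering bound, in terms of the sandwiched divergences to a fixed
state `σ`. -/
theorem expectedTraceDist_le_exp (b : HilbertBasis ι ℂ H) (hp : ∀ x, 0 ≤ p x)
    (hp1 : ∑ x, p x = 1) (hρ : ∀ x, IsDensity (ρ x)) (hn : 1 ≤ n) (hM : 1 ≤ M)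
    (hnp : ∀ x, ∃ k : ℕ, (n : ℝ) * p x = k) (hR : R = 1 / n * Real.log M)
    (hα : 1 < α) (hα2 : α < 2) {σ : H →L[ℂ] H} (hσ : IsDensity σ)
    (h : ∑ x, (p x : EReal) * sandwichedDiv α (ρ x) σ ≠ ⊤) :
    expectedTraceDist b p ρ n M ≤ ENNReal.ofReal (Real.exp
      (n * ((α - 1) / α * (∑ x, p x * (sandwichedDiv α (ρ x) σ).toReal - R)))) := by
  obtain ⟨h1, -⟩ := sum_mul_eq_coe hp (fun x => sandwichedDiv_ne_bot hα (hρ x) hσ) h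
  choose! τ hτ hfin using fun x hx => exists_of_sandwichedDiv_ne_top hα (h1 x hx)
  refine (expectedTraceDist_le b hp1 ρ hn hM hnp hα hα2 hσ τ hτ hfin).trans ?_
  have hα0 : 0 < α := by linarith
  have hMr : (0 : ℝ) < M := by positivity
  -- Where p x = 0 the exponent n p x vanishes, so any positive value would do; 1 keeps the
  -- logarithms defined.
  set K : X → ℝ := fun x => if p x = 0 then 1 else (trace (CFC.rpow (τ x) α)).toReal
  have hK0 : ∀ x, 0 < K x := by
    intro x
    by_cases hx : p x = 0
    · simp [K, hx]
    · simp only [K, hx, if_false]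
      exact ENNReal.toReal_pos
        (trace_rpow_ne_zero (hτ x hx).1 ((hτ x hx).ne_zero (hρ x)) hα0) (hfin x hx)
  have hK : ∏ x, trace (CFC.rpow (τ x) α) ^ (n * p x) =
      ENNReal.ofReal (∏ x, K x ^ (n * p x)) := by
    rw [ENNReal.ofReal_prod_of_nonneg fun x _ => Real.rpow_nonneg (hK0 x).le _]
    refine Finset.prod_congr rfl fun x _ => ?_
    by_cases hx : p x = 0
    · simp [hx]
    · rw [← ENNReal.ofReal_rpow_of_pos (hK0 x)]
      simp only [K, hx, if_false]
      rw [ENNReal.ofReal_toReal (hfin x hx)]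
  have hD : ∀ x, p x * (sandwichedDiv α (ρ x) σ).toReal = p x * (1 / (α - 1) * Real.log (K x)) := by
    intro x
    by_cases hx : p x = 0
    · simp [hx]
    · rw [sandwichedDiv_eq hα (hρ x) hσ (hτ x hx) (hfin x hx), EReal.toReal_coe]
      simp only [K, hx, if_false]
  set k := ∏ x, K x ^ (n * p x)
  have hk0 : 0 < k := Finset.prod_pos fun x _ => Real.rpow_pos_of_pos (hK0 x) _
  have hk : Real.log k = n * ∑ x, p x * Real.log (K x) := by
    rw [Real.log_prod fun x _ => (Real.rpow_pos_of_pos (hK0 x) _).ne', Finset.mul_sum]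
    refine Finset.sum_congr rfl fun x _ => ?_
    rw [Real.log_rpow (hK0 x)]
    ring
  have hM' : (M : ℝ≥0∞) = ENNReal.ofReal M := by simp
  rw [hK, hM', ← ENNReal.ofReal_inv_of_pos hMr,
    show (1 / 2 : ℝ≥0∞) = ENNReal.ofReal (2⁻¹) by
      rw [ENNReal.ofReal_inv_of_pos two_pos]; simp,
    show (2 : ℝ≥0∞) = ENNReal.ofReal 2 by simp,
    ← ENNReal.ofReal_mul (by positivity), ← ENNReal.ofReal_mul (by positivity),
    ENNReal.ofReal_rpow_of_pos (by positivity), ← ENNReal.ofReal_mul (by positivity),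
    ← ENNReal.ofReal_mul (by positivity)]
  refine ENNReal.ofReal_le_ofReal ((Real.log_le_iff_le_exp (by positivity)).1 ?_)
  have hn0 : (n : ℝ) ≠ 0 := by positivity
  have hs : ∑ x, p x * (sandwichedDiv α (ρ x) σ).toReal = 1 / (α - 1) * (Real.log k / n) := by
    rw [hk, mul_div_cancel_left₀ _ hn0, Finset.mul_sum]
    refine Finset.sum_congr rfl fun x _ => ?_
    rw [hD]; ring
  have h2 : 0 ≤ Real.log 2 := Real.log_nonneg (by norm_num)
  rw [hs, hR, Real.log_mul (by positivity) (by positivity), Real.log_mul (by positivity)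
    (by positivity), Real.log_inv, Real.log_inv, Real.log_rpow (by positivity),
    Real.log_mul (by positivity) (by positivity), Real.log_mul (by positivity) (by positivity)]
  have hα1 : α - 1 ≠ 0 := by linarith
  have e1 : (n : ℝ) * ((α - 1) / α * (1 / (α - 1) * (Real.log k / n) - 1 / n * Real.log M)) =
      1 / α * Real.log k - (1 - 1 / α) * Real.log M := by
    field_simp
  rw [e1]
  -- The factor 1/2 of the trace distance absorbs 2^(1/α).
  have : 1 / α ≤ 1 := by rw [div_le_one hα0]; exact hα.le
  nlinarith [mul_le_mul_of_nonneg_right this h2]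

/-- Solved for ∑ p D*_α(ρ_x‖σ), the covering bound is a lower bound that does not involve σ. It
therefore passes to the infimum over σ and, multiplied by (1-α)/α, to the supremum over α. -/
theorem expectedTraceDist_le_exp_augustinExponent (b : HilbertBasis ι ℂ H) (hp : ∀ x, 0 ≤ p x)
    (hp1 : ∑ x, p x = 1) (hρ : ∀ x, IsDensity (ρ x)) (hn : 1 ≤ n) (hM : 1 ≤ M)
    (hnp : ∀ x, ∃ k : ℕ, (n : ℝ) * p x = k) (hR : R = 1 / n * Real.log M) :
    expectedTraceDist b p ρ n M ≤ EReal.exp (-((n : EReal) * augustinExponent p ρ R)) := by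
  set L := expectedTraceDist b p ρ n M
  rcases eq_or_ne L 0 with h0 | h0
  · rw [h0]; exact zero_le
  have hn0 : (0 : ℝ) < n := by positivity
  have hnE : (n : EReal) = ((n : ℝ) : EReal) := by simp
  have key : ∀ α ∈ Set.Ioo (1 : ℝ) 2, (((1 - α) / α : ℝ) : EReal) * (augustinInfo α p ρ - (R : EReal))
      ≤ (((n : ℝ)⁻¹ : ℝ) : EReal) * (- ENNReal.log L) := by
    intro α hα
    have hα0 : 0 < α := by linarith [hα.1]
    have hc : 0 < (α - 1) / α := div_pos (by linarith [hα.1]) hα0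
    have hneg : (1 - α) / α < 0 := div_neg_of_neg_of_pos (by linarith [hα.1]) hα0
    have hb : ∀ σ : H →L[ℂ] H, IsDensity σ →
        ∑ x, (p x : EReal) * sandwichedDiv α (ρ x) σ ≠ ⊤ →
        L ≠ ∞ ∧ ((R + α / (α - 1) * (Real.log L.toReal / n) : ℝ) : EReal) ≤
          ∑ x, (p x : EReal) * sandwichedDiv α (ρ x) σ := by
      intro σ hσ hne
      have h1 := expectedTraceDist_le_exp b hp hp1 hρ hn hM hnp hR hα.1 hα.2 hσ hne
      have htop : L ≠ ∞ := ne_top_of_le_ne_top ENNReal.ofReal_ne_top h1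
      refine ⟨htop, ?_⟩
      rw [(sum_mul_eq_coe hp (fun x => sandwichedDiv_ne_bot hα.1 (hρ x) hσ) hne).2]
      refine EReal.coe_le_coe ?_
      have h2 := (Real.log_le_iff_le_exp (ENNReal.toReal_pos h0 htop)).2
        (ENNReal.toReal_le_of_le_ofReal (Real.exp_pos _).le h1)
      set D := ∑ x, p x * (sandwichedDiv α (ρ x) σ).toReal
      have h3 : Real.log L.toReal / n ≤ (α - 1) / α * (D - R) := by
        rw [div_le_iff₀ hn0]; linarith
      have hα1 : α - 1 ≠ 0 := by linarith [hα.1]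
      have h4 : α / (α - 1) * (Real.log L.toReal / n) ≤ D - R := by
        calc _ ≤ α / (α - 1) * ((α - 1) / α * (D - R)) :=
              mul_le_mul_of_nonneg_left h3 (div_pos hα0 (by linarith [hα.1])).le
          _ = D - R := by field_simp
      linarith
    -- An infinite Augustin information makes the term ⊥, as (1-α)/α < 0.
    by_cases htop : augustinInfo α p ρ = ⊤
    · rw [htop, EReal.top_sub_coe, EReal.coe_mul_top_of_neg hneg]
      exact bot_le
    · have hLtop : L ≠ ∞ := by
        by_contra hL
        refine htop ?_
        unfold augustinInfo
        refine iInf₂_eq_top.2 fun σ hσ => ?_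
        by_contra hne
        exact (hb σ hσ hne).1 hL
      have hI : ((R + α / (α - 1) * (Real.log L.toReal / n) : ℝ) : EReal) ≤ augustinInfo α p ρ := by
        refine le_iInf₂ fun σ hσ => ?_
        by_cases hne : ∑ x, (p x : EReal) * sandwichedDiv α (ρ x) σ = ⊤
        · rw [hne]; exact le_top
        · exact (hb σ hσ hne).2
      have hbot : augustinInfo α p ρ ≠ ⊥ := fun h => by
        rw [h] at hI; exact EReal.coe_ne_bot _ (le_bot_iff.1 hI)
      lift augustinInfo α p ρ to ℝ using ⟨htop, hbot⟩ with I
      rw [ENNReal.log_pos_real h0 hLtop]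
      norm_cast at hI ⊢
      have hα1 : α - 1 ≠ 0 := by linarith [hα.1]
      have h5 : (α - 1) / α * (α / (α - 1) * (Real.log L.toReal / n)) ≤ (α - 1) / α * (I - R) :=
        mul_le_mul_of_nonneg_left (by linarith) hc.le
      have h6 : (α - 1) / α * (α / (α - 1) * (Real.log L.toReal / n)) =
        Real.log L.toReal / n := by field_simp
      have h7 : (1 - α) / α = -((α - 1) / α) := by ring
      have h8 : (n : ℝ)⁻¹ * -Real.log L.toReal = -(Real.log L.toReal / n) := by ring
      rw [h7, h8]
      linarith
  have hsup : augustinExponent p ρ R ≤ (((n : ℝ)⁻¹ : ℝ) : EReal) * (- ENNReal.log L) :=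
    iSup₂_le key
  have h1 : (n : EReal) * augustinExponent p ρ R ≤ - ENNReal.log L := by
    calc (n : EReal) * augustinExponent p ρ R
        ≤ (n : EReal) * ((((n : ℝ)⁻¹ : ℝ) : EReal) * (- ENNReal.log L)) :=
          mul_le_mul_of_nonneg_left hsup (by rw [hnE]; exact_mod_cast hn0.le)
      _ = - ENNReal.log L := by
        rw [hnE, ← mul_assoc, ← EReal.coe_mul, mul_inv_cancel₀ hn0.ne', EReal.coe_one, one_mul]
  rw [← ENNReal.exp_log L]
  exact EReal.exp_monotone (EReal.le_neg_of_le_neg h1)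

end Exponent

/-! ### Relative entropy: independence of eigenbases and block structure -/

section RelEntropy

variable {H : Type*} [NormedAddCommGroup H] [InnerProductSpace ℂ H] [CompleteSpace H]
variable {ι ι' κ κ' : Type*}

theorem IsEigenbasis.starProjection_apply {T : H →L[ℂ] H} {e : HilbertBasis ι ℂ H} {l : ι → ℝ}
    (h : IsEigenbasis T e l) (c : ℝ) (i : ι) (v : H) [Decidable (l i = c)] :
    ⟪e i, (T - (c : ℂ) • 1).ker.starProjection v⟫_ℂ = if l i = c then ⟪e i, v⟫_ℂ else 0 := by
  have hT := isSelfAdjoint_of_isEigenbasis h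
  rw [← Submodule.inner_starProjection_left_eq_right]
  split_ifs with hc
  · rw [Submodule.starProjection_eq_self_iff.2]
    simp [LinearMap.mem_ker, h i, hc]
  · rw [(Submodule.starProjection_apply_eq_zero_iff _).2, inner_zero_left]
    intro w hw
    have hw' : T w = (c : ℂ) • w := by
      simpa [LinearMap.mem_ker, sub_eq_zero] using hw
    have h1 := isSelfAdjoint_iff_inner hT w (e i)
    rw [hw', h i, inner_smul_left, inner_smul_right, Complex.conj_ofReal] at h1
    have h2 : ((l i : ℂ) - c) * ⟪w, e i⟫_ℂ = 0 := by rw [sub_mul, h1, sub_self]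
    rcases mul_eq_zero.1 h2 with h3 | h3
    · exact absurd (by exact_mod_cast sub_eq_zero.1 h3) hc
    · exact h3

/-- Grouping eigenvectors by eigenvalue leaves the projections of v onto ker (T - c), which do not
mention the basis. Real c that are not eigenvalues contribute 0. -/
theorem IsEigenbasis.tsum_eq_tsum_starProjection {T : H →L[ℂ] H} {e : HilbertBasis ι ℂ H}
    {l : ι → ℝ} (h : IsEigenbasis T e l) (v : H) (F : ℝ → ℝ≥0∞) :
    ∑' i, ENNReal.ofReal (‖⟪e i, v⟫_ℂ‖ ^ 2) * F (l i) = ∑' c : ℝ,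
      ENNReal.ofReal (‖(T - (c : ℂ) • 1).ker.starProjection v‖ ^ 2) * F c := by
  classical
  have h1 : ∀ c : ℝ, ENNReal.ofReal (‖(T - (c : ℂ) • 1).ker.starProjection v‖ ^ 2) * F c =
      ∑' i, if l i = c then ENNReal.ofReal (‖⟪e i, v⟫_ℂ‖ ^ 2) * F c else 0 := by
    intro c
    rw [← tsum_ofReal_norm_inner_sq e, ← ENNReal.tsum_mul_right]
    refine tsum_congr fun i => ?_
    rw [h.starProjection_apply]
    split_ifs <;> simp
  simp_rw [h1]
  rw [ENNReal.tsum_comm]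
  refine tsum_congr fun i => ?_
  rw [tsum_eq_single (l i)]
  · simp
  · intro c hc; simp [hc.symm]

/-- The spectral measure of a vector does not depend on the eigenbasis. -/
theorem IsEigenbasis.tsum_eq {T : H →L[ℂ] H} {e : HilbertBasis ι ℂ H} {l : ι → ℝ}
    {e' : HilbertBasis ι' ℂ H} {l' : ι' → ℝ} (h : IsEigenbasis T e l) (h' : IsEigenbasis T e' l')
    (v : H) (F : ℝ → ℝ≥0∞) :
    ∑' i, ENNReal.ofReal (‖⟪e i, v⟫_ℂ‖ ^ 2) * F (l i) =
      ∑' i, ENNReal.ofReal (‖⟪e' i, v⟫_ℂ‖ ^ 2) * F (l' i) := by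
  rw [h.tsum_eq_tsum_starProjection, h'.tsum_eq_tsum_starProjection]

/-- The two eigenbases are exchanged one at a time, with the vectors of the other held fixed. -/
theorem relEntropy_eq {ρ σ : H →L[ℂ] H} {e : HilbertBasis ι ℂ H} {l : ι → ℝ}
    {f : HilbertBasis κ ℂ H} {m : κ → ℝ} (he : IsEigenbasis ρ e l) (hf : IsEigenbasis σ f m) :
    relEntropy ρ σ =
      ∑' i, ∑' j, ENNReal.ofReal (‖⟪e i, f j⟫_ℂ‖ ^ 2) * entropyTerm (l i) (m j) := by
  have key : ∀ (S : Set H) (e' : HilbertBasis S ℂ H) (l' : S → ℝ) (_ : IsEigenbasis ρ e' l')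
      (T : Set H) (f' : HilbertBasis T ℂ H) (m' : T → ℝ) (_ : IsEigenbasis σ f' m'),
      ∑' i, ∑' j, ENNReal.ofReal (‖⟪e' i, f' j⟫_ℂ‖ ^ 2) * entropyTerm (l' i) (m' j) =
      ∑' i, ∑' j, ENNReal.ofReal (‖⟪e i, f j⟫_ℂ‖ ^ 2) * entropyTerm (l i) (m j) := by
    intro S e' l' he' T f' m' hf'
    calc _ = ∑' i, ∑' j, ENNReal.ofReal (‖⟪e' i, f j⟫_ℂ‖ ^ 2) * entropyTerm (l' i) (m j) := by
          refine tsum_congr fun i => ?_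
          simp_rw [norm_inner_symm (e' i)]
          exact hf'.tsum_eq hf (e' i) _
      _ = _ := by
          rw [ENNReal.tsum_comm, ENNReal.tsum_comm (β := κ)]
          exact tsum_congr fun j => he'.tsum_eq he (f j) fun t => entropyTerm t (m j)
  unfold relEntropy
  refine le_antisymm ?_ ?_
  · obtain ⟨S, φ, e', he'⟩ := exists_set_reindex e
    obtain ⟨T, ψ, f', hf'⟩ := exists_set_reindex f
    have h1 : IsEigenbasis ρ e' (l ∘ φ) := fun i => by rw [he']; exact he _
    have h2 : IsEigenbasis σ f' (m ∘ ψ) := fun i => by rw [hf']; exact hf _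
    rw [← key S e' _ h1 T f' _ h2]
    exact iInf_le_of_le S <| iInf_le_of_le e' <| iInf_le_of_le _ <| iInf_le_of_le h1 <|
      iInf_le_of_le T <| iInf_le_of_le f' <| iInf_le_of_le _ <| iInf_le_of_le h2 le_rfl
  · exact le_iInf fun S => le_iInf fun e' => le_iInf fun l' => le_iInf fun h1 =>
      le_iInf fun T => le_iInf fun f' => le_iInf fun m' => le_iInf fun h2 =>
        (key S e' l' h1 T f' m' h2).ge

/-- Homogeneity lets the weight p x be pulled out of the block x of the classical-quantum state. -/
theorem entropyTerm_mul {c l m : ℝ} (hc : 0 ≤ c) :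
    entropyTerm (c * l) (c * m) = ENNReal.ofReal c * entropyTerm l m := by
  rcases hc.eq_or_lt with rfl | hc
  · simp [entropyTerm]
  unfold entropyTerm
  by_cases h : m = 0 ∧ l ≠ 0
  · rw [if_pos h, if_pos ⟨by simp [h.1], mul_ne_zero hc.ne' h.2⟩, ENNReal.mul_top]
    simpa using hc
  · rw [if_neg h, if_neg (by simpa [hc.ne'] using h), ← ENNReal.ofReal_mul hc.le]
    congr 1
    by_cases hl0 : l = 0
    · simp [hl0]
    · have hm0 : m ≠ 0 := fun h0 => h ⟨h0, hl0⟩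
      rw [Real.log_mul hc.ne' hl0, Real.log_mul hc.ne' hm0]
      ring

variable {X : Type*} [Fintype X]

theorem exists_hilbertBasis_cq [DecidableEq X] {S : X → Type*} (e : ∀ x, HilbertBasis (S x) ℂ H) :
    ∃ E : HilbertBasis (Σ x, S x) ℂ (PiLp 2 fun _ : X => H),
      ∀ xi, E xi = WithLp.toLp 2 (Pi.single xi.1 (e xi.1 xi.2)) := by
  have hin : ∀ (x : X) (v : H) (w : PiLp 2 fun _ : X => H),
      ⟪(WithLp.toLp 2 (Pi.single x v) : PiLp 2 fun _ : X => H), w⟫_ℂ = ⟪v, w x⟫_ℂ := by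
    intro x v w
    rw [PiLp.inner_apply, Finset.sum_eq_single x]
    · simp
    · intro y _ hy; simp [hy]
    · simp
  obtain ⟨E, hE⟩ := exists_hilbertBasis_of_orthonormal
    (v := fun xi : Σ x, S x => (WithLp.toLp 2 (Pi.single xi.1 (e xi.1 xi.2)) : PiLp 2 fun _ : X => H))
    (by
      classical
      rw [orthonormal_iff_ite]
      rintro ⟨x, i⟩ ⟨y, j⟩
      rw [hin]
      by_cases hxy : x = y
      · subst hxy
        simp [orthonormal_iff_ite.1 (e x).orthonormal]
      · simp [hxy])
    (by
      intro w hw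
      ext x
      refine eq_zero_of_forall_inner_eq_zero (e x) fun i => ?_
      rw [← hin]
      exact hw ⟨x, i⟩)
  exact ⟨E, fun xi => congrFun hE xi⟩

omit [CompleteSpace H] [Fintype X] in
theorem cqOp_single [DecidableEq X] (A : X → H →L[ℂ] H) (x : X) (v : H) :
    cqOp A (WithLp.toLp 2 (Pi.single x v)) = WithLp.toLp 2 (Pi.single x (A x v)) := by
  ext y
  by_cases hxy : y = x
  · subst hxy; simp [cqOp]
  · simp [cqOp, hxy]

theorem relEntropy_cqOp {A B : X → H →L[ℂ] H} {S T : X → Type*} {e : ∀ x, HilbertBasis (S x) ℂ H}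
    {l : ∀ x, S x → ℝ} {f : ∀ x, HilbertBasis (T x) ℂ H} {m : ∀ x, T x → ℝ}
    (he : ∀ x, IsEigenbasis (A x) (e x) (l x)) (hf : ∀ x, IsEigenbasis (B x) (f x) (m x)) :
    relEntropy (cqOp A) (cqOp B) = ∑ x, ∑' i, ∑' j,
      ENNReal.ofReal (‖⟪e x i, f x j⟫_ℂ‖ ^ 2) * entropyTerm (l x i) (m x j) := by
  classical
  obtain ⟨E, hE⟩ := exists_hilbertBasis_cq e
  obtain ⟨F, hF⟩ := exists_hilbertBasis_cq f
  have h1 : IsEigenbasis (cqOp A) E (fun xi => l xi.1 xi.2) := fun xi => by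
    rw [hE, cqOp_single, he, Pi.single_smul, WithLp.toLp_smul]
  have h2 : IsEigenbasis (cqOp B) F (fun xi => m xi.1 xi.2) := fun xi => by
    rw [hF, cqOp_single, hf, Pi.single_smul, WithLp.toLp_smul]
  rw [relEntropy_eq h1 h2, ENNReal.tsum_sigma', tsum_fintype]
  refine Finset.sum_congr rfl fun x _ => tsum_congr fun i => ?_
  rw [ENNReal.tsum_sigma', tsum_fintype, Finset.sum_eq_single x]
  · refine tsum_congr fun j => ?_
    rw [hE, hF, PiLp.inner_apply, Finset.sum_eq_single x]
    · simp
    · intro y _ hy; simp [hy]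
    · simp
  · intro y _ hy
    refine ENNReal.tsum_eq_zero.2 fun j => ?_
    have : ⟪E ⟨x, i⟩, F ⟨y, j⟩⟫_ℂ = 0 := by
      rw [hE, hF, PiLp.inner_apply]
      refine Finset.sum_eq_zero fun z _ => ?_
      by_cases hz : z = x
      · subst hz; simp [hy.symm]
      · simp [hz]
    simp [this]
  · simp

theorem mutualInfo_eq {p : X → ℝ} (hp : ∀ x, 0 ≤ p x) {ρ : X → H →L[ℂ] H} {S : X → Type*}
    {e : ∀ x, HilbertBasis (S x) ℂ H} {l : ∀ x, S x → ℝ} {g : HilbertBasis κ ℂ H} {r : κ → ℝ}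
    (he : ∀ x, IsEigenbasis (ρ x) (e x) (l x)) (hg : IsEigenbasis (marginal p ρ) g r) :
    mutualInfo p ρ = ∑ x, ENNReal.ofReal (p x) * ∑' i, ∑' j,
      ENNReal.ofReal (‖⟪e x i, g j⟫_ℂ‖ ^ 2) * entropyTerm (l x i) (r j) := by
  unfold mutualInfo
  rw [relEntropy_cqOp (A := fun x => (p x : ℂ) • ρ x) (B := fun x => (p x : ℂ) • marginal p ρ)
    (T := fun _ => κ) (e := e) (f := fun _ => g) (l := fun x i => p x * l x i)
    (m := fun x j => p x * r j)]
  · refine Finset.sum_congr rfl fun x _ => ?_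
    simp_rw [← ENNReal.tsum_mul_left]
    refine tsum_congr fun i => tsum_congr fun j => ?_
    rw [entropyTerm_mul (hp x)]
    ring
  · intro x i
    rw [_root_.smul_apply, he, smul_smul]; push_cast; rfl
  · intro x j
    rw [_root_.smul_apply, hg, smul_smul]; push_cast; rfl

end RelEntropy

/-! ### Gibbs' inequality for finite ensembles -/

section Ensemble

variable {H : Type*} [NormedAddCommGroup H] [InnerProductSpace ℂ H] [CompleteSpace H]
variable {ι κ Ω : Type*}

/-- `⟨v, -log T v⟩` for an operator `T` with eigenbasis `f` and eigenvalues `m`. -/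
def negLog (f : HilbertBasis κ ℂ H) (m : κ → ℝ) (v : H) : ℝ≥0∞ :=
  ∑' j, ENNReal.ofReal (‖⟪v, f j⟫_ℂ‖ ^ 2) * ENNReal.ofReal (-Real.log (m j))

theorem mul_negLog_add_le {t m : ℝ} (ht : 0 < t) (hm : 0 < m) :
    t * -Real.log t + t ≤ t * -Real.log m + m := by
  have h := Real.log_le_sub_one_of_pos (div_pos hm ht)
  rw [Real.log_div hm.ne' ht.ne'] at h
  have h2 := mul_le_mul_of_nonneg_left h ht.le
  have h3 : t * (m / t - 1) = m - t := by field_simp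
  linarith

theorem exists_eigenbasis_ensemble (G : Finset Ω) {w : Ω → ℝ} (hw : ∀ ω, 0 ≤ w ω) {v : Ω → H}
    (hv : ∀ ω, ‖v ω‖ = 1) :
    ∃ (η : H →L[ℂ] H) (S : Set H) (h : HilbertBasis S ℂ H) (t : S → ℝ),
      0 ≤ η ∧ IsEigenbasis η h t ∧ trace η = ∑ ω ∈ G, ENNReal.ofReal (w ω) ∧
      ∀ z, (⟪z, η z⟫_ℂ).re = ∑ ω ∈ G, w ω * ‖⟪v ω, z⟫_ℂ‖ ^ 2 := by
  set P : Ω → H →L[ℂ] H := fun ω => InnerProductSpace.rankOne ℂ (v ω) (v ω)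
  have hPi : ∀ ω z, (⟪z, P ω z⟫_ℂ).re = ‖⟪v ω, z⟫_ℂ‖ ^ 2 := by
    intro ω z
    simp only [P]
    rw [InnerProductSpace.rankOne_apply, inner_smul_right, ← inner_conj_symm z, Complex.mul_conj,
      Complex.normSq_eq_norm_sq]
    norm_cast
  have hPsa : ∀ ω, IsSelfAdjoint (P ω) := fun ω => by
    rw [ContinuousLinearMap.isSelfAdjoint_iff_isSymmetric]
    intro y z
    simp only [P, ContinuousLinearMap.coe_coe]
    rw [InnerProductSpace.rankOne_apply, InnerProductSpace.rankOne_apply, inner_smul_left,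
      inner_smul_right, inner_conj_symm, mul_comm]
  have hP0 : ∀ ω, 0 ≤ P ω := fun ω =>
    nonneg_of_re_inner_nonneg (hPsa ω) fun z => by rw [hPi]; positivity
  have hPt : ∀ ω, trace (P ω) = 1 := by
    intro ω
    obtain ⟨_, b, -⟩ := exists_hilbertBasis ℂ H
    rw [trace_eq_tsum (hP0 ω) b]
    simp_rw [hPi, norm_inner_symm (v ω)]
    rw [tsum_ofReal_norm_inner_sq, hv]
    simp
  have h0 : ∀ ω ∈ G, 0 ≤ w ω • P ω := fun ω _ => smul_nonneg (hw ω) (hP0 ω)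
  have hη : 0 ≤ ∑ ω ∈ G, w ω • P ω := Finset.sum_nonneg h0
  have htr : trace (∑ ω ∈ G, w ω • P ω) = ∑ ω ∈ G, ENNReal.ofReal (w ω) := by
    rw [trace_sum G _ h0]
    exact Finset.sum_congr rfl fun ω _ => by rw [trace_smul (hP0 ω) (hw ω), hPt, mul_one]
  obtain ⟨S, h, t, ht⟩ := exists_eigenbasis_of_trace hη (by
    rw [htr]; exact ENNReal.sum_ne_top.2 fun _ _ => ENNReal.ofReal_ne_top)
  refine ⟨_, S, h, t, hη, ht, htr, fun z => ?_⟩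
  rw [sum_apply, inner_sum, Complex.re_sum]
  refine Finset.sum_congr rfl fun ω _ => ?_
  rw [_root_.smul_apply, ← Complex.coe_smul, inner_smul_right, Complex.re_ofReal_mul, hPi]

theorem inner_eq_zero_of_re_inner_eq_zero {η : H →L[ℂ] H} (hη : 0 ≤ η) {h : HilbertBasis κ ℂ H}
    {t : κ → ℝ} (hh : IsEigenbasis η h t) {k : κ} (hk : t k ≠ 0) {y : H}
    (hy : (⟪y, η y⟫_ℂ).re = 0) : ⟪h k, y⟫_ℂ = 0 := by
  rw [re_inner_eq_norm_sqrt_sq hη, sq_eq_zero_iff, norm_eq_zero] at hy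
  have h1 : η y = 0 := by
    rw [← CFC.sqrt_mul_sqrt_self η, mul_apply_eq_comp, hy, map_zero]
  have h2 := hh.inner_apply hη.isSelfAdjoint k y
  rw [h1, inner_zero_right, eq_comm] at h2
  exact (mul_eq_zero.1 h2).resolve_left (by exact_mod_cast hk)

/-- η ≤ β gives √η β⁻¹ √η ≤ 1, read here at an eigenvector of η. -/
theorem tsum_inv_mul_norm_inner_sq_le_one {η β : H →L[ℂ] H} (hη : 0 ≤ η) {h : HilbertBasis κ ℂ H}
    {t : κ → ℝ} (hh : IsEigenbasis η h t) {g : HilbertBasis ι ℂ H} {r : ι → ℝ}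
    (hg : IsEigenbasis β g r) (hr : ∀ j, 0 ≤ r j)
    (hβ : ∀ z, (⟪z, η z⟫_ℂ).re ≤ (⟪z, β z⟫_ℂ).re) (k : κ) :
    ∑' j, ENNReal.ofReal (‖⟪h k, g j⟫_ℂ‖ ^ 2) *
      (ENNReal.ofReal (r j)⁻¹ * ENNReal.ofReal (t k)) ≤ 1 := by
  have hk := hh.nonneg hη k
  have hB : CFC.sqrt η (h k) = ((t k ^ (1 / 2 : ℝ) : ℝ) : ℂ) • h k := by
    rw [CFC.sqrt_eq_rpow]
    exact rpow_apply_eigenvector hη hk (hh k) (by norm_num)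
  have h5 := tsum_inv_mul_le hg hr (CFC.sqrt_nonneg η).isSelfAdjoint
    (fun z => by rw [← re_inner_eq_norm_sqrt_sq hη]; exact hβ z) (h k)
  rw [norm_hilbertBasis, one_pow, ENNReal.ofReal_one] at h5
  refine le_trans (le_of_eq (tsum_congr fun j => ?_)) h5
  have e1 : ENNReal.ofReal (‖⟪g j, CFC.sqrt η (h k)⟫_ℂ‖ ^ 2) =
      ENNReal.ofReal (‖⟪h k, g j⟫_ℂ‖ ^ 2) * ENNReal.ofReal (t k) := by
    rw [hB, inner_smul_right, norm_mul, mul_pow, norm_inner_symm (g j), mul_comm,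
      ENNReal.ofReal_mul (by positivity)]
    congr 2
    rw [Complex.norm_real, Real.norm_of_nonneg (by positivity), ← Real.rpow_natCast,
      ← Real.rpow_mul hk]
    norm_num
  rw [e1]
  ring

/-- Monotonicity of the logarithm at an eigenvector of η: log (t/r) ≤ t/r - 1 is averaged over the
spectral weights of h k for β, and the mean of t/r is at most 1. The bounds by 1 keep -log
nonnegative, so that `ENNReal.ofReal` does not truncate it. -/
theorem negLog_le {η β : H →L[ℂ] H} (hη : 0 ≤ η) {h : HilbertBasis κ ℂ H} {t : κ → ℝ}
    (hh : IsEigenbasis η h t) {g : HilbertBasis ι ℂ H} {r : ι → ℝ} (hg : IsEigenbasis β g r)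
    (hr : ∀ j, 0 ≤ r j) (hr1 : ∀ j, r j ≤ 1) (hβ : ∀ z, (⟪z, η z⟫_ℂ).re ≤ (⟪z, β z⟫_ℂ).re) {k : κ}
    (hk : 0 < t k) (hk1 : t k ≤ 1) : negLog g r (h k) ≤ ENNReal.ofReal (-Real.log (t k)) := by
  have h5 := tsum_inv_mul_norm_inner_sq_le_one hη hh hg hr hβ k
  have h6 : ∀ j, ENNReal.ofReal (‖⟪h k, g j⟫_ℂ‖ ^ 2) * ENNReal.ofReal (-Real.log (r j)) +
      ENNReal.ofReal (‖⟪h k, g j⟫_ℂ‖ ^ 2) ≤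
      ENNReal.ofReal (‖⟪h k, g j⟫_ℂ‖ ^ 2) * (ENNReal.ofReal (r j)⁻¹ * ENNReal.ofReal (t k)) +
      ENNReal.ofReal (‖⟪h k, g j⟫_ℂ‖ ^ 2) * ENNReal.ofReal (-Real.log (t k)) := by
    intro j
    -- At r j = 0 the value -log should be ∞ whereas `Real.log 0` is 0; the weight vanishes there,
    -- because g j lies in the kernel of η.
    rcases (hr j).eq_or_lt with h0 | h0
    · have h1 : (⟪g j, η (g j)⟫_ℂ).re = 0 :=
        le_antisymm ((hβ _).trans (by rw [hg.re_inner, h0])) (re_inner_nonneg hη _)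
      simp [inner_eq_zero_of_re_inner_eq_zero hη hh hk.ne' h1]
    · have hlt : 0 ≤ -Real.log (t k) := by
        have := Real.log_nonpos hk.le hk1
        linarith
      have e2 : ENNReal.ofReal (-Real.log (r j)) + 1 ≤
          ENNReal.ofReal (r j)⁻¹ * ENNReal.ofReal (t k) + ENNReal.ofReal (-Real.log (t k)) := by
        rw [← ENNReal.ofReal_mul (by positivity), ← ENNReal.ofReal_add (by positivity) hlt]
        have h7 := Real.log_le_sub_one_of_pos (div_pos hk h0)
        rw [Real.log_div hk.ne' h0.ne', div_eq_inv_mul] at h7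
        have h8 := Real.log_nonpos h0.le (hr1 j)
        rw [← ENNReal.ofReal_one, ← ENNReal.ofReal_add (by linarith) zero_le_one]
        exact ENNReal.ofReal_le_ofReal (by linarith)
      calc _ = ENNReal.ofReal (‖⟪h k, g j⟫_ℂ‖ ^ 2) * (ENNReal.ofReal (-Real.log (r j)) + 1) := by
            rw [mul_add, mul_one]
        _ ≤ _ := mul_le_mul_right e2 _
        _ = _ := mul_add _ _ _
  have h7 := ENNReal.tsum_le_tsum h6
  rw [ENNReal.tsum_add, ENNReal.tsum_add, ENNReal.tsum_mul_right, tsum_ofReal_norm_inner_basis_sq',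
    one_mul] at h7
  have h8 : negLog g r (h k) + 1 ≤ ENNReal.ofReal (-Real.log (t k)) + 1 :=
    h7.trans (by rw [add_comm]; gcongr)
  exact (ENNReal.add_le_add_iff_right ENNReal.one_ne_top).1 h8

/-- Both sides are the trace of η against one operator -log C, computed from the two decompositions
of η. -/
theorem sum_negLog_eq {ν : Type*} (G : Finset Ω) {w : Ω → ℝ} (hw : ∀ ω, 0 ≤ w ω) {v : Ω → H}
    {η : H →L[ℂ] H} (hη : 0 ≤ η) {h : HilbertBasis κ ℂ H} {t : κ → ℝ} (hh : IsEigenbasis η h t)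
    (hin : ∀ z, (⟪z, η z⟫_ℂ).re = ∑ ω ∈ G, w ω * ‖⟪v ω, z⟫_ℂ‖ ^ 2)
    (c : HilbertBasis ν ℂ H) (y : ν → ℝ) :
    ∑ ω ∈ G, ENNReal.ofReal (w ω) * negLog c y (v ω) =
      ∑' k, ENNReal.ofReal (t k) * negLog c y (h k) := by
  unfold negLog
  simp_rw [← ENNReal.tsum_mul_left]
  rw [ENNReal.tsum_comm, ← Summable.tsum_finsetSum fun _ _ => ENNReal.summable]
  refine tsum_congr fun j => ?_
  have h1 := hh.ofReal_re_inner hη.isSelfAdjoint (hh.nonneg hη) (c j)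
  rw [hin, ENNReal.ofReal_sum_of_nonneg fun ω _ => mul_nonneg (hw ω) (by positivity)] at h1
  simp_rw [← mul_assoc]
  rw [← Finset.sum_mul, ENNReal.tsum_mul_right]
  congr 1
  simp_rw [ENNReal.ofReal_mul (hw _)] at h1
  rw [h1]
  exact tsum_congr fun k => mul_comm _ _

/-- Gibbs' inequality for a finite ensemble dominated by `β`:
`Tr η (log σ - log β) ≤ 1 - Tr η`, where `η` is the average state of the ensemble. -/
theorem sum_negLog_le (G : Finset Ω) {w : Ω → ℝ} (hw : ∀ ω, 0 ≤ w ω) {v : Ω → H}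
    (hv : ∀ ω, ‖v ω‖ = 1) (hw1 : ∑ ω ∈ G, w ω ≤ 1) {β : H →L[ℂ] H} {g : HilbertBasis ι ℂ H}
    {r : ι → ℝ} (hg : IsEigenbasis β g r) (hr : ∀ j, 0 ≤ r j) (hr1 : ∀ j, r j ≤ 1)
    (hβ : ∀ z, ∑ ω ∈ G, w ω * ‖⟪v ω, z⟫_ℂ‖ ^ 2 ≤ (⟪z, β z⟫_ℂ).re)
    (f : HilbertBasis κ ℂ H) {m : κ → ℝ} (hm : ∀ j, 0 ≤ m j) (hm1 : ∀ j, m j ≤ 1)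
    (hms : ∑' j, ENNReal.ofReal (m j) ≤ 1)
    (h0 : ∀ ω ∈ G, w ω ≠ 0 → ∀ j, m j = 0 → ⟪v ω, f j⟫_ℂ = 0) :
    ∑ ω ∈ G, ENNReal.ofReal (w ω) * negLog g r (v ω) + ∑ ω ∈ G, ENNReal.ofReal (w ω) ≤
      ∑ ω ∈ G, ENNReal.ofReal (w ω) * negLog f m (v ω) + 1 := by
  obtain ⟨η, S, h, t, hη, hh, htr, hin⟩ := exists_eigenbasis_ensemble G hw hv
  have ht := hh.nonneg hη
  have htr' := htr
  rw [hh.trace_eq hη] at htr'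
  have ht1 : ∀ k, t k ≤ 1 := by
    intro k
    have h1 : ENNReal.ofReal (t k) ≤ ENNReal.ofReal 1 := by
      calc _ ≤ ∑' k, ENNReal.ofReal (t k) := ENNReal.le_tsum k
        _ = ENNReal.ofReal (∑ ω ∈ G, w ω) := by
          rw [htr', ENNReal.ofReal_sum_of_nonneg fun ω _ => hw ω]
        _ ≤ _ := ENNReal.ofReal_le_ofReal hw1
    exact (ENNReal.ofReal_le_ofReal_iff zero_le_one).1 h1
  rw [sum_negLog_eq G hw hη hh hin, sum_negLog_eq G hw hη hh hin, ← htr', ← ENNReal.tsum_add]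
  -- First -log β is replaced by -log t k; then t (-log t) + t ≤ t (-log m) + m is averaged over the
  -- spectral weights for f. Summed over k, the last term becomes ∑ m ≤ 1.
  have key : ∀ k, ENNReal.ofReal (t k) * negLog g r (h k) + ENNReal.ofReal (t k) ≤
      ENNReal.ofReal (t k) * negLog f m (h k) +
        ∑' j, ENNReal.ofReal (‖⟪h k, f j⟫_ℂ‖ ^ 2) * ENNReal.ofReal (m j) := by
    intro k
    rcases (ht k).eq_or_lt with h1 | h1
    · simp [← h1]
    · have h2 := negLog_le hη hh hg hr hr1 (fun z => (hin z).trans_le (hβ z)) h1 (ht1 k)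
      have hlt : 0 ≤ -Real.log (t k) := by
        have := Real.log_nonpos h1.le (ht1 k)
        linarith
      have h3 : ∀ j, ENNReal.ofReal (‖⟪h k, f j⟫_ℂ‖ ^ 2) *
          ENNReal.ofReal (t k * -Real.log (t k) + t k) ≤
          ENNReal.ofReal (t k) * (ENNReal.ofReal (‖⟪h k, f j⟫_ℂ‖ ^ 2) *
            ENNReal.ofReal (-Real.log (m j))) +
          ENNReal.ofReal (‖⟪h k, f j⟫_ℂ‖ ^ 2) * ENNReal.ofReal (m j) := by
        intro j
        rcases (hm j).eq_or_lt with h4 | h4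
        · have h5 : (⟪f j, η (f j)⟫_ℂ).re = 0 := by
            rw [hin]
            refine Finset.sum_eq_zero fun ω hω => ?_
            by_cases hwω : w ω = 0
            · simp [hwω]
            · simp [h0 ω hω hwω j h4.symm]
          simp [inner_eq_zero_of_re_inner_eq_zero hη hh h1.ne' h5]
        · have hlm : 0 ≤ -Real.log (m j) := by
            have := Real.log_nonpos h4.le (hm1 j)
            linarith
          calc _ ≤ ENNReal.ofReal (‖⟪h k, f j⟫_ℂ‖ ^ 2) *
                ENNReal.ofReal (t k * -Real.log (m j) + m j) := by
                exact mul_le_mul_right (ENNReal.ofReal_le_ofReal (mul_negLog_add_le h1 h4)) _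
            _ = _ := by
                rw [ENNReal.ofReal_add (by positivity) h4.le, ENNReal.ofReal_mul h1.le]
                ring
      have h4 := ENNReal.tsum_le_tsum h3
      rw [ENNReal.tsum_mul_right, tsum_ofReal_norm_inner_basis_sq', one_mul, ENNReal.tsum_add,
        ENNReal.tsum_mul_left, ENNReal.ofReal_add (by positivity) h1.le,
        ENNReal.ofReal_mul h1.le] at h4
      refine le_trans ?_ h4
      gcongr
  refine (ENNReal.tsum_le_tsum key).trans ?_
  rw [ENNReal.tsum_add, ENNReal.tsum_comm (α := S)]
  gcongr
  simp_rw [ENNReal.tsum_mul_right, tsum_ofReal_norm_inner_basis_sq, one_mul]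
  exact hms

end Ensemble

/-! ### Cross entropy at an eigenvector, bounded through τ -/

section Tangent

variable {H : Type*} [NormedAddCommGroup H] [InnerProductSpace ℂ H] [CompleteSpace H]
variable {ι κ : Type*}

theorem norm_inner_sq_le_of_nonneg {τ : H →L[ℂ] H} (hτ : 0 ≤ τ) (y z : H) :
    ‖⟪y, τ z⟫_ℂ‖ ^ 2 ≤ (⟪y, τ y⟫_ℂ).re * (⟪z, τ z⟫_ℂ).re := by
  rw [re_inner_eq_norm_sqrt_sq hτ, re_inner_eq_norm_sqrt_sq hτ, ← mul_pow]
  conv_lhs => rw [← CFC.sqrt_mul_sqrt_self τ]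
  rw [mul_apply_eq_comp, ← isSelfAdjoint_iff_inner (CFC.sqrt_nonneg τ).isSelfAdjoint]
  exact pow_le_pow_left₀ (norm_nonneg _) (norm_inner_le_norm _ _) 2

theorem IsSandwich.inner_eq_zero {ρ σ τ : H →L[ℂ] H} {γ : ℝ} (hγ : 0 < γ)
    (hσ : 0 ≤ σ) {f : HilbertBasis κ ℂ H} {m : κ → ℝ}
    (hf : IsEigenbasis σ f m) (h : IsSandwich γ ρ σ τ) {e : HilbertBasis ι ℂ H} {l : ι → ℝ}
    (he : IsEigenbasis ρ e l) {i : ι} (hi : l i ≠ 0) {j : κ} (hj : m j = 0) :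
    ⟪e i, f j⟫_ℂ = 0 := by
  have hfγ := hf.rpow hσ hγ.le
  have hsa : IsSelfAdjoint (CFC.rpow σ γ) := isSelfAdjoint_of_isEigenbasis hfγ
  have h1 : ⟪f j, ρ (e i)⟫_ℂ = 0 := by
    rw [← h.2.2, mul_apply_eq_comp, mul_apply_eq_comp, hfγ.inner_apply hsa, hj,
      Real.zero_rpow hγ.ne']
    simp
  rw [he i, inner_smul_right] at h1
  rw [inner_eq_zero_symm]
  exact (mul_eq_zero.1 h1).resolve_left (by exact_mod_cast hi)

/-- Jensen's inequality for the logarithm, in the form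
`-⟨e, log σ e⟩ ≤ γ⁻¹ log ⟨e, σ^{-γ} e⟩`, combined with the Cauchy-Schwarz inequality. -/
theorem IsSandwich.negLog_le {ρ σ τ : H →L[ℂ] H} {γ : ℝ} (hγ : 0 < γ)
    (hσ : 0 ≤ σ) {f : HilbertBasis κ ℂ H} {m : κ → ℝ} (hf : IsEigenbasis σ f m)
    (hm1 : ∀ j, m j ≤ 1) (h : IsSandwich γ ρ σ τ) {e : HilbertBasis ι ℂ H} {l : ι → ℝ}
    (he : IsEigenbasis ρ e l) {i : ι} (hi : 0 < l i) :
    0 < (⟪e i, τ (e i)⟫_ℂ).re ∧ negLog f m (e i) ≠ ∞ ∧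
      2 * γ * (negLog f m (e i)).toReal ≤
        Real.log (⟪e i, τ (e i)⟫_ℂ).re - Real.log (l i) := by
  have hm := hf.nonneg hσ
  have hfγ := hf.rpow hσ hγ.le
  have hsa : IsSelfAdjoint (CFC.rpow σ γ) := isSelfAdjoint_of_isEigenbasis hfγ
  -- Since σ^γ τ z = ρ e = l e, formally τ z = l σ^(-γ) e. Hence y = l a with a = ⟪e, σ^(-γ) e⟫, and
  -- Cauchy-Schwarz for the form of τ reads y² ≤ d l, that is a² ≤ d / l.
  set z := CFC.rpow σ γ (e i)
  set y := (⟪e i, τ z⟫_ℂ).re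
  set d := (⟪e i, τ (e i)⟫_ℂ).re
  have hz : (⟪z, τ z⟫_ℂ).re = l i := by
    rw [← he.re_inner i, ← h.2.2, mul_apply_eq_comp, mul_apply_eq_comp,
      ← isSelfAdjoint_iff_inner hsa]
  have hcs : y ^ 2 ≤ d * l i := by
    rw [← hz]
    refine le_trans ?_ (norm_inner_sq_le_of_nonneg h.1 (e i) z)
    rw [← sq_abs]
    exact pow_le_pow_left₀ (abs_nonneg _) (Complex.abs_re_le_norm _) 2
  have hsum : HasSum (fun j => ‖⟪e i, f j⟫_ℂ‖ ^ 2 * (m j ^ (-γ) * l i)) y := by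
    have h1 := Complex.hasSum_re (f.hasSum_inner_mul_inner (e i) (τ z))
    convert h1 using 2 with j
    rcases (hm j).eq_or_lt with h0 | h0
    · simp [h.inner_eq_zero hγ hσ hf he hi.ne' h0.symm]
    · have h2 : ((m j ^ γ : ℝ) : ℂ) * ⟪f j, τ z⟫_ℂ = l i * ⟪f j, e i⟫_ℂ := by
        rw [← inner_smul_right (f j) (e i), ← he i, ← h.2.2, mul_apply_eq_comp, mul_apply_eq_comp,
          hfγ.inner_apply hsa]
      have h3 : ⟪f j, τ z⟫_ℂ = ((m j ^ (-γ) * l i : ℝ) : ℂ) * ⟪f j, e i⟫_ℂ := by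
        rw [Complex.ofReal_mul, mul_assoc, ← h2, ← mul_assoc, ← Complex.ofReal_mul,
          ← Real.rpow_add h0]
        simp
      rw [h3, ← inner_conj_symm (f j), mul_left_comm ⟪e i, f j⟫_ℂ, Complex.mul_conj, Complex.normSq_eq_norm_sq]
      norm_cast
      ring
  have hw := hasSum_norm_inner_sq f (e i)
  simp_rw [norm_inner_symm (f _)] at hw
  rw [norm_hilbertBasis, one_pow] at hw
  set a := y / l i
  have ha : HasSum (fun j => ‖⟪e i, f j⟫_ℂ‖ ^ 2 * m j ^ (-γ)) a := by
    have h1 := hsum.mul_right (l i)⁻¹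
    rw [← div_eq_mul_inv] at h1
    have h2 : ∀ j, ‖⟪e i, f j⟫_ℂ‖ ^ 2 * (m j ^ (-γ) * l i) * (l i)⁻¹ =
        ‖⟪e i, f j⟫_ℂ‖ ^ 2 * m j ^ (-γ) := fun j => by
      rw [mul_assoc, mul_assoc, mul_inv_cancel₀ hi.ne', mul_one]
    simpa only [h2] using h1
  have ha1 : 1 ≤ a := by
    refine hasSum_le (fun j => ?_) hw ha
    rcases (hm j).eq_or_lt with h0 | h0
    · simp [h.inner_eq_zero hγ hσ hf he hi.ne' h0.symm]
    · exact le_mul_of_one_le_right (by positivity)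
        (Real.one_le_rpow_of_pos_of_le_one_of_nonpos h0 (hm1 j) (by linarith))
  have ha0 : 0 < a := by linarith
  -- The tangent inequality log u ≤ log a + u/a - 1 at u = m^(-γ) is averaged over the spectral
  -- weights of e.
  have hlog : negLog f m (e i) ≤ ENNReal.ofReal (γ⁻¹ * Real.log a) := by
    have h1 : HasSum (fun j => γ⁻¹ * (‖⟪e i, f j⟫_ℂ‖ ^ 2 * m j ^ (-γ) * a⁻¹ +
        ‖⟪e i, f j⟫_ℂ‖ ^ 2 * (Real.log a - 1))) (γ⁻¹ * (a * a⁻¹ + 1 * (Real.log a - 1))) :=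
      ((ha.mul_right _).add (hw.mul_right _)).mul_left _
    have h2 : γ⁻¹ * (a * a⁻¹ + 1 * (Real.log a - 1)) = γ⁻¹ * Real.log a := by
      rw [mul_inv_cancel₀ ha0.ne']; ring
    rw [h2] at h1
    have h3 : ∀ j, ‖⟪e i, f j⟫_ℂ‖ ^ 2 * -Real.log (m j) ≤
        γ⁻¹ * (‖⟪e i, f j⟫_ℂ‖ ^ 2 * m j ^ (-γ) * a⁻¹ +
        ‖⟪e i, f j⟫_ℂ‖ ^ 2 * (Real.log a - 1)) := by
      intro j
      rcases (hm j).eq_or_lt with h0 | h0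
      · simp [h.inner_eq_zero hγ hσ hf he hi.ne' h0.symm]
      · have h4 := Real.log_le_sub_one_of_pos (div_pos (Real.rpow_pos_of_pos h0 (-γ)) ha0)
        rw [Real.log_div (Real.rpow_pos_of_pos h0 _).ne' ha0.ne', Real.log_rpow h0] at h4
        rw [le_inv_mul_iff₀ hγ]
        have h5 : γ * -Real.log (m j) ≤ m j ^ (-γ) * a⁻¹ + (Real.log a - 1) := by
          rw [div_eq_mul_inv] at h4; linarith
        have h6 := mul_le_mul_of_nonneg_left h5 (sq_nonneg ‖⟪e i, f j⟫_ℂ‖)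
        linarith
    have h4 : ∀ j, 0 ≤ ‖⟪e i, f j⟫_ℂ‖ ^ 2 * -Real.log (m j) := fun j =>
      mul_nonneg (by positivity) (by have := Real.log_nonpos (hm j) (hm1 j); linarith)
    rw [← h1.tsum_eq, ENNReal.ofReal_tsum_of_nonneg (fun j => (h4 j).trans (h3 j)) h1.summable]
    refine ENNReal.tsum_le_tsum fun j => ?_
    rw [← ENNReal.ofReal_mul (by positivity)]
    exact ENNReal.ofReal_le_ofReal (h3 j)
  have had : a ^ 2 ≤ d / l i := by
    rw [div_pow, div_le_div_iff₀ (by positivity) hi]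
    nlinarith
  have hdl : 0 < d / l i := lt_of_lt_of_le (by positivity) had
  have hd : 0 < d := by
    have := mul_pos hdl hi
    rwa [div_mul_cancel₀ _ hi.ne'] at this
  refine ⟨hd, ne_top_of_le_ne_top ENNReal.ofReal_ne_top hlog, ?_⟩
  have h1 : (negLog f m (e i)).toReal ≤ γ⁻¹ * Real.log a :=
    ENNReal.toReal_le_of_le_ofReal
      (mul_nonneg (inv_nonneg.2 hγ.le) (Real.log_nonneg ha1)) hlog
  calc 2 * γ * (negLog f m (e i)).toReal ≤ 2 * γ * (γ⁻¹ * Real.log a) :=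
        mul_le_mul_of_nonneg_left h1 (by positivity)
    _ = Real.log (a ^ 2) := by rw [Real.log_pow]; push_cast; field_simp
    _ ≤ Real.log (d / l i) := Real.log_le_log (by positivity) had
    _ = _ := Real.log_div hd.ne' hi.ne'

end Tangent

/-! ### The mutual information is below every Augustin objective -/

section Upper

variable {X : Type*} [Fintype X] {p : X → ℝ}
variable {H : Type*} [NormedAddCommGroup H] [InnerProductSpace ℂ H] [CompleteSpace H]
variable {ρ : X → H →L[ℂ] H} {ι κ : Type*}

theorem hasSum_sigma_fintype {S : X → Type*} {F : ∀ x, S x → ℝ} {s : X → ℝ}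
    (h : ∀ x, HasSum (F x) (s x)) :
    HasSum (fun ω : Σ x, S x => F ω.1 ω.2) (∑ x, s x) := by
  classical
  have h1 : ∀ x, HasSum (fun ω : Σ x, S x => if ω.1 = x then F ω.1 ω.2 else 0) (s x) := by
    intro x
    refine ((sigma_mk_injective (i := x)).hasSum_iff ?_).1 ?_
    · rintro ⟨y, i⟩ hy
      have : y ≠ x := by
        rintro rfl
        exact hy ⟨i, rfl⟩
      simp [this]
    · simpa [Function.comp_def] using h x
  have h2 := hasSum_sum (s := Finset.univ) fun x _ => h1 x
  simpa using h2

omit [CompleteSpace H] in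
theorem marginal_eq (p : X → ℝ) (ρ : X → H →L[ℂ] H) : marginal p ρ = ∑ x, p x • ρ x :=
  Finset.sum_congr rfl fun _ _ => Complex.coe_smul _ _

theorem isDensity_marginal (hp : ∀ x, 0 ≤ p x) (hp1 : ∑ x, p x = 1)
    (hρ : ∀ x, IsDensity (ρ x)) : IsDensity (marginal p ρ) := by
  have h0 : ∀ x ∈ Finset.univ, 0 ≤ p x • ρ x := fun x _ => smul_nonneg (hp x) (hρ x).1
  rw [marginal_eq]
  refine ⟨Finset.sum_nonneg h0, ?_⟩
  rw [trace_sum _ _ h0]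
  simp_rw [fun x => trace_smul (hρ x).1 (hp x), (hρ _).2, mul_one]
  rw [← ENNReal.ofReal_sum_of_nonneg fun x _ => hp x, hp1, ENNReal.ofReal_one]

theorem smul_le_marginal (hp : ∀ x, 0 ≤ p x) (hρ : ∀ x, 0 ≤ ρ x) (x : X) :
    p x • ρ x ≤ marginal p ρ := by
  rw [marginal_eq]
  exact Finset.single_le_sum (f := fun x => p x • ρ x) (fun x _ => smul_nonneg (hp x) (hρ x))
    (Finset.mem_univ x)

theorem IsEigenbasis.le_one {T : H →L[ℂ] H} {e : HilbertBasis ι ℂ H} {l : ι → ℝ}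
    (h : IsEigenbasis T e l) (hT : IsDensity T) (i : ι) : l i ≤ 1 := by
  have h1 := hT.2
  rw [h.trace_eq hT.1] at h1
  rw [← ENNReal.ofReal_le_ofReal_iff zero_le_one, ENNReal.ofReal_one, ← h1]
  exact ENNReal.le_tsum i

theorem IsEigenbasis.hasSum_one {T : H →L[ℂ] H} {e : HilbertBasis ι ℂ H} {l : ι → ℝ}
    (h : IsEigenbasis T e l) (hT : IsDensity T) : HasSum l 1 := by
  have h1 := hT.2
  rw [h.trace_eq hT.1] at h1
  have h2 := ENNReal.hasSum_toReal (h1.trans_ne ENNReal.one_ne_top)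
  rw [← ENNReal.tsum_toReal_eq fun _ => ENNReal.ofReal_ne_top, h1] at h2
  simpa [fun i => ENNReal.toReal_ofReal (h.nonneg hT.1 i)] using h2

/-- Hölder: the exponent conjugate to α turns l^((α-1)/α) into l, and the diagonal of τ is bounded
by `tsum_diag_rpow_le`. -/
theorem tsum_rpow_mul_re_inner_le {τ : H →L[ℂ] H} (hτ : 0 ≤ τ) {α : ℝ} (hα : 1 < α)
    (hfin : trace (CFC.rpow τ α) ≠ ∞) (e : HilbertBasis ι ℂ H) {l : ι → ℝ} (hl : ∀ i, 0 ≤ l i)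
    (hl1 : ∑' i, ENNReal.ofReal (l i) ≤ 1) :
    ∑' i, ENNReal.ofReal (⟪e i, τ (e i)⟫_ℂ).re * ENNReal.ofReal (l i ^ ((α - 1) / α)) ≤
      trace (CFC.rpow τ α) ^ (1 / α) := by
  obtain ⟨S, h, t, hh⟩ := exists_eigenbasis_of_trace_rpow hτ (by linarith) hfin
  have hpq := Real.HolderConjugate.conjExponent hα
  refine (tsum_mul_le_Lp_mul_Lq hpq _ _).trans ?_
  have h1 : ∀ i, ENNReal.ofReal (l i ^ ((α - 1) / α)) ^ α.conjExponent = ENNReal.ofReal (l i) := by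
    intro i
    rw [ENNReal.ofReal_rpow_of_nonneg (Real.rpow_nonneg (hl i) _) hpq.symm.nonneg,
      ← Real.rpow_mul (hl i), Real.conjExponent]
    have : α - 1 ≠ 0 := by linarith
    have : α ≠ 0 := by linarith
    rw [show (α - 1) / α * (α / (α - 1)) = 1 by field_simp, Real.rpow_one]
  simp_rw [h1]
  calc _ ≤ trace (CFC.rpow τ α) ^ (1 / α) * 1 := by
        refine mul_le_mul' (ENNReal.rpow_le_rpow (tsum_diag_rpow_le hτ hh e hα.le) ?_)
          (ENNReal.rpow_le_one hl1 (one_div_nonneg.2 hpq.symm.nonneg))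
        exact one_div_nonneg.2 (by linarith)
    _ = _ := mul_one _

theorem entropyTerm_add_le {l r : ℝ} (hl : 0 ≤ l) (hl1 : l ≤ 1) (hr : 0 ≤ r) (hr1 : r ≤ 1)
    (h : l ≠ 0 → r ≠ 0) :
    entropyTerm l r + ENNReal.ofReal (l * -Real.log l) + ENNReal.ofReal l ≤
      ENNReal.ofReal l * ENNReal.ofReal (-Real.log r) + ENNReal.ofReal r := by
  rcases hl.eq_or_lt with h0 | h0
  · simp [entropyTerm, ← h0]
  · have hr0 : 0 < r := hr.lt_of_ne' (h h0.ne')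
    have h1 := Real.log_nonpos hl hl1
    have h2 := Real.log_nonpos hr hr1
    have h3 := mul_negLog_add_le h0 hr0
    have h4 : 0 ≤ l * -Real.log l := mul_nonneg hl (by linarith)
    rw [entropyTerm, if_neg (by tauto), ← ENNReal.ofReal_mul hl,
      ← ENNReal.ofReal_add (by linarith) h4,
      ← ENNReal.ofReal_add (by linarith) hl,
      ← ENNReal.ofReal_add (mul_nonneg hl (by linarith)) hr]
    exact ENNReal.ofReal_le_ofReal (by linarith)

theorem inner_eq_zero_of_smul_le {β ρ : H →L[ℂ] H} {c : ℝ} (hc : 0 < c) (hρ : 0 ≤ ρ)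
    (hle : c • ρ ≤ β) {e : HilbertBasis ι ℂ H} {l : ι → ℝ} (he : IsEigenbasis ρ e l)
    {g : HilbertBasis κ ℂ H} {r : κ → ℝ} (hg : IsEigenbasis β g r) {i : ι} (hi : l i ≠ 0) {j : κ}
    (hj : r j = 0) : ⟪e i, g j⟫_ℂ = 0 := by
  refine inner_eq_zero_of_re_inner_eq_zero hρ he hi ?_
  have h3 := re_inner_mono hle (g j)
  rw [hg.re_inner, hj, _root_.smul_apply, ← Complex.coe_smul, inner_smul_right,
    Complex.re_ofReal_mul] at h3
  have h4 := re_inner_nonneg hρ (g j)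
  nlinarith

/-- Unpacks `entropyTerm` into cross entropy against entropy. Only additions are used, since the
separate sums over i may be infinite. -/
theorem mul_tsum_entropyTerm_le {β ρ : H →L[ℂ] H} {c : ℝ} (hc : 0 ≤ c) (hρ : IsDensity ρ)
    (hβ : IsDensity β) (hle : c • ρ ≤ β) {e : HilbertBasis ι ℂ H} {l : ι → ℝ}
    (he : IsEigenbasis ρ e l) {g : HilbertBasis κ ℂ H} {r : κ → ℝ} (hg : IsEigenbasis β g r)
    (i : ι) :
    ENNReal.ofReal c * ∑' j, ENNReal.ofReal (‖⟪e i, g j⟫_ℂ‖ ^ 2) * entropyTerm (l i) (r j) +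
      ENNReal.ofReal (c * l i * -Real.log (l i)) + ENNReal.ofReal (c * l i) ≤
      ENNReal.ofReal (c * l i) * negLog g r (e i) +
        ENNReal.ofReal c * ENNReal.ofReal (⟪e i, β (e i)⟫_ℂ).re := by
  rcases hc.eq_or_lt with h0 | h0
  · simp [← h0]
  have hl := he.nonneg hρ.1
  have hr := hg.nonneg hβ.1
  have h1 : ∀ j, ENNReal.ofReal (‖⟪e i, g j⟫_ℂ‖ ^ 2) * entropyTerm (l i) (r j) +
      ENNReal.ofReal (‖⟪e i, g j⟫_ℂ‖ ^ 2) * ENNReal.ofReal (l i * -Real.log (l i)) +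
      ENNReal.ofReal (‖⟪e i, g j⟫_ℂ‖ ^ 2) * ENNReal.ofReal (l i) ≤
      ENNReal.ofReal (l i) * (ENNReal.ofReal (‖⟪e i, g j⟫_ℂ‖ ^ 2) *
        ENNReal.ofReal (-Real.log (r j))) +
        ENNReal.ofReal (‖⟪g j, e i⟫_ℂ‖ ^ 2) * ENNReal.ofReal (r j) := by
    intro j
    rw [norm_inner_symm (g j)]
    by_cases hz : l i ≠ 0 ∧ r j = 0
    · simp [inner_eq_zero_of_smul_le h0 hρ.1 hle he hg hz.1 hz.2]
    · have h2 := entropyTerm_add_le (hl i) (he.le_one hρ i) (hr j) (hg.le_one hβ j) (by tauto)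
      calc _ = ENNReal.ofReal (‖⟪e i, g j⟫_ℂ‖ ^ 2) * (entropyTerm (l i) (r j) +
            ENNReal.ofReal (l i * -Real.log (l i)) + ENNReal.ofReal (l i)) := by ring
        _ ≤ _ := mul_le_mul_right h2 _
        _ = _ := by ring
  have h2 := ENNReal.tsum_le_tsum h1
  rw [ENNReal.tsum_add, ENNReal.tsum_add, ENNReal.tsum_add, ENNReal.tsum_mul_right,
    ENNReal.tsum_mul_right, tsum_ofReal_norm_inner_basis_sq', ENNReal.tsum_mul_left, one_mul,
    one_mul, ← hg.ofReal_re_inner hβ.1.isSelfAdjoint hr] at h2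
  rw [mul_assoc c, ENNReal.ofReal_mul hc, ENNReal.ofReal_mul hc, mul_assoc, ← mul_add, ← mul_add,
    ← mul_add]
  exact mul_le_mul_right h2 _

/-- Gibbs' inequality passes from the marginal to σ, and the eigenvector bound passes from the cross
entropy to τ_x. Entropies are subtracted only over finite sets G of eigenvectors, with an error
vanishing as the mass of G tends to 1. -/
theorem mutualInfo_le (hp : ∀ x, 0 ≤ p x) (hp1 : ∑ x, p x = 1) (hρ : ∀ x, IsDensity (ρ x))
    {α : ℝ} (hα : 1 < α) {σ : H →L[ℂ] H} (hσ : IsDensity σ)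
    (h : ∑ x, (p x : EReal) * sandwichedDiv α (ρ x) σ ≠ ⊤) :
    (mutualInfo p ρ : EReal) ≤ ∑ x, (p x : EReal) * sandwichedDiv α (ρ x) σ := by
  obtain ⟨h1, h2⟩ := sum_mul_eq_coe hp (fun x => sandwichedDiv_ne_bot hα (hρ x) hσ) h
  choose! τ hτ hfin using fun x hx => exists_of_sandwichedDiv_ne_top hα (h1 x hx)
  have hα0 : 0 < α := by linarith
  set s := (α - 1) / α with hs
  have hs0 : 0 < s := div_pos (by linarith) hα0
  have hγ : 0 < (α - 1) / (2 * α) := div_pos (by linarith) (by linarith)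
  have hγs : 2 * ((α - 1) / (2 * α)) = s := by rw [hs]; field_simp
  have hβ := isDensity_marginal hp hp1 hρ
  set β := marginal p ρ
  obtain ⟨_, g, r, hg⟩ := hβ.exists_eigenbasis
  obtain ⟨_, f, m, hf⟩ := hσ.exists_eigenbasis
  choose S e l he using fun x => (hρ x).exists_eigenbasis
  have hl : ∀ x i, 0 ≤ l x i := fun x => (he x).nonneg (hρ x).1
  have hr := hg.nonneg hβ.1
  have hm := hf.nonneg hσ.1
  set D : X → ℝ := fun x => (sandwichedDiv α (ρ x) σ).toReal
  set K : X → ℝ := fun x => ((trace (CFC.rpow (τ x) α)) ^ (1 / α)).toReal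
  have hK0 : ∀ x, p x ≠ 0 → 0 < K x := fun x hx =>
    ENNReal.toReal_pos (ENNReal.rpow_pos (pos_iff_ne_zero.2
      (trace_rpow_ne_zero (hτ x hx).1 ((hτ x hx).ne_zero (hρ x)) hα0)) (hfin x hx)).ne'
      (ENNReal.rpow_ne_top_of_nonneg (by positivity) (hfin x hx))
  have hKD : ∀ x, p x ≠ 0 → Real.log (K x) = s * D x := by
    intro x hx
    have hN := ENNReal.toReal_pos
      (trace_rpow_ne_zero (hτ x hx).1 ((hτ x hx).ne_zero (hρ x)) hα0) (hfin x hx)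
    simp only [D, K]
    rw [sandwichedDiv_eq hα (hρ x) hσ (hτ x hx) (hfin x hx), EReal.toReal_coe,
      ← ENNReal.toReal_rpow, Real.log_rpow hN, hs]
    have : α - 1 ≠ 0 := by linarith
    field_simp
  set Ω := Σ x, S x
  set w : Ω → ℝ := fun ω => p ω.1 * l ω.1 ω.2
  set v : Ω → H := fun ω => e ω.1 ω.2
  have hw : ∀ ω, 0 ≤ w ω := fun ω => mul_nonneg (hp _) (hl _ _)
  have hv : ∀ ω, ‖v ω‖ = 1 := fun ω => norm_hilbertBasis _ _
  have hwsum : HasSum w 1 := by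
    have := hasSum_sigma_fintype fun x => ((he x).hasSum_one (hρ x)).mul_left (p x)
    simpa [hp1] using this
  have hwD : HasSum (fun ω => w ω * D ω.1) (∑ x, p x * D x) := by
    have := hasSum_sigma_fintype fun x =>
      (((he x).hasSum_one (hρ x)).mul_left (p x)).mul_right (D x)
    simpa using this
  have hdom : ∀ (G : Finset Ω) (z : H), ∑ ω ∈ G, w ω * ‖⟪v ω, z⟫_ℂ‖ ^ 2 ≤ (⟪z, β z⟫_ℂ).re := by
    intro G z
    have h3 := hasSum_sigma_fintype fun x =>
      ((he x).hasSum_re_inner (hρ x).1.isSelfAdjoint z).mul_left (p x)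
    have h4 : (⟪z, β z⟫_ℂ).re = ∑ x, p x * (⟪z, ρ x z⟫_ℂ).re := by
      simp only [β]
      rw [marginal_eq, sum_apply, inner_sum, Complex.re_sum]
      refine Finset.sum_congr rfl fun x _ => ?_
      rw [_root_.smul_apply, ← Complex.coe_smul, inner_smul_right, Complex.re_ofReal_mul]
    rw [h4]
    refine le_trans (le_of_eq ?_) (sum_le_hasSum G (fun ω _ => ?_) h3)
    · exact Finset.sum_congr rfl fun ω _ => by simp only [w, v]; ring
    · exact mul_nonneg (hp _) (mul_nonneg (by positivity) (hl _ _))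
  set T : Ω → ℝ≥0∞ := fun ω => ENNReal.ofReal (p ω.1) *
    ∑' j, ENNReal.ofReal (‖⟪e ω.1 ω.2, g j⟫_ℂ‖ ^ 2) * entropyTerm (l ω.1 ω.2) (r j)
  have hI : mutualInfo p ρ = ∑' ω, T ω := by
    rw [mutualInfo_eq hp he hg, ENNReal.tsum_sigma', tsum_fintype]
    exact Finset.sum_congr rfl fun x _ => ENNReal.tsum_mul_left.symm
  set U : Ω → ℝ := fun ω => (negLog f m (v ω)).toReal
  -- With d = ⟪v, τ v⟫ and K = ‖τ‖_α, so that log K = s D, the inequality log t ≤ t - 1 is applied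
  -- at t = d l^s / (l K). Y is w times this ratio, and Hölder keeps its sum below 1.
  set Y : Ω → ℝ := fun ω =>
    p ω.1 * ((⟪v ω, τ ω.1 (v ω)⟫_ℂ).re * l ω.1 ω.2 ^ s / K ω.1)
  have hne : ∀ ω, w ω ≠ 0 → p ω.1 ≠ 0 ∧ 0 < l ω.1 ω.2 := fun ω hω =>
    ⟨left_ne_zero_of_mul hω, (hl _ _).lt_of_ne' (right_ne_zero_of_mul hω)⟩
  have hneg : ∀ ω, w ω ≠ 0 → _ := fun ω hω =>
    (hτ _ (hne ω hω).1).negLog_le hγ hσ.1 hf (hf.le_one hσ) (he ω.1) (hne ω hω).2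
  have hU : ∀ ω, ENNReal.ofReal (w ω) * negLog f m (v ω) = ENNReal.ofReal (w ω * U ω) := by
    intro ω
    by_cases hω : w ω = 0
    · simp [hω]
    · rw [ENNReal.ofReal_mul (hw ω), ENNReal.ofReal_toReal (hneg ω hω).2.1]
  have hUY : ∀ ω, s * (w ω * U ω) ≤
      Y ω - w ω + s * (w ω * D ω.1) + s * (w ω * -Real.log (l ω.1 ω.2)) := by
    intro ω
    by_cases hω : w ω = 0
    · have h3 : Y ω = 0 := by
        rcases mul_eq_zero.1 hω with h4 | h4
        · simp only [Y, h4, zero_mul]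
        · simp only [Y, h4, Real.zero_rpow hs0.ne', mul_zero, zero_div]
      simp [hω, h3]
    · obtain ⟨hd, -, h3⟩ := hneg ω hω
      obtain ⟨hpω, hlω⟩ := hne ω hω
      rw [hγs] at h3
      have hK := hK0 _ hpω
      have hls : 0 < l ω.1 ω.2 ^ s := Real.rpow_pos_of_pos hlω s
      set d := (⟪v ω, τ ω.1 (v ω)⟫_ℂ).re with hd_def
      have hd' : 0 < d := hd
      have h4 := Real.log_le_sub_one_of_pos
        (show 0 < d * l ω.1 ω.2 ^ s / (l ω.1 ω.2 * K ω.1) by positivity)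
      rw [Real.log_div (by positivity) (by positivity), Real.log_mul hd'.ne' hls.ne',
        Real.log_mul hlω.ne' hK.ne', Real.log_rpow hlω, hKD _ hpω] at h4
      have h5 : Y ω = w ω * (d * l ω.1 ω.2 ^ s / (l ω.1 ω.2 * K ω.1)) := by
        simp only [Y, w]
        rw [← hd_def]
        field_simp
      have h6 : s * U ω ≤ d * l ω.1 ω.2 ^ s / (l ω.1 ω.2 * K ω.1) - 1 + s * D ω.1 +
          s * -Real.log (l ω.1 ω.2) := by
        have h7 : s * U ω ≤ Real.log d - Real.log (l ω.1 ω.2) := h3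
        linarith
      have h8 := mul_le_mul_of_nonneg_left h6 (hw ω)
      rw [h5]
      linarith
  have hY : ∀ G : Finset Ω, ∑ ω ∈ G, Y ω ≤ 1 := by
    intro G
    have hY0 : ∀ ω, 0 ≤ Y ω := by
      intro ω
      by_cases hx : p ω.1 = 0
      · simp [Y, hx]
      · exact mul_nonneg (hp _) (div_nonneg (mul_nonneg (re_inner_nonneg (hτ _ hx).1 _)
          (Real.rpow_nonneg (hl _ _) _)) (hK0 _ hx).le)
    rw [← ENNReal.ofReal_le_ofReal_iff zero_le_one, ENNReal.ofReal_one]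
    calc ENNReal.ofReal (∑ ω ∈ G, Y ω) ≤ ∑ ω ∈ G, ENNReal.ofReal (Y ω) :=
          (ENNReal.ofReal_sum_of_nonneg fun ω _ => hY0 ω).le
      _ ≤ ∑' ω, ENNReal.ofReal (Y ω) := ENNReal.sum_le_tsum G
      _ = ∑ x, ∑' i, ENNReal.ofReal (Y ⟨x, i⟩) := by rw [ENNReal.tsum_sigma', tsum_fintype]
      _ ≤ ∑ x, ENNReal.ofReal (p x) := by
          refine Finset.sum_le_sum fun x _ => ?_
          by_cases hx : p x = 0
          · simp [Y, hx]
          · have hK := hK0 x hx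
            have h3 : ∀ i, ENNReal.ofReal (Y ⟨x, i⟩) = ENNReal.ofReal (p x) *
                (ENNReal.ofReal (⟪e x i, τ x (e x i)⟫_ℂ).re * ENNReal.ofReal (l x i ^ s)) *
                (ENNReal.ofReal (K x))⁻¹ := by
              intro i
              simp only [Y, v]
              rw [div_eq_mul_inv, ENNReal.ofReal_mul (hp x), ENNReal.ofReal_mul' (by positivity),
                ENNReal.ofReal_mul' (Real.rpow_nonneg (hl x i) s), ENNReal.ofReal_inv_of_pos hK]
              ring
            simp_rw [h3]
            rw [ENNReal.tsum_mul_right, ENNReal.tsum_mul_left]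
            have h4 := tsum_rpow_mul_re_inner_le (hτ x hx).1 hα (hfin x hx) (e x) (hl x)
              (by rw [← (he x).trace_eq (hρ x).1, (hρ x).2])
            have h5 : ENNReal.ofReal (K x) = trace (CFC.rpow (τ x) α) ^ (1 / α) :=
              ENNReal.ofReal_toReal (ENNReal.rpow_ne_top_of_nonneg (by positivity) (hfin x hx))
            rw [← h5] at h4
            calc _ ≤ ENNReal.ofReal (p x) * ENNReal.ofReal (K x) * (ENNReal.ofReal (K x))⁻¹ := by
                  gcongr
              _ = _ := by
                  rw [mul_assoc, ENNReal.mul_inv_cancel (by simpa using hK) ENNReal.ofReal_ne_top,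
                    mul_one]
      _ = 1 := by
          rw [← ENNReal.ofReal_sum_of_nonneg fun x _ => hp x, hp1, ENNReal.ofReal_one]
  have hq : ∀ G : Finset Ω, ∑ ω ∈ G, ENNReal.ofReal (p ω.1) *
      ENNReal.ofReal (⟪v ω, β (v ω)⟫_ℂ).re ≤ 1 := by
    intro G
    refine (ENNReal.sum_le_tsum G).trans (le_of_eq ?_)
    rw [ENNReal.tsum_sigma', tsum_fintype]
    simp only [v]
    simp_rw [ENNReal.tsum_mul_left, ← trace_eq_tsum hβ.1, hβ.2, mul_one]
    rw [← ENNReal.ofReal_sum_of_nonneg fun x _ => hp x, hp1, ENNReal.ofReal_one]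
  -- With W the mass of G, the deficit 1 - W is paid twice for the additive constants in Gibbs'
  -- inequality and in the unpacked entropy terms, and once with factor 1/s for ∑ Y ≤ 1.
  set B : Finset Ω → ℝ := fun G =>
    (2 + s⁻¹) * (1 - ∑ ω ∈ G, w ω) + ∑ ω ∈ G, w ω * D ω.1
  have hB : ∀ G, 0 ≤ B G ∧ ∑ ω ∈ G, T ω ≤ ENNReal.ofReal (B G) := by
    intro G
    have hL : ∀ ω, 0 ≤ w ω * -Real.log (l ω.1 ω.2) := fun ω => mul_nonneg (hw ω) (by
      have := Real.log_nonpos (hl ω.1 ω.2) ((he ω.1).le_one (hρ ω.1) ω.2)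
      linarith)
    have h3 := sum_negLog_le G hw hv (sum_le_hasSum G (fun ω _ => hw ω) hwsum) hg hr
      (hg.le_one hβ) (hdom G) f hm (hf.le_one hσ) (by rw [← hf.trace_eq hσ.1, hσ.2])
      (fun ω _ hω j hj => (hτ _ (hne ω hω).1).inner_eq_zero hγ hσ.1 hf (he ω.1)
        (hne ω hω).2.ne' hj)
    simp_rw [hU] at h3
    have h4 : ∑ ω ∈ G, T ω + ∑ ω ∈ G, ENNReal.ofReal (w ω * -Real.log (l ω.1 ω.2)) +
        ∑ ω ∈ G, ENNReal.ofReal (w ω) ≤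
        ∑ ω ∈ G, ENNReal.ofReal (w ω) * negLog g r (v ω) + 1 := by
      rw [← Finset.sum_add_distrib, ← Finset.sum_add_distrib]
      refine le_trans (Finset.sum_le_sum fun ω _ => mul_tsum_entropyTerm_le (hp ω.1) (hρ ω.1) hβ
        (smul_le_marginal hp (fun x => (hρ x).1) ω.1) (he ω.1) hg ω.2) ?_
      rw [Finset.sum_add_distrib]
      exact add_le_add_right (hq G) _
    rw [← ENNReal.ofReal_sum_of_nonneg fun ω _ => hw ω] at h3 h4
    rw [← ENNReal.ofReal_sum_of_nonneg fun ω _ => hL ω] at h4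
    rw [← ENNReal.ofReal_sum_of_nonneg fun ω _ =>
      mul_nonneg (hw ω) ENNReal.toReal_nonneg] at h3
    set W := ∑ ω ∈ G, w ω
    set L := ∑ ω ∈ G, w ω * -Real.log (l ω.1 ω.2)
    set V := ∑ ω ∈ G, w ω * U ω
    have hW0 : 0 ≤ W := Finset.sum_nonneg fun ω _ => hw ω
    have hL0 : 0 ≤ L := Finset.sum_nonneg fun ω _ => hL ω
    have hV0 : 0 ≤ V := Finset.sum_nonneg fun ω _ => mul_nonneg (hw ω) ENNReal.toReal_nonneg
    have h5 : ∑ ω ∈ G, T ω + ENNReal.ofReal (L + W + W) ≤ ENNReal.ofReal (V + 1 + 1) := by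
      rw [ENNReal.ofReal_add (by positivity) hW0, ENNReal.ofReal_add hL0 hW0,
        ENNReal.ofReal_add (by positivity) zero_le_one, ENNReal.ofReal_add hV0 zero_le_one,
        ENNReal.ofReal_one, ← add_assoc, ← add_assoc]
      calc _ ≤ _ := add_le_add_left h4 _
        _ = ∑ ω ∈ G, ENNReal.ofReal (w ω) * negLog g r (v ω) + ENNReal.ofReal W + 1 := by
            rw [add_right_comm]
        _ ≤ _ := add_le_add_left h3 _
    have h6 : V + 1 + 1 - (L + W + W) ≤ B G := by
      have h7 : s * V ≤ ∑ ω ∈ G, Y ω - W + s * ∑ ω ∈ G, w ω * D ω.1 + s * L := by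
        simp only [V, W, L]
        rw [Finset.mul_sum, Finset.mul_sum, Finset.mul_sum, ← Finset.sum_sub_distrib,
          ← Finset.sum_add_distrib, ← Finset.sum_add_distrib]
        exact Finset.sum_le_sum fun ω _ => hUY ω
      have h8 : s * (V - L - ∑ ω ∈ G, w ω * D ω.1) ≤ 1 - W := by
        have := hY G
        linarith
      have h9 := (le_inv_mul_iff₀ hs0).2 h8
      simp only [B]
      linarith
    have h7 : L + W + W ≤ V + 1 + 1 :=
      (ENNReal.ofReal_le_ofReal_iff (by positivity)).1 (le_trans le_add_self h5)
    refine ⟨by linarith, ?_⟩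
    refine le_trans ?_ (ENNReal.ofReal_le_ofReal h6)
    rw [ENNReal.ofReal_sub _ (by positivity)]
    exact ENNReal.le_sub_of_add_le_right ENNReal.ofReal_ne_top h5
  have hBlim : Tendsto B atTop (𝓝 (∑ x, p x * D x)) := by
    have h3 : Tendsto (fun G : Finset Ω => ∑ ω ∈ G, w ω) atTop (𝓝 1) := hwsum
    have h4 : Tendsto (fun G : Finset Ω => ∑ ω ∈ G, w ω * D ω.1) atTop (𝓝 (∑ x, p x * D x)) := hwD
    have h5 := ((h3.const_sub 1).const_mul (2 + s⁻¹)).add h4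
    simpa using h5
  have hD0 : 0 ≤ ∑ x, p x * D x := ge_of_tendsto' hBlim fun G => (hB G).1
  rw [h2, hI]
  have h6 : ∑' ω, T ω ≤ ENNReal.ofReal (∑ x, p x * D x) :=
    le_of_tendsto_of_tendsto' ENNReal.summable.hasSum (ENNReal.tendsto_ofReal hBlim)
      fun G => (hB G).2
  calc ((∑' ω, T ω : ℝ≥0∞) : EReal) ≤ ((ENNReal.ofReal (∑ x, p x * D x) : ℝ≥0∞) : EReal) := by
        exact_mod_cast h6
    _ = _ := by rw [EReal.coe_ennreal_ofReal, max_eq_left hD0]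

end Upper

/-! ### Products of powers and A^(-1/2) B -/

section Factor

variable {H : Type*} [NormedAddCommGroup H] [InnerProductSpace ℂ H] [CompleteSpace H]
variable {ι κ : Type*}

theorem rpow_eq_rpow_mul_self {T : H →L[ℂ] H} (hT : 0 ≤ T) {α : ℝ} (hα : 1 < α) :
    CFC.rpow T α = CFC.rpow T (α - 1) * T := by
  have h0 : (0 : ℝ) < α - 1 := by linarith
  set c : ℝ≥0 := ⟨α - 1, h0.le⟩
  have hc : 0 < c := h0
  have h := CFC.nnrpow_add (a := T) hc one_pos
  rw [CFC.nnrpow_one T, CFC.nnrpow_eq_rpow hc, CFC.nnrpow_eq_rpow (by positivity)] at h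
  have e1 : ((c + 1 : ℝ≥0) : ℝ) = α := sub_add_cancel α 1
  rw [e1] at h
  exact h

theorem IsEigenbasis.mul_rpow {T : H →L[ℂ] H} (hT : 0 ≤ T) {e : HilbertBasis ι ℂ H} {l : ι → ℝ}
    (he : IsEigenbasis T e l) {x y : ℝ} (hx : 0 < x) (hy : 0 < y) :
    CFC.rpow T x * CFC.rpow T y = CFC.rpow T (x + y) := by
  refine clm_ext_basis e fun i => ?_
  rw [mul_apply_eq_comp, he.rpow hT hy.le i, map_smul, he.rpow hT hx.le i,
    he.rpow hT (add_pos hx hy).le i, smul_smul, ← Complex.ofReal_mul]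
  congr 2
  rw [mul_comm]
  exact (Real.rpow_add' (he.nonneg hT i) (add_pos hx hy).ne').symm

theorem IsEigenbasis.norm_rpow_half_sq {T : H →L[ℂ] H} (hT : 0 ≤ T) {e : HilbertBasis ι ℂ H}
    {l : ι → ℝ} (he : IsEigenbasis T e l) {x : ℝ} (hx : 0 < x) (z : H) :
    ‖CFC.rpow T (x / 2) z‖ ^ 2 = (⟪z, CFC.rpow T x z⟫_ℂ).re := by
  have h := he.mul_rpow hT (half_pos hx) (half_pos hx)
  rw [add_halves] at h
  rw [← h, mul_apply_eq_comp, ← isSelfAdjoint_iff_inner (T := CFC.rpow T (x / 2))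
    (CFC.rpow_nonneg (a := T) (y := x / 2)).isSelfAdjoint]
  exact (inner_self_eq_norm_sq (𝕜 := ℂ) _).symm

/-- If `B² ≤ A` then `A^{-1/2} B` is a contraction. -/
theorem exists_inv_sqrt_mul {A B : H →L[ℂ] H} {f : HilbertBasis κ ℂ H} {a : κ → ℝ}
    (hA : IsEigenbasis A f a) (ha : ∀ j, 0 ≤ a j) (hB : IsSelfAdjoint B)
    (h : ∀ z, ‖B z‖ ^ 2 ≤ (⟪z, A z⟫_ℂ).re) :
    ∃ L : H →L[ℂ] H, (∀ y, ‖L y‖ ≤ ‖y‖) ∧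
      ∀ j y, ⟪f j, L y⟫_ℂ = (((√(a j))⁻¹ : ℝ) : ℂ) * ⟪f j, B y⟫_ℂ := by
  have hterm : ∀ j y, ENNReal.ofReal (‖(((√(a j))⁻¹ : ℝ) : ℂ) * ⟪f j, B y⟫_ℂ‖ ^ 2) =
      ENNReal.ofReal (a j)⁻¹ * ENNReal.ofReal (‖⟪f j, B y⟫_ℂ‖ ^ 2) := by
    intro j y
    rw [norm_mul, mul_pow, Complex.norm_real, Real.norm_of_nonneg (by positivity), inv_pow,
      Real.sq_sqrt (ha j), ENNReal.ofReal_mul (inv_nonneg.2 (ha j))]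
  have hle : ∀ y, ∑' j, ENNReal.ofReal (‖(((√(a j))⁻¹ : ℝ) : ℂ) * ⟪f j, B y⟫_ℂ‖ ^ 2) ≤
      ENNReal.ofReal (‖y‖ ^ 2) := by
    intro y
    simp_rw [hterm]
    exact tsum_inv_mul_le hA ha hB h y
  -- The coefficients of A^(-1/2) B y are square summable by B A⁻¹ B ≤ 1. The convention (√0)⁻¹ = 0
  -- inverts A on its support only.
  have hmem : ∀ y, Memℓp (fun j => (((√(a j))⁻¹ : ℝ) : ℂ) * ⟪f j, B y⟫_ℂ) 2 := by
    intro y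
    refine memℓp_two ?_
    have h1 := ENNReal.summable_toReal (ne_top_of_le_ne_top ENNReal.ofReal_ne_top (hle y))
    refine h1.congr fun j => ?_
    rw [ENNReal.toReal_ofReal (by positivity)]
  have hnorm : ∀ y, ‖f.repr.symm ⟨_, hmem y⟩‖ ≤ 1 * ‖y‖ := by
    intro y
    rw [one_mul]
    refine le_of_sq_le_sq ?_ (norm_nonneg _)
    rw [LinearIsometryEquiv.norm_map, ← ENNReal.ofReal_le_ofReal_iff (by positivity)]
    refine le_trans (le_of_eq ?_) (hle y)
    have h1 := norm_sq_eq (⟨_, hmem y⟩ : ℓ²(κ, ℂ))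
    rw [← h1.tsum_eq, ENNReal.ofReal_tsum_of_nonneg (fun _ => by positivity) h1.summable]
  refine ⟨LinearMap.mkContinuous
    { toFun := fun y => f.repr.symm ⟨_, hmem y⟩
      map_add' := fun y z => ?_
      map_smul' := fun c y => ?_ } 1 hnorm, fun y => ?_, fun j y => ?_⟩
  · rw [← map_add]
    congr 1
    ext j
    simp only [map_add, inner_add_right, mul_add, lp.coeFn_add, Pi.add_apply]
  · rw [RingHom.id_apply, ← map_smul]
    congr 1
    ext j
    simp only [map_smul, inner_smul_right, lp.coeFn_smul, Pi.smul_apply, smul_eq_mul]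
    ring
  · simpa using hnorm y
  · rw [← f.repr_apply_apply]
    simp

end Factor

/-! ### Comparison with the Petz quantity -/

section Sandwich

variable {H : Type*} [NormedAddCommGroup H] [InnerProductSpace ℂ H] [CompleteSpace H]
variable {ι κ : Type*}

/-- For `ρ ≤ σ`, the sandwiched operator of order `α ∈ (1,2)` exists, and the trace of its `α`-th
power is bounded by the Petz quantity `Tr ρ^{1+s} σ^{-s}`, `s = (α-1)/α`. -/
theorem exists_isSandwich_of_le {ρ σ : H →L[ℂ] H} (hρ : 0 ≤ ρ) (hle : ρ ≤ σ)
    {e : HilbertBasis ι ℂ H} {l : ι → ℝ} (he : IsEigenbasis ρ e l)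
    {f : HilbertBasis κ ℂ H} {m : κ → ℝ} (hf : IsEigenbasis σ f m) {α : ℝ} (hα : 1 < α)
    (hα2 : α < 2) :
    ∃ τ : H →L[ℂ] H, IsSandwich ((α - 1) / (2 * α)) ρ σ τ ∧
      trace (CFC.rpow τ α) ≤ ∑' i, ∑' j, ENNReal.ofReal (‖⟪e i, f j⟫_ℂ‖ ^ 2) *
        ENNReal.ofReal (l i ^ (1 + (α - 1) / α) * (m j ^ ((α - 1) / α))⁻¹) := by
  have hσ : 0 ≤ σ := hρ.trans hle
  have hα0 : 0 < α := by linarith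
  set s := (α - 1) / α with hs
  have hs0 : 0 < s := div_pos (by linarith) hα0
  have hs1 : s < 1 := by rw [hs, div_lt_one hα0]; linarith
  have hγ : (α - 1) / (2 * α) = s / 2 := by rw [hs]; field_simp
  rw [hγ]
  have hl := he.nonneg hρ
  have hm := hf.nonneg hσ
  have hsa : ∀ (T : H →L[ℂ] H) (x : ℝ), IsSelfAdjoint (CFC.rpow T x) := fun T x =>
    (CFC.rpow_nonneg (a := T) (y := x)).isSelfAdjoint
  set B := CFC.rpow ρ (s / 2)
  set C := CFC.rpow ρ ((1 - s) / 2)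
  set Q := CFC.rpow ρ (1 / 2)
  set S := CFC.rpow σ (s / 2)
  have hBC : B * C = Q := by
    simp only [B, C, Q]
    rw [he.mul_rpow hρ (by linarith) (by linarith)]
    congr 1; ring
  have hQQ : Q * Q = ρ := by
    simp only [Q]
    rw [he.mul_rpow hρ (by norm_num) (by norm_num), show (1 / 2 + 1 / 2 : ℝ) = 1 by norm_num]
    exact CFC.rpow_one ρ
  have hQf : ∀ j, m j = 0 → Q (f j) = 0 := by
    intro j hj
    have h1 := he.norm_rpow_half_sq hρ one_pos (f j)
    rw [show CFC.rpow ρ 1 = ρ from CFC.rpow_one ρ] at h1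
    have h2 := re_inner_mono hle (f j)
    rw [hf.re_inner, hj, ← h1] at h2
    exact norm_eq_zero.1 (sq_eq_zero_iff.1 (le_antisymm h2 (sq_nonneg _)))
  -- By Löwner-Heinz L₀ = σ^(-s/2) ρ^(s/2) is a contraction. Then L = L₀ ρ^((1-s)/2) stands for
  -- σ^(-s/2) ρ^(1/2), and the sandwiched operator is L L*.
  have hpow : CFC.rpow ρ s ≤ CFC.rpow σ s := CFC.rpow_le_rpow ⟨hs0.le, hs1.le⟩ hle
  obtain ⟨L₀, hL₀, hL₀f⟩ := exists_inv_sqrt_mul (hf.rpow hσ hs0.le)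
    (fun j => Real.rpow_nonneg (hm j) s) (hsa ρ (s / 2))
    (fun z => (he.norm_rpow_half_sq hρ hs0 z).trans_le (re_inner_mono hpow z))
  set L := L₀ * C
  have hLf : ∀ j y, ⟪f j, L y⟫_ℂ = (((√(m j ^ s))⁻¹ : ℝ) : ℂ) * ⟪f j, Q y⟫_ℂ := by
    intro j y
    simp only [L]
    rw [mul_apply_eq_comp, hL₀f, ← mul_apply_eq_comp, hBC]
  have hLn : ∀ y, ‖L y‖ ^ 2 ≤ (⟪y, CFC.rpow ρ (1 - s) y⟫_ℂ).re := by
    intro y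
    rw [← he.norm_rpow_half_sq hρ (by linarith)]
    exact pow_le_pow_left₀ (norm_nonneg _) (hL₀ _) 2
  have hSL : S * L = Q := by
    ext y
    refine sub_eq_zero.1 (eq_zero_of_forall_inner_eq_zero f fun j => ?_)
    rw [inner_sub_right, mul_apply_eq_comp, (hf.rpow hσ (by linarith)).inner_apply (hsa _ _), hLf,
      sub_eq_zero]
    rcases (hm j).eq_or_lt with h0 | h0
    · rw [← isSelfAdjoint_iff_inner (hsa _ _), hQf j h0.symm]
      simp
    · have h1 : m j ^ (s / 2) * (√(m j ^ s))⁻¹ = 1 := by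
        rw [Real.sqrt_eq_rpow, ← Real.rpow_mul h0.le, show s * (1 / 2) = s / 2 by ring]
        exact mul_inv_cancel₀ (Real.rpow_pos_of_pos h0 _).ne'
      rw [← mul_assoc, ← Complex.ofReal_mul, h1]
      simp
  have hadj : ∀ y z, ⟪star L y, z⟫_ℂ = ⟪y, L z⟫_ℂ := fun y z => by
    rw [ContinuousLinearMap.star_eq_adjoint, ContinuousLinearMap.adjoint_inner_left]
  have hτ : 0 ≤ L * star L := mul_star_self_nonneg L
  have hκ : 0 ≤ star L * L := star_mul_self_nonneg L
  refine ⟨L * star L, ⟨hτ, fun v hv => ?_, ?_⟩, ?_⟩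
  · have h1 : star L v = 0 := by
      refine eq_zero_of_forall_inner_eq_zero f fun k => ?_
      rw [inner_eq_zero_symm, hadj]
      refine (f.hasSum_inner_mul_inner v (L (f k))).unique ?_
      have h2 : ∀ j, ⟪v, f j⟫_ℂ * ⟪f j, L (f k)⟫_ℂ = 0 := by
        intro j
        by_cases hj : m j = 0
        · rw [hLf, hj, Real.zero_rpow hs0.ne']
          simp
        · have h3 := hf.inner_apply hσ.isSelfAdjoint j v
          rw [hv, inner_zero_right, eq_comm] at h3
          have h4 := (mul_eq_zero.1 h3).resolve_left (by exact_mod_cast hj)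
          rw [inner_eq_zero_symm.1 h4, zero_mul]
      simpa only [h2] using hasSum_zero
    rw [mul_apply_eq_comp, h1, map_zero]
  · have hS : star S = S := hsa _ _
    have hQ : star Q = Q := hsa _ _
    calc S * (L * star L) * S = (S * L) * star (S * L) := by
          have h1 : ∀ a b c : H →L[ℂ] H, a * (b * c) * a = a * b * (c * a) := fun a b c => by
            simp only [mul_assoc]
          rw [star_mul S L, hS, h1]
      _ = ρ := by rw [hSL, hQ, hQQ]
  · have hκle : star L * L ≤ CFC.rpow ρ (1 - s) := by
      refine sub_nonneg.1 (nonneg_of_re_inner_nonneg ((hsa _ _).sub hκ.isSelfAdjoint) fun v => ?_)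
      rw [sub_apply, inner_sub_right, Complex.sub_re, mul_apply_eq_comp,
        ← inner_conj_symm v (star L (L v)), hadj, Complex.conj_re]
      have h1 := hLn v
      have h2 : (⟪L v, L v⟫_ℂ).re = ‖L v‖ ^ 2 := inner_self_eq_norm_sq (𝕜 := ℂ) _
      linarith
    -- As L* L ≤ ρ^(1-s), (L L*)^α = L (L* L)^(α-1) L* ≤ L ρ^((1-s)(α-1)) L*; Löwner-Heinz needs α -
    -- 1 ≤ 1. Since (1-s)(α-1) = s, the trace of the right side is Tr ρ^(1+s) σ^(-s).
    have h1 : CFC.rpow (L * star L) α = L * CFC.rpow (star L * L) (α - 1) * star L := by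
      rw [rpow_eq_rpow_mul_self hτ hα, ← mul_assoc,
        rpow_mul_eq_mul_rpow hτ hκ (mul_assoc L (star L) L) (by linarith)]
    have h2 : CFC.rpow (star L * L) (α - 1) ≤ CFC.rpow (CFC.rpow ρ (1 - s)) (α - 1) :=
      CFC.rpow_le_rpow ⟨by linarith, by linarith⟩ hκle
    have he2 := (he.rpow hρ (show 0 ≤ 1 - s by linarith)).rpow CFC.rpow_nonneg
      (show 0 ≤ α - 1 by linarith)
    rw [trace_eq_tsum (T := CFC.rpow (L * star L) α) CFC.rpow_nonneg f, h1, ENNReal.tsum_comm]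
    refine ENNReal.tsum_le_tsum fun j => ?_
    rw [mul_apply_eq_comp, mul_apply_eq_comp, ← hadj]
    refine (ENNReal.ofReal_le_ofReal (re_inner_mono h2 _)).trans ?_
    rw [he2.ofReal_re_inner (hsa _ _)
      (fun i => Real.rpow_nonneg (Real.rpow_nonneg (hl i) _) _)]
    refine ENNReal.tsum_le_tsum fun i => le_of_eq ?_
    rw [← ENNReal.ofReal_mul (by positivity), ← ENNReal.ofReal_mul (by positivity)]
    congr 1
    rw [norm_inner_symm, hadj, hLf, he.rpow hρ (by norm_num : (0 : ℝ) ≤ 1 / 2) i,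
      inner_smul_right, norm_mul, norm_mul, Complex.norm_real, Complex.norm_real,
      Real.norm_of_nonneg (by positivity), Real.norm_of_nonneg (Real.rpow_nonneg (hl i) _),
      norm_inner_symm, mul_pow, mul_pow, inv_pow, Real.sq_sqrt (Real.rpow_nonneg (hm j) s),
      ← Real.rpow_natCast (l i ^ (1 / 2 : ℝ)), ← Real.rpow_mul (hl i), ← Real.rpow_mul (hl i),
      Real.rpow_add' (hl i) (by linarith)]
    have h3 : (1 - s) * (α - 1) = s := by rw [hs]; field_simp; ring
    rw [h3, show (1 / 2 : ℝ) * (2 : ℕ) = 1 by norm_num, Real.rpow_one]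
    ring

end Sandwich

/-! ### Expansion of the Petz quantity near order one -/

section Lower

variable {H : Type*} [NormedAddCommGroup H] [InnerProductSpace ℂ H] [CompleteSpace H]
variable {ι κ : Type*}

theorem exp_le_of_nonpos {t : ℝ} (ht : t ≤ 0) : Real.exp t ≤ 1 + t + t ^ 2 := by
  rcases le_total (-1) t with h | h
  · have := (abs_le.1 (Real.abs_exp_sub_one_sub_id_le (abs_le.2 ⟨h, by linarith⟩))).2
    linarith
  · have := Real.exp_le_one_iff.2 ht
    nlinarith

theorem exp_le_of_nonneg {t : ℝ} (ht : 0 ≤ t) : Real.exp t ≤ 1 + t + t ^ 2 * Real.exp t := by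
  have h1 : Real.exp t * (1 - t) ≤ 1 := by
    have h2 := Real.one_sub_le_exp_neg t
    have h3 := mul_le_mul_of_nonneg_left h2 (Real.exp_pos t).le
    rwa [← Real.exp_add, add_neg_cancel, Real.exp_zero] at h3
  nlinarith [mul_le_mul_of_nonneg_left h1 ht]

/-- Second-order expansion of l e^(s log x), x = l/m. For x ≥ 1 the remainder uses log x ≤ 4 x^(1/4)
and x^s ≤ x^(1/2), giving 16 x; for x ≤ 1 it uses -log x ≤ 2 x^(-1/2), giving 4/x. -/
theorem rpow_mul_inv_rpow_le {l m s : ℝ} (hl : 0 < l) (hm : 0 < m) (hs : 0 < s)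
    (hs2 : s ≤ 1 / 2) :
    l ^ (1 + s) * (m ^ s)⁻¹ ≤
      l + s * (l * (Real.log l - Real.log m)) + s ^ 2 * (16 * (l * (m⁻¹ * l)) + 4 * m) := by
  set x := l / m with hx
  have hx0 : 0 < x := div_pos hl hm
  have hlog : Real.log l - Real.log m = Real.log x := (Real.log_div hl.ne' hm.ne').symm
  have h1 : l ^ (1 + s) * (m ^ s)⁻¹ = l * Real.exp (s * Real.log x) := by
    rw [Real.rpow_add hl, Real.rpow_one, mul_assoc, ← div_eq_mul_inv,
      ← Real.div_rpow hl.le hm.le, Real.rpow_def_of_pos hx0, mul_comm s]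
  have hlx : l = m * x := by rw [hx]; field_simp
  rw [h1, hlog]
  have key : Real.exp (s * Real.log x) ≤
      1 + s * Real.log x + s ^ 2 * (16 * x + 4 * x⁻¹) := by
    rcases le_total 0 (Real.log x) with h | h
    · have h2 := exp_le_of_nonneg (mul_nonneg hs.le h)
      have hx1 : 1 ≤ x := by
        by_contra hc
        exact absurd h (not_le.2 (Real.log_neg hx0 (not_le.1 hc)))
      have h3 : Real.exp (s * Real.log x) ≤ x ^ (1 / 2 : ℝ) := by
        rw [mul_comm, ← Real.rpow_def_of_pos hx0]
        exact Real.rpow_le_rpow_of_exponent_le hx1 hs2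
      have h4 : Real.log x ≤ 4 * x ^ (1 / 4 : ℝ) := by
        have := Real.log_le_rpow_div hx0.le (show (0 : ℝ) < 1 / 4 by norm_num)
        linarith
      have h5 : (x ^ (1 / 4 : ℝ)) ^ 2 * x ^ (1 / 2 : ℝ) = x := by
        rw [← Real.rpow_natCast, ← Real.rpow_mul hx0.le, ← Real.rpow_add hx0]
        norm_num
      have h6 : Real.log x ^ 2 * Real.exp (s * Real.log x) ≤ 16 * x := by
        calc _ ≤ (4 * x ^ (1 / 4 : ℝ)) ^ 2 * x ^ (1 / 2 : ℝ) :=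
              mul_le_mul (pow_le_pow_left₀ h h4 2) h3 (Real.exp_pos _).le (by positivity)
          _ = 16 * x := by rw [mul_pow, mul_assoc, h5]; norm_num
      have h7 := mul_le_mul_of_nonneg_left h6 (sq_nonneg s)
      have h8 : 0 ≤ s ^ 2 * (4 * x⁻¹) := by positivity
      nlinarith
    · have h2 := exp_le_of_nonpos (mul_nonpos_of_nonneg_of_nonpos hs.le h)
      have h4 : -Real.log x ≤ 2 * x⁻¹ ^ (1 / 2 : ℝ) := by
        have := Real.log_le_rpow_div (inv_pos.2 hx0).le (show (0 : ℝ) < 1 / 2 by norm_num)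
        rw [Real.log_inv] at this
        linarith
      have h5 : (x⁻¹ ^ (1 / 2 : ℝ)) ^ 2 = x⁻¹ := by
        rw [← Real.rpow_natCast, ← Real.rpow_mul (inv_pos.2 hx0).le]
        norm_num
      have h6 : Real.log x ^ 2 ≤ 4 * x⁻¹ := by
        calc Real.log x ^ 2 = (-Real.log x) ^ 2 := by ring
          _ ≤ (2 * x⁻¹ ^ (1 / 2 : ℝ)) ^ 2 := pow_le_pow_left₀ (by linarith) h4 2
          _ = 4 * x⁻¹ := by rw [mul_pow, h5]; norm_num
      have h7 := mul_le_mul_of_nonneg_left h6 (sq_nonneg s)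
      have h8 : 0 ≤ s ^ 2 * (16 * x) := by positivity
      nlinarith
  calc _ ≤ l * (1 + s * Real.log x + s ^ 2 * (16 * x + 4 * x⁻¹)) :=
        mul_le_mul_of_nonneg_left key hl.le
    _ = _ := by rw [hx]; field_simp

/-- The scalar expansion is summed against the weights |⟪e i, f j⟫|². The first-order term gives the
relative entropy; in the remainder l²/m sums to Tr ρ² σ⁻¹ ≤ 1/c, because c ρ ≤ σ, and m sums to 1.
-/
theorem tsum_petz_le {ρ σ : H →L[ℂ] H} (hρ : IsDensity ρ) (hσ : IsDensity σ) {c : ℝ} (hc : 0 < c)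
    (hle : c • ρ ≤ σ) {e : HilbertBasis ι ℂ H} {l : ι → ℝ} (he : IsEigenbasis ρ e l)
    {f : HilbertBasis κ ℂ H} {m : κ → ℝ} (hf : IsEigenbasis σ f m) {s : ℝ} (hs : 0 < s)
    (hs2 : s ≤ 1 / 2) :
    ∑' i, ∑' j, ENNReal.ofReal (‖⟪e i, f j⟫_ℂ‖ ^ 2) *
        ENNReal.ofReal (l i ^ (1 + s) * (m j ^ s)⁻¹) ≤
      1 + ENNReal.ofReal s * (∑' i, ∑' j, ENNReal.ofReal (‖⟪e i, f j⟫_ℂ‖ ^ 2) *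
        entropyTerm (l i) (m j)) + ENNReal.ofReal (s ^ 2 * (16 * c⁻¹ + 4)) := by
  have hl := he.nonneg hρ.1
  have hm := hf.nonneg hσ.1
  set u : ι → κ → ℝ≥0∞ := fun i j => ENNReal.ofReal (‖⟪e i, f j⟫_ℂ‖ ^ 2)
  have hu1 : ∀ i, ∑' j, u i j = 1 := tsum_ofReal_norm_inner_basis_sq' e f
  have hu2 : ∀ j, ∑' i, u i j = 1 := tsum_ofReal_norm_inner_basis_sq e f
  have hlsum : ∑' i, ENNReal.ofReal (l i) = 1 := by rw [← he.trace_eq hρ.1, hρ.2]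
  have hmsum : ∑' j, ENNReal.ofReal (m j) = 1 := by rw [← hf.trace_eq hσ.1, hσ.2]
  have hA : ∑' i, ∑' j, u i j * ENNReal.ofReal (l i) = 1 := by
    simp_rw [ENNReal.tsum_mul_right, hu1, one_mul]
    exact hlsum
  have hB : ∑' i, ∑' j, u i j * ENNReal.ofReal (m j) = 1 := by
    rw [ENNReal.tsum_comm]
    simp_rw [ENNReal.tsum_mul_right, hu2, one_mul]
    exact hmsum
  have hcρ : IsEigenbasis (c • ρ) e (fun i => c * l i) := fun i => by
    rw [_root_.smul_apply, he, ← Complex.coe_smul, smul_smul, Complex.ofReal_mul]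
  have hC : ∑' i, ∑' j, ENNReal.ofReal (l i) *
      (u i j * (ENNReal.ofReal (m j)⁻¹ * ENNReal.ofReal (l i))) ≤ ENNReal.ofReal c⁻¹ := by
    calc _ ≤ ∑' i, ENNReal.ofReal (l i) * ENNReal.ofReal c⁻¹ := by
          refine ENNReal.tsum_le_tsum fun i => ?_
          rw [ENNReal.tsum_mul_left]
          refine mul_le_mul_right ?_ _
          have h1 := tsum_inv_mul_norm_inner_sq_le_one (smul_nonneg hc.le hρ.1) hcρ hf hm
            (re_inner_mono hle) i
          have h2 : ∀ j, u i j * (ENNReal.ofReal (m j)⁻¹ * ENNReal.ofReal (l i)) =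
              ENNReal.ofReal c⁻¹ * (u i j *
                (ENNReal.ofReal (m j)⁻¹ * ENNReal.ofReal (c * l i))) := by
            intro j
            have h3 : ENNReal.ofReal (l i) = ENNReal.ofReal c⁻¹ * ENNReal.ofReal (c * l i) := by
              rw [← ENNReal.ofReal_mul (inv_nonneg.2 hc.le), inv_mul_cancel_left₀ hc.ne']
            rw [h3]
            ring
          simp_rw [h2]
          rw [ENNReal.tsum_mul_left]
          exact (mul_le_mul_right h1 _).trans_eq (mul_one _)
      _ = _ := by rw [ENNReal.tsum_mul_right, hlsum, one_mul]
  -- `entropyTerm` carries the correction m - l, so s m is added on the left and s l on the right;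
  -- both sum to s and cancel at the end.
  have hterm : ∀ i j, u i j * ENNReal.ofReal (l i ^ (1 + s) * (m j ^ s)⁻¹) +
      ENNReal.ofReal s * (u i j * ENNReal.ofReal (m j)) ≤
      u i j * ENNReal.ofReal (l i) + ENNReal.ofReal s * (u i j * entropyTerm (l i) (m j)) +
      ENNReal.ofReal s * (u i j * ENNReal.ofReal (l i)) +
      (ENNReal.ofReal (s ^ 2 * 16) * (ENNReal.ofReal (l i) *
        (u i j * (ENNReal.ofReal (m j)⁻¹ * ENNReal.ofReal (l i)))) +
      ENNReal.ofReal (s ^ 2 * 4) * (u i j * ENNReal.ofReal (m j))) := by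
    intro i j
    rcases (hl i).eq_or_lt with hli | hli
    · rw [← hli, Real.zero_rpow (by linarith)]
      simp [entropyTerm]
    rcases (hm j).eq_or_lt with hmj | hmj
    · simp [u, inner_eq_zero_of_smul_le hc hρ.1 hle he hf hli.ne' hmj.symm]
    have h1 := rpow_mul_inv_rpow_le hli hmj hs hs2
    have h2 := mul_negLog_add_le hli hmj
    have h3 : 0 ≤ l i * (Real.log (l i) - Real.log (m j)) + m j - l i := by linarith
    have h4 : ENNReal.ofReal (l i ^ (1 + s) * (m j ^ s)⁻¹) + ENNReal.ofReal s * ENNReal.ofReal (m j)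
        ≤ ENNReal.ofReal (l i) + ENNReal.ofReal s * entropyTerm (l i) (m j) +
        ENNReal.ofReal s * ENNReal.ofReal (l i) +
        (ENNReal.ofReal (s ^ 2 * 16) * (ENNReal.ofReal (l i) *
          (ENNReal.ofReal (m j)⁻¹ * ENNReal.ofReal (l i))) +
        ENNReal.ofReal (s ^ 2 * 4) * ENNReal.ofReal (m j)) := by
      rw [entropyTerm, if_neg fun h => hmj.ne' h.1]
      have p1 : 0 ≤ s * (l i * (Real.log (l i) - Real.log (m j)) + m j - l i) :=
        mul_nonneg hs.le h3
      rw [← ENNReal.ofReal_mul hs.le, ← ENNReal.ofReal_mul hs.le, ← ENNReal.ofReal_mul hs.le,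
        ← ENNReal.ofReal_mul (by positivity), ← ENNReal.ofReal_mul (by positivity),
        ← ENNReal.ofReal_mul (by positivity), ← ENNReal.ofReal_mul (by positivity),
        ← ENNReal.ofReal_add (by positivity) (by positivity),
        ← ENNReal.ofReal_add (by positivity) p1,
        ← ENNReal.ofReal_add (by linarith) (by positivity),
        ← ENNReal.ofReal_add (by positivity) (by positivity),
        ← ENNReal.ofReal_add (add_nonneg (by linarith) (by positivity)) (by positivity)]
      refine ENNReal.ofReal_le_ofReal ?_
      linarith
    calc _ = u i j * (ENNReal.ofReal (l i ^ (1 + s) * (m j ^ s)⁻¹) +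
          ENNReal.ofReal s * ENNReal.ofReal (m j)) := by ring
      _ ≤ _ := mul_le_mul_right h4 _
      _ = _ := by ring
  have h1 := ENNReal.tsum_le_tsum fun i => ENNReal.tsum_le_tsum fun j => hterm i j
  simp_rw [ENNReal.tsum_add, ENNReal.tsum_mul_left (a := ENNReal.ofReal s),
    ENNReal.tsum_mul_left (a := ENNReal.ofReal (s ^ 2 * 16)),
    ENNReal.tsum_mul_left (a := ENNReal.ofReal (s ^ 2 * 4))] at h1
  rw [hA, hB, mul_one, mul_one, add_right_comm _ (ENNReal.ofReal s)] at h1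
  rw [← ENNReal.add_le_add_iff_right (ENNReal.ofReal_ne_top (r := s))]
  refine h1.trans ?_
  refine add_le_add_left (add_le_add_right ?_ _) _
  rw [mul_add, ENNReal.ofReal_add (by positivity) (by positivity), ← mul_assoc (s ^ 2),
    ENNReal.ofReal_mul (p := s ^ 2 * 16) (by positivity)]
  gcongr

/-- The Petz comparison requires domination by σ, so it is applied to c ρ and scaled back. The net
power of c is 1 + s - α = -(α-1) s, so the cost -s log c vanishes with s. -/
theorem sandwichedDiv_le {ρ σ : H →L[ℂ] H} (hρ : IsDensity ρ) (hσ : IsDensity σ) {c : ℝ}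
    (hc : 0 < c) (hle : c • ρ ≤ σ) {e : HilbertBasis ι ℂ H} {l : ι → ℝ} (he : IsEigenbasis ρ e l)
    {f : HilbertBasis κ ℂ H} {m : κ → ℝ} (hf : IsEigenbasis σ f m) {α : ℝ} (hα : 1 < α)
    (hα2 : α < 2) (hD : ∑' i, ∑' j, ENNReal.ofReal (‖⟪e i, f j⟫_ℂ‖ ^ 2) *
        entropyTerm (l i) (m j) ≠ ∞) :
    sandwichedDiv α ρ σ ≤ (((∑' i, ∑' j, ENNReal.ofReal (‖⟪e i, f j⟫_ℂ‖ ^ 2) *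
        entropyTerm (l i) (m j)).toReal +
        (α - 1) / α * (16 * c⁻¹ + 4 - Real.log c) : ℝ) : EReal) := by
  set D := ∑' i, ∑' j, ENNReal.ofReal (‖⟪e i, f j⟫_ℂ‖ ^ 2) * entropyTerm (l i) (m j)
  have hα0 : 0 < α := by linarith
  have hα1 : 0 < α - 1 := by linarith
  set s := (α - 1) / α with hs
  have hs0 : 0 < s := div_pos hα1 hα0
  have hs2 : s ≤ 1 / 2 := by rw [hs, div_le_div_iff₀ hα0 two_pos]; linarith
  have hl := he.nonneg hρ.1
  have hm := hf.nonneg hσ.1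
  have hcρ : IsEigenbasis (c • ρ) e (fun i => c * l i) := fun i => by
    rw [_root_.smul_apply, he, ← Complex.coe_smul, smul_smul, Complex.ofReal_mul]
  obtain ⟨τ', hτ', htr⟩ := exists_isSandwich_of_le (smul_nonneg hc.le hρ.1) hle hcρ hf hα hα2
  rw [← hs] at htr
  have hci : 0 ≤ c⁻¹ := inv_nonneg.2 hc.le
  have hτ : IsSandwich ((α - 1) / (2 * α)) ρ σ (c⁻¹ • τ') := by
    refine ⟨smul_nonneg hci hτ'.1, fun v hv => ?_, ?_⟩
    · rw [_root_.smul_apply, hτ'.2.1 v hv, smul_zero]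
    · rw [mul_smul_comm, smul_mul_assoc, hτ'.2.2, smul_smul, inv_mul_cancel₀ hc.ne', one_smul]
  have hpetz := tsum_petz_le hρ hσ hc hle he hf hs0 hs2
  set q := 1 + s * D.toReal + s ^ 2 * (16 * c⁻¹ + 4)
  have hq0 : 0 < q := by positivity
  have hq : 1 + ENNReal.ofReal s * D + ENNReal.ofReal (s ^ 2 * (16 * c⁻¹ + 4)) =
      ENNReal.ofReal q := by
    rw [ENNReal.ofReal_add (by positivity) (by positivity),
      ENNReal.ofReal_add zero_le_one (by positivity), ENNReal.ofReal_mul hs0.le,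
      ENNReal.ofReal_toReal hD, ENNReal.ofReal_one]
  rw [hq] at hpetz
  have htr2 : trace (CFC.rpow τ' α) ≤ ENNReal.ofReal (c ^ (1 + s) * q) := by
    refine htr.trans ?_
    have h1 : ∀ i j, ENNReal.ofReal (‖⟪e i, f j⟫_ℂ‖ ^ 2) *
        ENNReal.ofReal ((c * l i) ^ (1 + s) * (m j ^ s)⁻¹) = ENNReal.ofReal (c ^ (1 + s)) *
        (ENNReal.ofReal (‖⟪e i, f j⟫_ℂ‖ ^ 2) *
        ENNReal.ofReal (l i ^ (1 + s) * (m j ^ s)⁻¹)) := by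
      intro i j
      rw [Real.mul_rpow hc.le (hl i), mul_assoc,
        ENNReal.ofReal_mul (p := c ^ (1 + s)) (by positivity)]
      ring
    simp_rw [h1, ENNReal.tsum_mul_left]
    rw [ENNReal.ofReal_mul (by positivity)]
    exact mul_le_mul_right hpetz _
  obtain ⟨_, h, t, hh⟩ := exists_eigenbasis_of_trace_rpow hτ'.1 hα0
    (ne_top_of_le_ne_top ENNReal.ofReal_ne_top htr2)
  have hh' : IsEigenbasis (c⁻¹ • τ') h (fun k => c⁻¹ * t k) := fun k => by
    rw [_root_.smul_apply, hh, ← Complex.coe_smul, smul_smul, Complex.ofReal_mul]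
  have htr3 : trace (CFC.rpow (c⁻¹ • τ') α) ≤ ENNReal.ofReal (c⁻¹ ^ α * (c ^ (1 + s) * q)) := by
    rw [hh'.trace_rpow hτ.1 hα0.le, ENNReal.ofReal_mul (by positivity)]
    rw [hh.trace_rpow hτ'.1 hα0.le] at htr2
    simp_rw [fun k => Real.mul_rpow (z := α) hci (hh.nonneg hτ'.1 k),
      fun k => ENNReal.ofReal_mul (q := t k ^ α) (show 0 ≤ c⁻¹ ^ α by positivity)]
    rw [ENNReal.tsum_mul_left]
    exact mul_le_mul_right htr2 _
  have hfin := ne_top_of_le_ne_top ENNReal.ofReal_ne_top htr3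
  rw [sandwichedDiv_eq hα hρ hσ hτ hfin]
  refine EReal.coe_le_coe ?_
  have hN0 := ENNReal.toReal_pos (trace_rpow_ne_zero hτ.1 (hτ.ne_zero hρ) hα0) hfin
  have hlog := Real.log_le_log hN0 (ENNReal.toReal_le_of_le_ofReal (by positivity) htr3)
  rw [Real.log_mul (by positivity) (by positivity), Real.log_mul (by positivity) (by positivity),
    Real.log_rpow (inv_pos.2 hc), Real.log_rpow hc, Real.log_inv] at hlog
  have hlq := Real.log_le_sub_one_of_pos hq0
  have hsα : s = (α - 1) * (1 / α) := by rw [hs]; ring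
  have hinv : 1 / α ≤ 1 := by rw [div_le_one hα0]; exact hα.le
  have hinv0 : 0 ≤ 1 / α := by positivity
  have e1 : 1 + s - α = -((α - 1) * s) := by rw [hs]; field_simp; ring
  have h1 : Real.log (trace (CFC.rpow (c⁻¹ • τ') α)).toReal ≤
      (α - 1) * (-(s * Real.log c) + 1 / α * (D.toReal + s * (16 * c⁻¹ + 4))) := by
    calc _ ≤ (1 + s - α) * Real.log c + (q - 1) := by linarith
      _ = -((α - 1) * s) * Real.log c + s * (D.toReal + s * (16 * c⁻¹ + 4)) := by
        rw [e1]; ring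
      _ = _ := by
        conv_lhs => rw [show s * (D.toReal + s * (16 * c⁻¹ + 4)) =
          ((α - 1) * (1 / α)) * (D.toReal + s * (16 * c⁻¹ + 4)) by rw [← hsα]]
        ring
  rw [one_div, inv_mul_le_iff₀ hα1]
  refine h1.trans (mul_le_mul_of_nonneg_left ?_ hα1.le)
  have h2 : 0 ≤ D.toReal + s * (16 * c⁻¹ + 4) := by positivity
  have h3 := mul_le_mul_of_nonneg_right hinv h2
  linarith

end Lower

/-! ### Positivity of the exponent -/

section Main

variable {X : Type*} [Fintype X] {p : X → ℝ}
variable {H : Type*} [NormedAddCommGroup H] [InnerProductSpace ℂ H] [CompleteSpace H]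
variable {ρ : X → H →L[ℂ] H} {R : ℝ}

/-- The marginal itself serves as σ: it dominates p x • ρ x, so its objective exceeds the mutual
information by at most s C with s = (α-1)/α, and α is taken close to 1. -/
theorem exists_augustinInfo_lt (hp : ∀ x, 0 ≤ p x) (hp1 : ∑ x, p x = 1)
    (hρ : ∀ x, IsDensity (ρ x)) (h : (mutualInfo p ρ : EReal) < (R : EReal)) :
    ∃ α ∈ Set.Ioo (1 : ℝ) 2, augustinInfo α p ρ < (R : EReal) := by
  have hβ := isDensity_marginal hp hp1 hρ
  obtain ⟨_, g, r, hg⟩ := hβ.exists_eigenbasis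
  choose S e l he using fun x => (hρ x).exists_eigenbasis
  have hI := mutualInfo_eq hp he hg
  set D : X → ℝ≥0∞ := fun x => ∑' i, ∑' j, ENNReal.ofReal (‖⟪e x i, g j⟫_ℂ‖ ^ 2) *
    entropyTerm (l x i) (r j)
  have hItop : mutualInfo p ρ ≠ ∞ := by
    intro h1
    rw [h1] at h
    exact not_top_lt h
  have hDtop : ∀ x, p x ≠ 0 → D x ≠ ∞ := by
    intro x hx h1
    refine hItop ?_
    rw [hI, ENNReal.sum_eq_top]
    refine ⟨x, Finset.mem_univ x, ?_⟩
    change ENNReal.ofReal (p x) * D x = ∞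
    rw [h1, ENNReal.mul_top]
    simpa using (hp x).lt_of_ne' hx
  have hIreal : (mutualInfo p ρ).toReal = ∑ x, p x * (D x).toReal := by
    rw [hI, ENNReal.toReal_sum]
    · exact Finset.sum_congr rfl fun x _ => by
        rw [ENNReal.toReal_mul, ENNReal.toReal_ofReal (hp x)]
    · intro x _
      by_cases hx : p x = 0
      · simp [hx]
      · exact ENNReal.mul_ne_top ENNReal.ofReal_ne_top (hDtop x hx)
  have hIR : (mutualInfo p ρ).toReal < R := by
    rw [← EReal.coe_lt_coe_iff, EReal.coe_ennreal_toReal hItop]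
    exact h
  set C := ∑ x, p x * (16 * (p x)⁻¹ + 4 - Real.log (p x))
  have hb : ∀ α ∈ Set.Ioo (1 : ℝ) 2, augustinInfo α p ρ ≤
      (((mutualInfo p ρ).toReal + (α - 1) / α * C : ℝ) : EReal) := by
    intro α hα
    refine (iInf₂_le _ hβ).trans ?_
    have h1 : ∀ x, (p x : EReal) * sandwichedDiv α (ρ x) (marginal p ρ) ≤
        ((p x * ((D x).toReal + (α - 1) / α * (16 * (p x)⁻¹ + 4 - Real.log (p x))) : ℝ) : EReal) := by
      intro x
      by_cases hx : p x = 0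
      · simp [hx]
      · rw [EReal.coe_mul]
        exact mul_le_mul_of_nonneg_left (sandwichedDiv_le (hρ x) hβ ((hp x).lt_of_ne' hx)
          (smul_le_marginal hp (fun x => (hρ x).1) x) (he x) hg hα.1 hα.2 (hDtop x hx))
          (by exact_mod_cast hp x)
    refine (Finset.sum_le_sum fun x _ => h1 x).trans (le_of_eq ?_)
    rw [sum_coe_real, hIreal]
    congr 1
    simp only [C]
    rw [Finset.mul_sum, ← Finset.sum_add_distrib]
    exact Finset.sum_congr rfl fun x _ => by ring
  set δ := R - (mutualInfo p ρ).toReal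
  have hδ : 0 < δ := sub_pos.2 hIR
  -- Chosen so that α = 1 + ε < 2 and ε |C| < δ; s ≤ ε then suffices. The summand +1 avoids dividing
  -- by zero when C = 0.
  set ε := min (1 / 2) (δ / (2 * (|C| + 1)))
  have hε : 0 < ε := lt_min (by norm_num) (by positivity)
  have hε2 : ε ≤ 1 / 2 := min_le_left _ _
  have hα : 1 + ε ∈ Set.Ioo (1 : ℝ) 2 := ⟨by linarith, by linarith⟩
  refine ⟨1 + ε, hα, (hb _ hα).trans_lt ?_⟩
  rw [EReal.coe_lt_coe_iff]
  have h1 : (1 + ε - 1) / (1 + ε) ≤ ε := by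
    rw [add_sub_cancel_left, div_le_iff₀ (by linarith)]
    nlinarith
  have h0 : 0 ≤ (1 + ε - 1) / (1 + ε) := by
    rw [add_sub_cancel_left]
    positivity
  have h2 : (1 + ε - 1) / (1 + ε) * C ≤ ε * |C| :=
    (mul_le_mul_of_nonneg_left (le_abs_self C) h0).trans
      (mul_le_mul_of_nonneg_right h1 (abs_nonneg C))
  have h3 : ε * (2 * (|C| + 1)) ≤ δ := by
    rw [← le_div_iff₀ (by positivity)]
    exact min_le_right _ _
  have h4 := abs_nonneg C
  have h5 : ε * |C| < δ := by nlinarith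
  simp only [δ] at h5
  linarith

theorem coe_mul_pos_iff_of_neg {a : ℝ} (ha : a < 0) (y : EReal) : 0 < (a : EReal) * y ↔ y < 0 := by
  induction y with
  | bot => simp [EReal.coe_mul_bot_of_neg ha]
  | top => simp [EReal.coe_mul_top_of_neg ha]
  | coe y =>
    norm_cast
    exact ⟨fun h => by by_contra hy; nlinarith [not_lt.1 hy], fun h => mul_pos_of_neg_of_neg ha h⟩

/-- A supremum is positive iff some term is, and the negative factor (1-α)/α turns this into an
Augustin information below R for some α in (1,2). -/
theorem augustinExponent_pos_iff (hp : ∀ x, 0 ≤ p x) (hp1 : ∑ x, p x = 1)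
    (hρ : ∀ x, IsDensity (ρ x)) :
    0 < augustinExponent p ρ R ↔ (mutualInfo p ρ : EReal) < (R : EReal) := by
  have h1 : 0 < augustinExponent p ρ R ↔
      ∃ α ∈ Set.Ioo (1 : ℝ) 2, augustinInfo α p ρ < (R : EReal) := by
    unfold augustinExponent
    simp only [lt_iSup_iff, exists_prop]
    refine exists_congr fun α => and_congr_right fun hα => ?_
    rw [coe_mul_pos_iff_of_neg (div_neg_of_neg_of_pos (by linarith [hα.1]) (by linarith [hα.1]))]
    exact EReal.sub_neg (Or.inr (EReal.coe_ne_top R)) (Or.inr (EReal.coe_ne_bot R))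
  rw [h1]
  refine ⟨fun ⟨α, hα, h⟩ => ?_, exists_augustinInfo_lt hp hp1 hρ⟩
  unfold augustinInfo at h
  obtain ⟨σ, h⟩ := iInf_lt_iff.1 h
  obtain ⟨hσ, h⟩ := iInf_lt_iff.1 h
  exact (mutualInfo_le hp hp1 hρ hα.1 hσ (h.trans (EReal.coe_lt_top R)).ne).trans_lt h

end Main

end SoftCovering

end

theorem mainTheorem4 {X : Type*} [Fintype X]
    {H : Type*} [NormedAddCommGroup H] [InnerProductSpace ℂ H] [CompleteSpace H]
    {ι : Type*} (b : HilbertBasis ι ℂ H)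
    (p : X → ℝ) (hp : ∀ x, 0 ≤ p x) (hp1 : ∑ x, p x = 1)
    (ρ : X → H →L[ℂ] H) (hρ : ∀ x, SoftCovering.IsDensity (ρ x))
    (n M : ℕ) (hn : 1 ≤ n) (hM : 1 ≤ M) (hnp : ∀ x, ∃ k : ℕ, (n : ℝ) * p x = k)
    (R : ℝ) (hR : R = 1 / n * Real.log M) :
    SoftCovering.expectedTraceDist b p ρ n M ≤
        EReal.exp (-((n : EReal) * SoftCovering.augustinExponent p ρ R)) ∧
      (0 < SoftCovering.augustinExponent p ρ R ↔
        (SoftCovering.mutualInfo p ρ : EReal) < (R : EReal)) :=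
  ⟨SoftCovering.expectedTraceDist_le_exp_augustinExponent b hp hp1 hρ hn hM hnp hR,
    SoftCovering.augustinExponent_pos_iff hp hp1 hρ⟩
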